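/- **Setting.** Manifolds are real, smooth, finite-dimensional, Hausdorff and second countable. Let $G$ be a real Lie group with semisimple Lie algebra $\mathfrak g$ (a complex Lie group is regarded as a real one), with a $|k|$-grading $\mathfrak g=\mathfrak g_{-k}\oplus\dots\oplus\mathfrak g_k$ ($[\mathfrak g_i,\mathfrak g_j]\subseteq\mathfrak g_{i+j}$, and $\mathfrak g_{-k}\oplus\dots\oplus\mathfrak g_{-1}$ generated by $\mathfrak g_{-1}$), and let $P\subset G$ be a closed subgroup whose Lie algebra is the parabolic subalgebra $\mathfrak p=\mathfrak g_0\oplus\dots\oplus\mathfrak g_k$. Put $\mathfrak p_+=\mathfrak g_1\oplus\dots\oplus\mathfrak g_k$, $P_+=\exp(\mathfrak p_+)$ and $G_0=\{g\in P:\mathrm{Ad}(g)\mathfrak g_i=\mathfrak g_i\ \text{for all } i\}$. Let $(\pi:\mathcal G\to M,\omega)$ be a parabolic geometry of type $(G,P)$, that is, a principal $P$-bundle with a Cartan connection $\omega\in\Omega^1(\mathcal G,\mathfrak g)$, and let $\mathcal G_0=\mathcal G/P_+$, with projection $\pi_+:\mathcal G\to\mathcal G_0$. Fix an element $E_\lambda$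 of the center of $\mathfrak g_0$ that acts on each $\mathfrak g_i$ by a real scalar, nonzero for $i\neq0$, and a smooth homomorphism $\lambda:G_0\to\mathbb R_+$ with $\lambda'(A)=B(E_\lambda,A)$ for $A\in\mathfrak g_0$, $B$ the Killing form. Let $\mathcal L^\lambda\to M$ be the associated principal $\mathbb R_+$-bundle $\mathcal G_0\times_{G_0}\mathbb R_+$. A *global scale* is a smooth section of $\mathcal L^\lambda$. A *Weyl structure* is a smooth $G_0$-equivariant section $\sigma:\mathcal G_0\to\mathcal G$ of $\pi_+$. With $\omega_0$ the $\mathfrak g_0$-component of $\omega$, the form $\lambda'\circ\sigma^*\omega_0$ induces a principal connection $\sigma^\lambda$ on $\mathcal L^\lambda$. An *exact Weyl structure* is a Weyl structure $\sigma$ with a corresponding global scale $s_\sigma$, which means that $\sigma^\lambda$ is the trivial connection induced by $s_\sigma$ (i.e. $s_\sigma$ is parallel). Let $\mathrm{Aut}(\mathcal G,\omega)$ be the group of diffeomorphisms $\Phi$ of $\mathcal G$ that commute with the right $P$-action and satisfy $\Phi^*\omega=\omega$, with the compact-open topology. Each $\Phi$ induces maps $\Phi_0$ of $\mathcal G_0$,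 $\Phi_\lambda$ of $\mathcal L^\lambda$ and $\varphi$ of $M$, and $\mathrm{Aut}(\mathcal G,\omega)$ acts on $M$ through $\varphi$. Put $\mathrm{Aut}(\sigma)=\{\Phi:\Phi^{-1}\circ\sigma\circ\Phi_0=\sigma\}$ for a Weyl structure $\sigma$, and $\mathrm{Aut}(\overline\sigma)=\{\Phi:\Phi_\lambda^{-1}\circ s_\sigma\circ\varphi=s_\sigma\}$ if $\sigma$ is exact. The geometry is *essential* if $\mathrm{Aut}(\overline\sigma)\subsetneq\mathrm{Aut}(\mathcal G,\omega)$ for every exact Weyl structure $\sigma$. **Proposition.** If $(\mathcal G\to M,\omega)$ is essential, then $\mathrm{Aut}(\mathcal G,\omega)$ does not act properly on $M$. Equivalently, if $\mathrm{Aut}(\mathcal G,\omega)$ acts properly on $M$, then there is a global scale invariant under all automorphisms; it corresponds to an exact Weyl structure $\sigma$ with $\mathrm{Aut}(\overline\sigma)=\mathrm{Aut}(\sigma)=\mathrm{Aut}(\mathcal G,\omega)$. -/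

import Mathlib

open scoped Manifold ContDiff TensorProduct RightActions

noncomputable section

namespace ParabolicGeometry

/-! ### Lie groups, the adjoint representation, one-parameter groups

All manifolds are finite-dimensional real `C^∞` manifolds without boundary.  A complex Lie group is
regarded as a real Lie group. -/

section LieGroups

/-- A smooth Lie group is regular enough for Mathlib's Lie bracket on its Lie algebra. -/
instance lieGroupMinSmoothness {n : ℕ} {G : Type*} [TopologicalSpace G]
    [ChartedSpace (EuclideanSpace ℝ (Fin n)) G] [Group G] [LieGroup (𝓡 n) ∞ G] :
    LieGroup (𝓡 n) (minSmoothness ℝ 3) G := by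
  rw [minSmoothness_of_isRCLikeNormedField]
  infer_instance

variable {n m : ℕ} {G : Type*} [TopologicalSpace G]
  [ChartedSpace (EuclideanSpace ℝ (Fin n)) G] [Group G]

/-- The adjoint representation: `Ad g` is the derivative at `1` of `x ↦ g x g⁻¹`. -/
def Ad (n : ℕ) {G : Type*} [TopologicalSpace G] [ChartedSpace (EuclideanSpace ℝ (Fin n)) G]
    [Group G] (g : G) : GroupLieAlgebra (𝓡 n) G →L[ℝ] GroupLieAlgebra (𝓡 n) G :=
  mfderiv (𝓡 n) (𝓡 n) (fun x : G => g * x * g⁻¹) 1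

theorem Ad_one : Ad n (1 : G) = ContinuousLinearMap.id ℝ _ := by
  have h : (fun x : G => 1 * x * 1⁻¹) = id := by ext x; simp
  unfold Ad
  rw [h]
  exact mfderiv_id

theorem mdifferentiable_conj [LieGroup (𝓡 n) ∞ G] (g : G) :
    MDifferentiable (𝓡 n) (𝓡 n) (fun x : G => g * x * g⁻¹) :=
  ((contMDiff_mul_right (I := 𝓡 n) (n := ∞) (a := g⁻¹)).comp
    (contMDiff_mul_left (I := 𝓡 n) (n := ∞) (a := g))).mdifferentiable (by simp)

theorem Ad_mul [LieGroup (𝓡 n) ∞ G] (g h : G) : Ad n (g * h) = (Ad n g).comp (Ad n h) := by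
  have e : (fun x : G => g * h * x * (g * h)⁻¹)
      = (fun x : G => g * x * g⁻¹) ∘ (fun x : G => h * x * h⁻¹) := by
    ext x; simp [mul_assoc]
  have h1 : h * 1 * h⁻¹ = (1 : G) := by simp
  unfold Ad
  rw [e, mfderiv_comp (I' := 𝓡 n) (1 : G) (mdifferentiable_conj g _) (mdifferentiable_conj h _)]
  congr 1
  rw [h1]

/-- `P` is a closed subgroup of the Lie group `G`, with its structure of embedded Lie subgroup
(the topology on `P` is the subspace topology). -/
structure IsClosedLieSubgroup (P : Subgroup G) [ChartedSpace (EuclideanSpace ℝ (Fin m)) P] :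
    Prop where
  isClosed : IsClosed (P : Set G)
  contMDiff : ContMDiff (𝓡 m) (𝓡 n) ∞ (fun p : P => (p : G))
  immersion : ∀ p : P, Function.Injective (mfderiv (𝓡 m) (𝓡 n) (fun p : P => (p : G)) p)

/-- The derivative at `1` of the inclusion, identifying the Lie algebra of `P` with a subalgebra
of the Lie algebra of `G`. -/
def lieIncl (n m : ℕ) {G : Type*} [TopologicalSpace G]
    [ChartedSpace (EuclideanSpace ℝ (Fin n)) G] [Group G]
    (P : Subgroup G) [ChartedSpace (EuclideanSpace ℝ (Fin m)) P] :
    GroupLieAlgebra (𝓡 m) P →L[ℝ] GroupLieAlgebra (𝓡 n) G :=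
  mfderiv (𝓡 m) (𝓡 n) (fun p : P => (p : G)) 1

/-- `γ(t) = exp(tX)` for the vector `X` of the Lie algebra: `γ` is a smooth one-parameter group
with initial velocity `X`. -/
structure IsOneParameterGroup (n : ℕ) {G : Type*} [TopologicalSpace G]
    [ChartedSpace (EuclideanSpace ℝ (Fin n)) G] [Group G]
    (γ : ℝ → G) (X : GroupLieAlgebra (𝓡 n) G) : Prop where
  contMDiff : ContMDiff 𝓘(ℝ, ℝ) (𝓡 n) ∞ γ
  map_zero : γ 0 = 1
  map_add : ∀ s t, γ (s + t) = γ s * γ t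
  velocity : (mfderiv 𝓘(ℝ, ℝ) (𝓡 n) γ 0 : ℝ →L[ℝ] GroupLieAlgebra (𝓡 n) G) 1 = X

end LieGroups

/-! ### Gradings and parabolic subalgebras -/

section Algebra

variable {L : Type*} [LieRing L] [LieAlgebra ℝ L]

/-- A `|k|`-grading `L = L_{-k} ⊕ ⋯ ⊕ L_k`, with `L_{-k} ⊕ ⋯ ⊕ L_{-1}` generated by `L_{-1}`. -/
structure KGrading (L : Type*) [LieRing L] [LieAlgebra ℝ L] where
  k : ℕ
  piece : ℤ → Submodule ℝ L
  isInternal : DirectSum.IsInternal piece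
  eq_bot : ∀ i : ℤ, (k : ℤ) < |i| → piece i = ⊥
  lie_mem : ∀ i j : ℤ, ∀ X ∈ piece i, ∀ Y ∈ piece j, ⁅X, Y⁆ ∈ piece (i + j)
  generates : (LieSubalgebra.lieSpan ℝ L (piece (-1) : Set L)).toSubmodule
    = ⨆ i : ℤ, ⨆ _ : i < 0, piece i

namespace KGrading

/-- The filtration component `L^i = L_i ⊕ ⋯ ⊕ L_k`. -/
def filt (gr : KGrading L) (i : ℤ) : Submodule ℝ L := ⨆ j : ℤ, ⨆ _ : i ≤ j, gr.piece j

theorem piece_le_filt (gr : KGrading L) {i j : ℤ} (h : i ≤ j) : gr.piece j ≤ gr.filt i :=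
  le_iSup₂_of_le j h le_rfl

theorem lie_mem_filt (gr : KGrading L) {X Y : L} (hX : X ∈ gr.filt 0) (hY : Y ∈ gr.filt 0) :
    ⁅X, Y⁆ ∈ gr.filt 0 := by
  have key : ∀ j : ℤ, 0 ≤ j → ∀ Z ∈ gr.piece j, ∀ W ∈ gr.filt 0, ⁅W, Z⁆ ∈ gr.filt 0 := by
    intro j hj Z hZ W hW
    let f : L →ₗ[ℝ] L := -(LieAlgebra.ad ℝ L Z : L →ₗ[ℝ] L)
    have hf : ∀ V, f V = ⁅V, Z⁆ := fun V => by simp [f]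
    have : gr.filt 0 ≤ (gr.filt 0).comap f := by
      refine iSup₂_le fun i hi V hV => ?_
      rw [Submodule.mem_comap, hf]
      exact gr.piece_le_filt (by omega) (gr.lie_mem i j V hV Z hZ)
    have h := this hW
    rwa [Submodule.mem_comap, hf] at h
  have : gr.filt 0 ≤ (gr.filt 0).comap (LieAlgebra.ad ℝ L X : L →ₗ[ℝ] L) :=
    iSup₂_le fun j hj Z hZ => key j hj Z hZ X hX
  exact this hY

/-- The subalgebra `L_0 ⊕ ⋯ ⊕ L_k`. -/
def parabolic (gr : KGrading L) : LieSubalgebra ℝ L :=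
  { gr.filt 0 with lie_mem' := fun hX hY => gr.lie_mem_filt hX hY }

/-- The projection of `L` onto the grading component `L_i` (as an endomorphism of `L`). -/
def proj (gr : KGrading L) (i : ℤ) : L →ₗ[ℝ] L :=
  (gr.piece i).subtype ∘ₗ DirectSum.component ℝ ℤ (fun j => gr.piece j) i ∘ₗ
    (LinearEquiv.ofBijective (DirectSum.coeLinearMap gr.piece) gr.isInternal).symm.toLinearMap

end KGrading

/-- A Borel subalgebra of a complex Lie algebra: a maximal solvable subalgebra. -/
def IsBorel {L : Type*} [LieRing L] [LieAlgebra ℂ L] (b : LieSubalgebra ℂ L) : Prop :=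
  Maximal (fun b' : LieSubalgebra ℂ L => LieAlgebra.IsSolvable b') b

/-- A subalgebra of a real Lie algebra is parabolic if its complexification contains a Borel
subalgebra of the complexified Lie algebra. -/
def IsParabolicSubalgebra (p : LieSubalgebra ℝ L) : Prop :=
  ∃ b : LieSubalgebra ℂ (ℂ ⊗[ℝ] L), IsBorel b ∧ b ≤ p.baseChange ℂ

end Algebra

/-! ### Parabolic types `(G, P)`, the groups `G₀` and `P₊`, scale representations -/

section Types

variable {n m : ℕ} {G : Type*} [TopologicalSpace G]
  [ChartedSpace (EuclideanSpace ℝ (Fin n)) G] [Group G] [LieGroup (𝓡 n) ∞ G]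
  (P : Subgroup G) [ChartedSpace (EuclideanSpace ℝ (Fin m)) P]
  (gr : KGrading (GroupLieAlgebra (𝓡 n) G))

/-- `G` is semisimple, and the closed subgroup `P` is parabolic with Lie algebra
`p = g_0 ⊕ ⋯ ⊕ g_k` for the given grading of the Lie algebra `g` of `G`. -/
structure IsParabolicType : Prop where
  semisimple : LieAlgebra.IsSemisimple ℝ (GroupLieAlgebra (𝓡 n) G)
  closedSubgroup : IsClosedLieSubgroup (n := n) (m := m) P
  lieAlgebra_eq : LinearMap.range (lieIncl n m P).toLinearMap
    = gr.parabolic.toSubmodule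
  parabolic : IsParabolicSubalgebra gr.parabolic

/-- The Levi subgroup `G₀ ⊂ P`: the elements whose adjoint action preserves the grading. -/
def GZero : Subgroup P where
  carrier := {p | ∀ i, (gr.piece i).map (Ad n (p : G)).toLinearMap
    = gr.piece i}
  one_mem' := by
    intro i
    rw [OneMemClass.coe_one, Ad_one]
    exact Submodule.map_id _
  mul_mem' := by
    intro a b ha hb i
    have h : (Ad n ((a * b : P) : G)).toLinearMap
        = (Ad n (a : G)).toLinearMap ∘ₗ
          (Ad n (b : G)).toLinearMap := by
      rw [Subgroup.coe_mul, Ad_mul]; rfl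
    rw [h, Submodule.map_comp, hb i, ha i]
  inv_mem' := by
    intro a ha i
    have h : (Ad n ((a⁻¹ : P) : G)).toLinearMap ∘ₗ
        (Ad n (a : G)).toLinearMap = LinearMap.id := by
      have h2 := Ad_mul (n := n) ((a⁻¹ : P) : G) (a : G)
      rw [← Subgroup.coe_mul, inv_mul_cancel, OneMemClass.coe_one, Ad_one] at h2
      ext x
      exact (congrArg (fun T : GroupLieAlgebra (𝓡 n) G →L[ℝ] GroupLieAlgebra (𝓡 n) G => T x)
        h2).symm
    conv_lhs => rw [← ha i]
    rw [← Submodule.map_comp, h, Submodule.map_id]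

/-- The subgroup `P₊ ⊂ P` generated by `exp(p₊)`, `p₊ = g_1 ⊕ ⋯ ⊕ g_k` (for a parabolic type,
`exp(p₊)` is itself already a subgroup). -/
def PPlus : Subgroup P :=
  Subgroup.closure {p | ∃ (γ : ℝ → P) (X : GroupLieAlgebra (𝓡 n) G), X ∈ gr.filt 1 ∧
    IsOneParameterGroup n (fun t => (γ t : G)) X ∧ γ 1 = p}

/-- A scale representation: an element `E = E_λ` of the center of `g_0` acting on each `g_i` by a
real scalar (nonzero for `i ≠ 0`), and a smooth homomorphism `λ : G₀ → ℝ_{>0}` with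
`λ'(A) = B(E_λ, A)` for `A ∈ g_0`, where `B` is the Killing form. -/
structure ScaleRepresentation where
  E : GroupLieAlgebra (𝓡 n) G
  E_mem : E ∈ gr.piece 0
  E_central : ∀ X ∈ gr.piece 0, ⁅E, X⁆ = 0
  E_scalar : ∀ i : ℤ, i ≠ 0 → ∃ a : ℝ, a ≠ 0 ∧ ∀ X ∈ gr.piece i, ⁅E, X⁆ = a • X
  toHom : GZero P gr →* ℝ
  pos : ∀ g, 0 < toHom g
  /-- smoothness on the closed subgroup `G₀` of `P`: locally, `λ` is the restriction of a smooth
  function on `P` -/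
  smooth : ∀ g : GZero P gr, ∃ f : P → ℝ, ContMDiffAt (𝓡 m) 𝓘(ℝ, ℝ) ∞ f (g : P) ∧
    ∀ᶠ p in nhds (g : P), ∀ hp : p ∈ GZero P gr, f p = toHom ⟨p, hp⟩
  deriv : ∀ (γ : ℝ → P) (A : GroupLieAlgebra (𝓡 n) G) (h : ∀ t, γ t ∈ GZero P gr),
    IsOneParameterGroup n (fun t => (γ t : G)) A →
    HasDerivAt (fun t => toHom ⟨γ t, h t⟩) (killingForm ℝ (GroupLieAlgebra (𝓡 n) G) E A) 0

end Types

/-- The differential `df_x : T_x M → ℝ` of a real-valued function on a manifold. -/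
def realDifferential {d : ℕ} {M : Type*} [TopologicalSpace M]
    [ChartedSpace (EuclideanSpace ℝ (Fin d)) M] (f : M → ℝ) (x : M) :
    TangentSpace (𝓡 d) x →L[ℝ] ℝ :=
  mfderiv (𝓡 d) 𝓘(ℝ, ℝ) f x

/-! ### Cartan geometries and their automorphisms -/

section Cartan

/-- A Cartan geometry of type `(G, P)` on `M`: a smooth principal `P`-bundle `π : B → M` (the right
action of `p` on `u` is `u <• p`), with a Cartan connection `ω` (the field `cartan`), a smooth one-form on `B` with
values in the Lie algebra of `G`. -/
structure CartanGeometry (n m b d : ℕ) {G : Type*} [TopologicalSpace G]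
    [ChartedSpace (EuclideanSpace ℝ (Fin n)) G] [Group G]
    (P : Subgroup G) [ChartedSpace (EuclideanSpace ℝ (Fin m)) P]
    (B : Type*) [TopologicalSpace B] [ChartedSpace (EuclideanSpace ℝ (Fin b)) B]
    [IsManifold (𝓡 b) ∞ B] [MulAction Pᵐᵒᵖ B]
    (M : Type*) [TopologicalSpace M] [ChartedSpace (EuclideanSpace ℝ (Fin d)) M] where
  π : B → M
  contMDiff_π : ContMDiff (𝓡 b) (𝓡 d) ∞ π
  contMDiff_act : ContMDiff ((𝓡 b).prod (𝓡 m)) (𝓡 b) ∞ (fun x : B × P => x.1 <• x.2)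
  π_act : ∀ (u : B) (p : P), π (u <• p) = π u
  /-- local triviality: near each point there is a smooth local section `τ` of `π` such that
  `(y, p) ↦ τ(y) p` is a diffeomorphism of `U × P` onto `π⁻¹(U)`, with inverse
  `u ↦ (π(u), κ(u))` -/
  locallyTrivial : ∀ x : M, ∃ (U : Set M) (τ : M → B) (κ : B → P), IsOpen U ∧ x ∈ U ∧
    ContMDiffOn (𝓡 d) (𝓡 b) ∞ τ U ∧ ContMDiffOn (𝓡 b) (𝓡 m) ∞ κ (π ⁻¹' U) ∧
    (∀ y ∈ U, π (τ y) = y) ∧ (∀ u ∈ π ⁻¹' U, τ (π u) <• κ u = u) ∧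
    (∀ y ∈ U, ∀ p : P, κ (τ y <• p) = p)
  cartan : ∀ u : B, TangentSpace (𝓡 b) u →L[ℝ] GroupLieAlgebra (𝓡 n) G
  contMDiff_cartan : ContMDiff (M' := EuclideanSpace ℝ (Fin n)) (𝓡 b).tangent (𝓡 n) ∞
    (fun v : TangentBundle (𝓡 b) B => cartan v.1 v.2)
  /-- `R_p^* ω = Ad(p⁻¹) ∘ ω` -/
  equivariant : ∀ (p : P) (u : B) (v : TangentSpace (𝓡 b) u),
    cartan (u <• p) (mfderiv (𝓡 b) (𝓡 b) (fun u : B => u <• p) u v) = Ad n (p : G)⁻¹ (cartan u v)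
  /-- `ω` reproduces the generators of the fundamental vector fields, `ω(X̃) = X` -/
  fundamental : ∀ (u : B) (X : GroupLieAlgebra (𝓡 m) P),
    cartan u ((mfderiv (𝓡 m) (𝓡 b) (fun p : P => u <• p) 1 :
      GroupLieAlgebra (𝓡 m) P →L[ℝ] TangentSpace (𝓡 b) u) X) = lieIncl n m P X
  bijective : ∀ u : B, Function.Bijective (cartan u)

namespace CartanGeometry

variable {n m b d : ℕ} {G : Type*} [TopologicalSpace G]
  [ChartedSpace (EuclideanSpace ℝ (Fin n)) G] [Group G]
  {P : Subgroup G} [ChartedSpace (EuclideanSpace ℝ (Fin m)) P]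
  {B : Type*} [TopologicalSpace B] [ChartedSpace (EuclideanSpace ℝ (Fin b)) B]
  [IsManifold (𝓡 b) ∞ B] [MulAction Pᵐᵒᵖ B]
  {M : Type*} [TopologicalSpace M] [ChartedSpace (EuclideanSpace ℝ (Fin d)) M]
  (C : CartanGeometry n m b d P B M)

theorem exists_π_eq (x : M) : ∃ u, C.π u = x := by
  obtain ⟨U, τ, κ, -, hx, -, -, h, -⟩ := C.locallyTrivial x
  exact ⟨τ x, h x hx⟩

theorem exists_act_eq {u u' : B} (h : C.π u = C.π u') : ∃ p : P, u' = u <• p := by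
  obtain ⟨U, τ, κ, -, hx, -, -, -, hκ, -⟩ := C.locallyTrivial (C.π u)
  have h1 := hκ u hx
  have h2 := hκ u' (by rw [Set.mem_preimage, ← h]; exact hx)
  refine ⟨(κ u)⁻¹ * κ u', ?_⟩
  rw [← h] at h2
  rw [MulOpposite.op_mul, mul_smul]
  conv_lhs => rw [← h2]
  congr 1
  rw [MulOpposite.op_inv, eq_inv_smul_iff]
  exact h1

/-- The automorphism group `Aut(B, ω)`: the diffeomorphisms `Φ` of `B` that commute with the right
action of `P` and satisfy `Φ^* ω = ω`. -/
def Aut : Subgroup (B ≃ₜ B) where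
  carrier := {Φ | ContMDiff (𝓡 b) (𝓡 b) ∞ Φ ∧ ContMDiff (𝓡 b) (𝓡 b) ∞ Φ.symm ∧
    (∀ (u : B) (p : P), Φ (u <• p) = Φ u <• p) ∧
    ∀ (u : B) (v : TangentSpace (𝓡 b) u), C.cartan (Φ u) (mfderiv (𝓡 b) (𝓡 b) Φ u v) = C.cartan u v}
  one_mem' := by
    refine ⟨contMDiff_id, contMDiff_id, fun _ _ => rfl, fun u v => ?_⟩
    have : mfderiv (𝓡 b) (𝓡 b) (⇑(1 : B ≃ₜ B)) u = ContinuousLinearMap.id ℝ _ := mfderiv_id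
    rw [this]
    rfl
  mul_mem' := by
    rintro Φ Ψ ⟨h1, h2, h3, h4⟩ ⟨k1, k2, k3, k4⟩
    refine ⟨h1.comp k1, k2.comp h2, fun u p => ?_, fun u v => ?_⟩
    · rw [Homeomorph.mul_apply, Homeomorph.mul_apply, k3, h3]
    · have e : mfderiv (𝓡 b) (𝓡 b) (⇑(Φ * Ψ)) u
          = (mfderiv (𝓡 b) (𝓡 b) Φ (Ψ u)).comp (mfderiv (𝓡 b) (𝓡 b) Ψ u) :=
        mfderiv_comp (I' := 𝓡 b) u (h1.mdifferentiable (by simp) _)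
          (k1.mdifferentiable (by simp) _)
      rw [e]
      exact (h4 (Ψ u) _).trans (k4 u v)
  inv_mem' := by
    rintro Φ ⟨h1, h2, h3, h4⟩
    refine ⟨h2, h1, fun u p => ?_, fun u v => ?_⟩
    · apply Φ.injective
      rw [h3]
      simp
    · have hu : Φ (Φ.symm u) = u := Φ.apply_symm_apply u
      have e : (mfderiv (𝓡 b) (𝓡 b) Φ (Φ.symm u)).comp (mfderiv (𝓡 b) (𝓡 b) Φ.symm u)
          = mfderiv (𝓡 b) (𝓡 b) (Φ ∘ Φ.symm) u :=
        (mfderiv_comp (I' := 𝓡 b) u (h1.mdifferentiable (by simp) _)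
          (h2.mdifferentiable (by simp) _)).symm
      have e2 : (Φ ∘ Φ.symm : B → B) = id := by ext x; simp
      have h := h4 (Φ.symm u) (mfderiv (𝓡 b) (𝓡 b) Φ.symm u v)
      refine Eq.trans h.symm ?_
      have e3 := congrArg (fun T : EuclideanSpace ℝ (Fin b) →L[ℝ] EuclideanSpace ℝ (Fin b) => T v) e
      rw [e2] at e3
      have e4 := e3.trans (congrArg
        (fun T : EuclideanSpace ℝ (Fin b) →L[ℝ] EuclideanSpace ℝ (Fin b) => T v)
        (mfderiv_id (I := 𝓡 b) (x := u)))
      have e5 : ∀ (x y : B), x = y → ∀ w : EuclideanSpace ℝ (Fin b),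
          (C.cartan x w : EuclideanSpace ℝ (Fin n)) = C.cartan y w := by
        rintro x _ rfl w; rfl
      exact (congrArg (C.cartan (Φ (Φ.symm u))) e4).trans (e5 _ _ hu v)

/-- The topology of `Aut(B, ω)`: uniform convergence on compact sets of the automorphisms and of
their inverses (compact-open topology). -/
instance : TopologicalSpace C.Aut :=
  TopologicalSpace.induced
    (fun Φ : C.Aut => ((Φ.1 : C(B, B)), (Φ.1.symm : C(B, B)))) inferInstance

/-- The diffeomorphism `φ` of `M` induced by an automorphism `Φ`, see `baseMap_π`. -/
def baseMap (Φ : C.Aut) (x : M) : M := C.π (Φ.1 (C.exists_π_eq x).choose)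

/-- `φ ∘ π = π ∘ Φ` -/
theorem baseMap_π (Φ : C.Aut) (u : B) : C.baseMap Φ (C.π u) = C.π (Φ.1 u) := by
  obtain ⟨p, hp⟩ := C.exists_act_eq (C.exists_π_eq (C.π u)).choose_spec
  unfold baseMap
  conv_rhs => rw [hp]
  rw [Φ.2.2.2.1, C.π_act]

/-- The action of `Aut(B, ω)` on `M`. -/
instance : MulAction C.Aut M where
  smul Φ x := C.baseMap Φ x
  one_smul x := by
    obtain ⟨u, rfl⟩ := C.exists_π_eq x
    exact C.baseMap_π 1 u
  mul_smul Φ Ψ x := by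
    obtain ⟨u, rfl⟩ := C.exists_π_eq x
    change C.baseMap (Φ * Ψ) (C.π u) = C.baseMap Φ (C.baseMap Ψ (C.π u))
    rw [C.baseMap_π, C.baseMap_π, C.baseMap_π]
    rfl

/-! ### Weyl structures, scale bundles, essential structures -/

variable [LieGroup (𝓡 n) ∞ G] (gr : KGrading (GroupLieAlgebra (𝓡 n) G))

/-- The orbit space `B₀ = B / P₊`. -/
def BZero (_C : CartanGeometry n m b d P B M) (gr : KGrading (GroupLieAlgebra (𝓡 n) G)) :=
  MulAction.orbitRel.Quotient (PPlus P gr).op B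

/-- The projection `π₊ : B → B₀`. -/
def toBZero (u : B) : C.BZero gr := Quotient.mk (MulAction.orbitRel (PPlus P gr).op B) u

/-- The projection `π₀ : B₀ → M`. -/
def πZero : C.BZero gr → M :=
  Quotient.lift C.π (by
    rintro u v ⟨⟨q, hq⟩, rfl⟩
    exact C.π_act v q.unop)

/-- The map `Φ₀ : B₀ → B₀` induced by an automorphism `Φ`. -/
def autZero (Φ : C.Aut) : C.BZero gr → C.BZero gr :=
  Quotient.map Φ.1 (by
    rintro u v ⟨q, rfl⟩
    exact ⟨q, (Φ.2.2.2.1 v q.1.unop).symm⟩)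

/-- A Weyl structure: a smooth `G₀`-equivariant section `σ` of `π₊ : B → B₀`.  The action of `G₀`
on `B₀` is `π₊(u) g = π₊(u g)`.  As `π₊` is a surjective submersion, `σ` is smooth for the quotient
manifold structure on `B₀` if and only if `σ ∘ π₊` is smooth. -/
structure WeylStructure where
  σ : C.BZero gr → B
  section_σ : ∀ x, C.toBZero gr (σ x) = x
  equivariant : ∀ (u : B), ∀ g ∈ GZero P gr, σ (C.toBZero gr (u <• g)) = σ (C.toBZero gr u) <• g
  contMDiff : ContMDiff (𝓡 b) (𝓡 b) ∞ (fun u => σ (C.toBZero gr u))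

/-- The pull-back `Φ^* σ = Φ⁻¹ ∘ σ ∘ Φ₀`. -/
def pullWeyl (Φ : C.Aut) (σ : C.BZero gr → B) : C.BZero gr → B :=
  fun x => Φ.1.symm (σ (C.autZero gr Φ x))

variable {gr}
variable (lam : ScaleRepresentation (m := m) P gr)

/-- The relation `(u g, r) ∼ (u, λ(g) r)` on `B₀ × ℝ_{>0}`. -/
def ScaleRel (x y : C.BZero gr × {r : ℝ // 0 < r}) : Prop :=
  ∃ (u : B) (g : GZero P gr) (r : {r : ℝ // 0 < r}),
    x = (C.toBZero gr (u <• (g : P)), r) ∧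
    y = (C.toBZero gr u, ⟨lam.toHom g * r.1, mul_pos (lam.pos g) r.2⟩)

/-- The scale bundle `L^λ = B₀ ×_{G₀} ℝ_{>0}`, the principal `ℝ_{>0}`-bundle associated to
`B₀ → M` by `λ`. -/
def ScaleBundle : Type _ := Quot (C.ScaleRel lam)

/-- The class `[π₊(u), r]` in the scale bundle. -/
def scaleMk (u : B) (r : {r : ℝ // 0 < r}) : C.ScaleBundle lam :=
  Quot.mk _ (C.toBZero gr u, r)

/-- The projection `L^λ → M`. -/
def scaleπ : C.ScaleBundle lam → M :=
  Quot.lift (fun x => C.πZero gr x.1) (by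
    rintro _ _ ⟨u, g, r, rfl, rfl⟩
    exact C.π_act u g)

/-- The bundle map `Φ_λ : L^λ → L^λ` induced by an automorphism, `Φ_λ [x, r] = [Φ₀ x, r]`. -/
def autScale (Φ : C.Aut) : C.ScaleBundle lam → C.ScaleBundle lam :=
  Quot.map (fun x => (C.autZero gr Φ x.1, x.2)) (by
    rintro _ _ ⟨u, g, r, rfl, rfl⟩
    refine ⟨Φ.1 u, g, r, ?_, rfl⟩
    rw [← Φ.2.2.2.1]
    rfl)

/-- The representation `[π₊ ∘ τ, r]` of a section `s` of the scale bundle over an open set `U`, by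
a smooth local section `τ` of `B → M` and a smooth positive function `r`. -/
structure IsLocalForm (s : M → C.ScaleBundle lam) (U : Set M) (τ : M → B)
    (r : M → {r : ℝ // 0 < r}) : Prop where
  isOpen : IsOpen U
  contMDiff_τ : ContMDiffOn (𝓡 d) (𝓡 b) ∞ τ U
  π_τ : ∀ y ∈ U, C.π (τ y) = y
  contMDiff_r : ContMDiffOn (𝓡 d) 𝓘(ℝ, ℝ) ∞ (fun y => (r y : ℝ)) U
  eq : ∀ y ∈ U, s y = C.scaleMk lam (τ y) (r y)

/-- A global scale: a smooth global section of `L^λ → M`. -/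
structure GlobalScale where
  s : M → C.ScaleBundle lam
  section_s : ∀ x, C.scaleπ lam (s x) = x
  smooth : ∀ x, ∃ U τ r, x ∈ U ∧ C.IsLocalForm lam s U τ r

/-- The pull-back `Φ^* s = Φ_λ⁻¹ ∘ s ∘ φ`. -/
def pullScale (Φ : C.Aut) (s : M → C.ScaleBundle lam) : M → C.ScaleBundle lam :=
  fun x => C.autScale lam Φ⁻¹ (s (Φ • x))

/-- The derivative `λ'(A) = B(E_λ, A)`, applied to the `g_0`-component of `A`. -/
def scaleDeriv (lam : ScaleRepresentation (m := m) P gr) (A : GroupLieAlgebra (𝓡 n) G) : ℝ :=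
  killingForm ℝ (GroupLieAlgebra (𝓡 n) G) lam.E (gr.proj 0 A)

/-- The principal connection `σ^λ` on `L^λ` induced by `λ' ∘ σ^* ω_0` is the trivial connection
with parallel section `s`, that is, `s^* σ^λ = 0`.  In a local form `s = [π₊ ∘ τ, r]`, the one-form
`s^* σ^λ` is `(π₊ ∘ τ)^* (λ' ∘ σ^* ω_0) + dr / r`. -/
def IsParallel (W : C.WeylStructure gr) (s : M → C.ScaleBundle lam) : Prop :=
  ∀ U τ r, C.IsLocalForm lam s U τ r → ∀ x ∈ U, ∀ v : TangentSpace (𝓡 d) x,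
    scaleDeriv lam (C.cartan (W.σ (C.toBZero gr (τ x)))
      (mfderiv (𝓡 d) (𝓡 b) (fun y => W.σ (C.toBZero gr (τ y))) x v))
    + (r x : ℝ)⁻¹ * realDifferential (fun y => (r y : ℝ)) x v = 0

/-- An exact Weyl structure: a Weyl structure `σ` together with the corresponding global scale
`s_σ`, i.e. the connection `σ^λ` is the trivial connection induced by `s_σ`. -/
structure ExactWeylStructure where
  weyl : C.WeylStructure gr
  scale : C.GlobalScale lam
  parallel : C.IsParallel lam weyl scale.s

variable {lam}

/-- The automorphisms `Aut(σ)` of a Weyl structure: `Φ^* σ = σ`. -/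
def weylAut (W : C.WeylStructure gr) : Set C.Aut := {Φ | C.pullWeyl gr Φ W.σ = W.σ}

/-- The exact automorphisms of an exact Weyl structure `σ`: `Φ^* s_σ = s_σ`. -/
def exactAut (W : C.ExactWeylStructure lam) : Set C.Aut :=
  {Φ | C.pullScale lam Φ W.scale.s = W.scale.s}

variable (lam)

/-- The geometry is essential if the exact automorphisms of each exact Weyl structure form a proper
subset of `Aut(B, ω)`. -/
def IsEssential : Prop := ∀ W : C.ExactWeylStructure lam, C.exactAut W ⊂ Set.univ

end CartanGeometry

end Cartan

end ParabolicGeometry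

end

/-!
Only the statement that a proper action has an invariant exact Weyl structure needs proof: if such a
`W` exists, then `exactAut W` is everything, which contradicts essentiality.

A global scale is the same thing as a positive smooth function `f` on the total space of the
Cartan bundle with `f (u <• p) = (χ p)⁻¹ * f u`, where `χ` is the character of the parabolic
subgroup `P` that extends `λ` and is trivial on `P₊` (`IsParabolicType.exists_extend_scale`,
`IsScaleFunction`).

*Invariant scales.* Local triviality gives, near each point of the base, a nonnegative smooth
function with this equivariance and with compact support over the base. If the automorphism group
acts properly on the base, then it is locally compact, and for each `u` only a compact set of
automorphisms moves `u` into that support. So the function can be averaged with respect to Haar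
measure. The average is smooth because automorphisms preserve the Cartan connection: derivatives in
the directions of the constant vector fields commute with the averaging, so one differentiates
under the integral without any smoothness of the automorphism group
(`CartanGeometry.contMDiff_average`). Countably many averages are glued with invariant weights,
which gives an invariant scale function (`CartanGeometry.exists_invariant_scaleFunction`).

*From scales to Weyl structures.* Minus the logarithmic derivative of a scale function `f`, read
through the Cartan connection and the Killing form, is an equivariant map `F` from the total space
to the Lie algebra. As `f` transforms by `χ⁻¹` along the fibres, `F` takes its values in `E_λ + p₊`
(`CartanGeometry.exists_log_derivative`). The group `P₊` acts simply transitively on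
`E_λ + p₊`, since `E_λ` is a nonzero multiple of the grading element. So `F` takes the value `E_λ`
at exactly one point of each `P₊`-orbit, and these points form the image of a Weyl structure `σ`
(`CartanGeometry.exists_normalization`). Along `σ` the derivative of `log f` is minus the Killing
product of `E_λ` with the Cartan connection, which says that the scale is parallel for `σ^λ`; and as
the construction is natural, `σ` inherits every symmetry of `f`
(`CartanGeometry.exists_exactWeylStructure`).

The facts on Lie groups that this uses are derived from the invariant vector fields: the adjoint
representation is smooth with derivative the bracket (`contMDiff_adModel`, `fderiv_chartAd`),
one-parameter groups exist and `Ad` of them is the exponential of `ad`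
(`IsOneParameterGroup.adModel_eq_exp`), and `P` is the product of the Levi factor and `P₊`
(`IsParabolicType.exists_levi_projection`).
-/

noncomputable section

namespace ParabolicGeometry

/-! ### Gradings of Lie algebras with nondegenerate Killing form -/

namespace KGrading

variable {L : Type*} [LieRing L] [LieAlgebra ℝ L] (gr : KGrading L)

theorem proj_mem (i : ℤ) (X : L) : gr.proj i X ∈ gr.piece i := Subtype.coe_prop _

theorem proj_of_mem_piece (i j : ℤ) {X : L} (hX : X ∈ gr.piece i) :
    gr.proj j X = if i = j then X else 0 := by
  have h : (LinearEquiv.ofBijective (DirectSum.coeLinearMap gr.piece) gr.isInternal).symm X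
      = DirectSum.lof ℝ ℤ (fun j => gr.piece j) i ⟨X, hX⟩ := by
    rw [LinearEquiv.symm_apply_eq]
    exact (DirectSum.coeLinearMap_lof gr.piece i ⟨X, hX⟩).symm
  simp only [proj, LinearMap.comp_apply, LinearEquiv.coe_coe, h]
  by_cases hij : i = j
  · subst hij; simp [DirectSum.component.lof_self]
  · rw [if_neg hij, DirectSum.component.of, dif_neg hij]; simp

theorem proj_self {i : ℤ} {X : L} (hX : X ∈ gr.piece i) : gr.proj i X = X := by
  simp [gr.proj_of_mem_piece i i hX]

theorem proj_of_ne {i j : ℤ} {X : L} (hX : X ∈ gr.piece i) (h : i ≠ j) : gr.proj j X = 0 := by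
  simp [gr.proj_of_mem_piece i j hX, h]

theorem iSup_piece : ⨆ i, gr.piece i = ⊤ := gr.isInternal.submodule_iSup_eq_top

@[elab_as_elim]
theorem induction_piece {motive : L → Prop} (X : L)
    (mem : ∀ i, ∀ X ∈ gr.piece i, motive X) (add : ∀ X Y, motive X → motive Y → motive (X + Y)) :
    motive X := by
  refine Submodule.iSup_induction gr.piece (motive := motive)
    (by rw [gr.iSup_piece]; trivial : X ∈ ⨆ i, gr.piece i) mem (mem 0 0 (zero_mem _)) add

theorem piece_eq_zero {i : ℤ} (hi : i ∉ Finset.Icc (-(gr.k : ℤ)) gr.k) {X : L}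
    (hX : X ∈ gr.piece i) : X = 0 := by
  rw [gr.eq_bot i (by rw [lt_abs]; simp at hi; omega)] at hX
  simpa using hX

theorem sum_proj (X : L) : ∑ i ∈ Finset.Icc (-(gr.k : ℤ)) gr.k, gr.proj i X = X := by
  induction X using gr.induction_piece with
  | mem i X hX =>
    simp_rw [fun j => gr.proj_of_mem_piece i j hX]
    rw [Finset.sum_ite_eq]
    split_ifs with h
    · rfl
    · exact (gr.piece_eq_zero h hX).symm
  | add X Y hX hY =>
    simp only [map_add, Finset.sum_add_distrib, hX, hY]

theorem eq_zero_of_proj {X : L} (h : ∀ i, gr.proj i X = 0) : X = 0 := by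
  rw [← gr.sum_proj X]; exact Finset.sum_eq_zero fun i _ => h i

theorem mem_filt_iff {i : ℤ} {X : L} : X ∈ gr.filt i ↔ ∀ j < i, gr.proj j X = 0 := by
  constructor
  · intro hX j hj
    have : gr.filt i ≤ LinearMap.ker (gr.proj j) :=
      iSup₂_le fun l hl Y hY => gr.proj_of_ne hY (by omega)
    exact this hX
  · intro h
    rw [← gr.sum_proj X]
    refine Submodule.sum_mem _ fun j _ => ?_
    by_cases hj : j < i
    · rw [h j hj]; exact zero_mem _
    · exact gr.piece_le_filt (by omega) (gr.proj_mem j X)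

theorem filt_anti {i j : ℤ} (h : i ≤ j) : gr.filt j ≤ gr.filt i := fun X hX => by
  rw [mem_filt_iff] at *; exact fun l hl => hX l (by omega)

theorem filt_eq_bot {i : ℤ} (h : (gr.k : ℤ) < i) {X : L} (hX : X ∈ gr.filt i) : X = 0 := by
  refine gr.eq_zero_of_proj fun j => ?_
  by_cases hj : j < i
  · exact gr.mem_filt_iff.1 hX j hj
  · exact gr.piece_eq_zero (by simp; omega) (gr.proj_mem j X)

theorem lie_mem_filt_add {i j : ℤ} {X Y : L} (hX : X ∈ gr.filt i) (hY : Y ∈ gr.filt j) :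
    ⁅X, Y⁆ ∈ gr.filt (i + j) := by
  rw [mem_filt_iff] at hX hY
  rw [← gr.sum_proj X, ← gr.sum_proj Y, sum_lie]
  refine Submodule.sum_mem _ fun a _ => ?_
  rw [lie_sum]
  refine Submodule.sum_mem _ fun b _ => ?_
  by_cases ha : a < i
  · rw [hX a ha, zero_lie]; exact zero_mem _
  by_cases hb : b < j
  · rw [hY b hb, lie_zero]; exact zero_mem _
  exact gr.piece_le_filt (by omega) (gr.lie_mem a b _ (gr.proj_mem a X) _ (gr.proj_mem b Y))

theorem sub_proj_mem_filt {i : ℤ} {X : L} (hX : X ∈ gr.filt i) :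
    X - gr.proj i X ∈ gr.filt (i + 1) := by
  rw [mem_filt_iff] at *
  intro j hj
  rw [map_sub]
  rcases (show j ≤ i by omega).lt_or_eq with h | rfl
  · rw [hX j h, gr.proj_of_ne (gr.proj_mem i X) (by omega), sub_zero]
  · rw [gr.proj_self (gr.proj_mem j X), sub_self]

/-- The endomorphism that multiplies the grading component `L_i` by `i`. -/
def degree : L →ₗ[ℝ] L := ∑ i ∈ Finset.Icc (-(gr.k : ℤ)) gr.k, (i : ℝ) • gr.proj i

theorem degree_apply {i : ℤ} {X : L} (hX : X ∈ gr.piece i) : gr.degree X = (i : ℝ) • X := by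
  simp only [degree, LinearMap.sum_apply, LinearMap.smul_apply]
  simp_rw [fun j => gr.proj_of_mem_piece i j hX, smul_ite, smul_zero]
  rw [Finset.sum_ite_eq]
  split_ifs with h
  · rfl
  · simp [gr.piece_eq_zero h hX]

theorem degree_lie (X Y : L) : gr.degree ⁅X, Y⁆ = ⁅X, gr.degree Y⁆ - ⁅Y, gr.degree X⁆ := by
  induction X using gr.induction_piece with
  | mem i X hX =>
    induction Y using gr.induction_piece with
    | mem j Y hY =>
      rw [gr.degree_apply hX, gr.degree_apply hY, gr.degree_apply (gr.lie_mem i j X hX Y hY),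
        lie_smul, lie_smul, ← lie_skew X Y]
      push_cast
      module
    | add Y Y' h h' => simp only [lie_add, add_lie, map_add, h, h']; abel
  | add X X' h h' => simp only [lie_add, add_lie, map_add, h, h']; abel

/-- `ε` is the grading element: `ad ε` is multiplication by `i` on `L_i`. -/
def IsGradingElement (ε : L) : Prop := ∀ i, ∀ X ∈ gr.piece i, ⁅ε, X⁆ = (i : ℝ) • X

variable {gr} {ε : L}

theorem IsGradingElement.mem_piece_iff (hε : gr.IsGradingElement ε) {i : ℤ} {X : L} :
    X ∈ gr.piece i ↔ ⁅ε, X⁆ = (i : ℝ) • X := by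
  refine ⟨hε i X, fun h => ?_⟩
  have h1 : ∀ Y, ⁅ε, Y⁆ = gr.degree Y := fun Y => by
    induction Y using gr.induction_piece with
    | mem j Y hY => rw [hε j Y hY, gr.degree_apply hY]
    | add Y Y' h h' => simp [h, h']
  have h2 : ∀ j Y, gr.proj j (gr.degree Y) = (j : ℝ) • gr.proj j Y := fun j Y => by
    induction Y using gr.induction_piece with
    | mem l Y hY =>
      rw [gr.degree_apply hY, map_smul, gr.proj_of_mem_piece l j hY]
      split_ifs with hl
      · rw [hl]
      · simp
    | add Y Y' h h' => simp [h, h']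
  have h3 : X = gr.proj i X := by
    rw [← sub_eq_zero]
    refine gr.eq_zero_of_proj fun j => ?_
    by_cases hj : j = i
    · subst hj; simp [gr.proj_self (gr.proj_mem j X)]
    · rw [map_sub, gr.proj_of_ne (gr.proj_mem i X) (Ne.symm hj), sub_zero]
      have h4 := h2 j X
      rw [← h1, h, map_smul] at h4
      have h5 : ((i : ℝ) - j) • gr.proj j X = 0 := by rw [sub_smul, h4, sub_self]
      refine (smul_eq_zero.1 h5).resolve_left (sub_ne_zero.2 ?_)
      exact_mod_cast Ne.symm hj
  rw [h3]; exact gr.proj_mem i X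

theorem IsGradingElement.mem_piece_zero (hε : gr.IsGradingElement ε) : ε ∈ gr.piece 0 := by
  rw [hε.mem_piece_iff]; simp

theorem IsGradingElement.killingForm_eq_zero (hε : gr.IsGradingElement ε) {i j : ℤ} (h : i + j ≠ 0)
    {X Y : L} (hX : X ∈ gr.piece i) (hY : Y ∈ gr.piece j) : killingForm ℝ L X Y = 0 := by
  have h1 := LieModule.traceForm_apply_lie_apply ℝ L L X ε Y
  rw [← lie_skew, hε i X hX, hε j Y hY] at h1
  simp only [map_neg, map_smul, LinearMap.neg_apply, LinearMap.smul_apply, smul_eq_mul] at h1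
  have h2 : ((i : ℝ) + j) * killingForm ℝ L X Y = 0 := by
    change ((i : ℝ) + j) * LieModule.traceForm ℝ L L X Y = 0
    linarith
  refine (mul_eq_zero.1 h2).resolve_left ?_
  exact_mod_cast h

section Killing

variable [FiniteDimensional ℝ L] [LieAlgebra.IsKilling ℝ L]

omit [FiniteDimensional ℝ L] in
theorem eq_zero_of_killingForm {X : L} (h : ∀ i, ∀ Y ∈ gr.piece i, killingForm ℝ L X Y = 0) :
    X = 0 := by
  refine (LieAlgebra.IsKilling.killingForm_nondegenerate ℝ L).1 X fun Y => ?_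
  induction Y using gr.induction_piece with
  | mem i Y hY => exact h i Y hY
  | add Y Y' h h' => simp [h, h']

variable (gr) in
/-- Multiplication by the degree is a derivation, and derivations of a Lie algebra with
nondegenerate Killing form are inner. -/
theorem exists_isGradingElement : ∃ ε, gr.IsGradingElement ε := by
  let D : LieDerivation ℝ L L :=
    { toLinearMap := gr.degree
      leibniz' := gr.degree_lie }
  have hD : D ∈ (LieDerivation.ad ℝ L).range := by
    rw [LieDerivation.IsKilling.range_ad_eq_top]; trivial
  obtain ⟨ε, hε⟩ := hD
  refine ⟨ε, fun i X hX => ?_⟩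
  have h : LieDerivation.ad ℝ L ε X = D X := congrArg (fun T : LieDerivation ℝ L L => T X) hε
  rw [LieDerivation.ad_apply_apply] at h
  exact h.trans (gr.degree_apply hX)

omit [FiniteDimensional ℝ L] in
/-- `p₊` is the annihilator of `p` for the Killing form. -/
theorem IsGradingElement.mem_filt_one_iff (hε : gr.IsGradingElement ε) {X : L} :
    X ∈ gr.filt 1 ↔ ∀ Y ∈ gr.filt 0, killingForm ℝ L X Y = 0 := by
  constructor
  · intro hX Y hY
    rw [mem_filt_iff] at hX hY
    rw [← gr.sum_proj X, ← gr.sum_proj Y]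
    simp only [map_sum, LinearMap.sum_apply]
    refine Finset.sum_eq_zero fun a _ => Finset.sum_eq_zero fun b _ => ?_
    by_cases hb : b < 1
    · rw [hX b hb]; simp
    by_cases ha : a < 0
    · rw [hY a ha]; simp
    exact hε.killingForm_eq_zero (by omega) (gr.proj_mem _ _) (gr.proj_mem _ _)
  · intro h
    rw [mem_filt_iff]
    intro j hj
    refine eq_zero_of_killingForm (gr := gr) fun i Y hY => ?_
    by_cases hij : j + i = 0
    · have h1 := h Y (gr.piece_le_filt (by omega) hY)
      rw [← gr.sum_proj X] at h1
      simp only [map_sum, LinearMap.sum_apply] at h1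
      by_cases hjm : j ∈ Finset.Icc (-(gr.k : ℤ)) gr.k
      · rwa [Finset.sum_eq_single_of_mem j hjm fun l _ hl =>
          hε.killingForm_eq_zero (by omega) (gr.proj_mem _ _) hY] at h1
      · simp [gr.piece_eq_zero hjm (gr.proj_mem j X)]
    · exact hε.killingForm_eq_zero hij (gr.proj_mem _ _) hY

variable (gr) in
/-- The subspace `L_{-k} ⊕ ⋯ ⊕ L_{-1}`. -/
def neg : Submodule ℝ L := ⨆ i : ℤ, ⨆ _ : i < 0, gr.piece i

omit [FiniteDimensional ℝ L] [LieAlgebra.IsKilling ℝ L] in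
theorem mem_neg_iff {X : L} : X ∈ gr.neg ↔ ∀ j, 0 ≤ j → gr.proj j X = 0 := by
  constructor
  · intro hX j hj
    have : gr.neg ≤ LinearMap.ker (gr.proj j) :=
      iSup₂_le fun l hl Y hY => gr.proj_of_ne hY (by omega)
    exact this hX
  · intro h
    rw [← gr.sum_proj X]
    refine Submodule.sum_mem _ fun j _ => ?_
    by_cases hj : 0 ≤ j
    · rw [h j hj]; exact zero_mem _
    · exact (le_iSup₂_of_le (f := fun i (_ : i < 0) => gr.piece i) j (by omega) le_rfl)
        (gr.proj_mem j X)

omit [FiniteDimensional ℝ L] [LieAlgebra.IsKilling ℝ L] in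
/-- Induction over the generation of `L_{-k} ⊕ ⋯ ⊕ L_{-1}` by `L_{-1}`. -/
theorem neg_induction {motive : L → Prop} {X : L} (hX : X ∈ gr.neg)
    (mem : ∀ X ∈ gr.piece (-1), motive X) (add : ∀ X Y, motive X → motive Y → motive (X + Y))
    (smul : ∀ (a : ℝ) X, motive X → motive (a • X))
    (lie : ∀ X ∈ gr.neg, ∀ Y ∈ gr.neg, motive X → motive Y → motive ⁅X, Y⁆) : motive X := by
  have hg : (LieSubalgebra.lieSpan ℝ L (gr.piece (-1) : Set L)).toSubmodule = gr.neg := gr.generates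
  rw [← hg] at hX
  replace hX : X ∈ LieSubalgebra.lieSpan ℝ L (gr.piece (-1) : Set L) := hX
  induction hX using LieSubalgebra.lieSpan_induction with
  | mem x h => exact mem x h
  | zero => exact mem 0 (zero_mem _)
  | add x y hx hy h h' => exact add x y h h'
  | smul a x hx h => exact smul a x h
  | lie x y hx hy h h' =>
    rw [← hg] at lie
    exact lie x hx y hy h h'

omit [FiniteDimensional ℝ L] in
/-- An element of `L_0` that centralizes `L_0` and `L_{-1}` is zero: it centralizes `L_{-i}`, as
`L_{-1}` generates, hence also `L_i`, which is dual to `L_{-i}`. -/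
theorem IsGradingElement.eq_zero_of_centralizes (hε : gr.IsGradingElement ε) {D : L}
    (hD : D ∈ gr.piece 0)
    (h0 : ∀ X ∈ gr.piece 0, ⁅D, X⁆ = 0) (h1 : ∀ X ∈ gr.piece (-1), ⁅D, X⁆ = 0) : D = 0 := by
  have hneg : ∀ X ∈ gr.neg, ⁅D, X⁆ = 0 := fun X hX => by
    refine neg_induction (motive := fun X => ⁅D, X⁆ = 0) hX h1 (fun X Y h h' => ?_)
      (fun a X h => ?_) fun X hX Y hY h h' => ?_
    · rw [lie_add, h, h', add_zero]
    · rw [lie_smul, h, smul_zero]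
    · rw [leibniz_lie, h, h', zero_lie, lie_zero, add_zero]
  have hneg' : ∀ i < 0, ∀ X ∈ gr.piece i, ⁅D, X⁆ = 0 := fun i hi X hX =>
    hneg X ((le_iSup₂_of_le (f := fun i (_ : i < 0) => gr.piece i) i hi le_rfl) hX)
  have hall : ∀ X : L, ⁅D, X⁆ = 0 := fun X => by
    induction X using gr.induction_piece with
    | add X Y h h' => rw [lie_add, h, h', add_zero]
    | mem i X hX =>
      rcases lt_trichotomy i 0 with hi | rfl | hi
      · exact hneg' i hi X hX
      · exact h0 X hX
      · refine eq_zero_of_killingForm (gr := gr) fun j Y hY => ?_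
        by_cases hij : 0 + i + j = 0
        · have h2 := LieModule.traceForm_apply_lie_apply ℝ L L X D Y
          rw [hneg' j (by omega) Y hY, map_zero, ← lie_skew, map_neg, LinearMap.neg_apply,
            neg_eq_zero] at h2
          exact h2
        · exact hε.killingForm_eq_zero hij (gr.lie_mem 0 i D hD X hX) hY
  refine eq_zero_of_killingForm (gr := gr) fun i Y _ => ?_
  have : LieAlgebra.ad ℝ L D = 0 := by ext X; exact hall X
  simp [killingForm_apply_apply, this]

omit [FiniteDimensional ℝ L] [LieAlgebra.IsKilling ℝ L] in
theorem lie_mem_neg {X Y : L} (hX : X ∈ gr.neg) (hY : Y ∈ gr.neg) :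
    ⁅X, Y⁆ ∈ gr.neg ∧ gr.proj (-1) ⁅X, Y⁆ = 0 := by
  have key : ∀ j, -1 ≤ j → gr.proj j ⁅X, Y⁆ = 0 := fun j hj => by
    rw [mem_neg_iff] at hX hY
    rw [← gr.sum_proj X, ← gr.sum_proj Y, sum_lie, map_sum]
    refine Finset.sum_eq_zero fun a _ => ?_
    rw [lie_sum, map_sum]
    refine Finset.sum_eq_zero fun b _ => ?_
    by_cases ha : 0 ≤ a
    · rw [hX a ha, zero_lie, map_zero]
    by_cases hb : 0 ≤ b
    · rw [hY b hb, lie_zero, map_zero]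
    exact gr.proj_of_ne (gr.lie_mem a b _ (gr.proj_mem a X) _ (gr.proj_mem b Y)) (by omega)
  exact ⟨mem_neg_iff.2 fun j hj => key j (by omega), key _ le_rfl⟩

omit [FiniteDimensional ℝ L] in
/-- A central element of `L_0` acting on `L_{-1}` by a nonzero scalar is a multiple of the grading
element. -/
theorem IsGradingElement.exists_eq_smul (hε : gr.IsGradingElement ε) {E : L}
    (hE : E ∈ gr.piece 0) (h0 : ∀ X ∈ gr.piece 0, ⁅E, X⁆ = 0)
    (h1 : ∃ a : ℝ, a ≠ 0 ∧ ∀ X ∈ gr.piece (-1), ⁅E, X⁆ = a • X) :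
    ∃ c : ℝ, c ≠ 0 ∧ E = c • ε := by
  obtain ⟨a, ha, h1⟩ := h1
  refine ⟨-a, neg_ne_zero.2 ha, sub_eq_zero.1 ?_⟩
  refine hε.eq_zero_of_centralizes
    (sub_mem hE (Submodule.smul_mem _ _ hε.mem_piece_zero)) (fun X hX => ?_) fun X hX => ?_
  · rw [sub_lie, h0 X hX, smul_lie, hε 0 X hX]; simp
  · rw [sub_lie, h1 X hX, smul_lie, hε _ X hX]; simp

omit [LieAlgebra.IsKilling ℝ L] in
/-- A Lie algebra automorphism `σ` that preserves the parabolic subalgebra preserves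
`L_{-k} ⊕ ⋯ ⊕ L_{-1}` if `σ⁻¹` maps the grading element into `L_0`. -/
theorem IsGradingElement.map_mem_neg (hε : gr.IsGradingElement ε) (σ : L ≃ₗ⁅ℝ⁆ L)
    (hσ : ∀ X, σ X ∈ gr.filt 0 ↔ X ∈ gr.filt 0) (h : σ.symm ε ∈ gr.piece 0) :
    ∀ X, σ X ∈ gr.neg ↔ X ∈ gr.neg := by
  have hproj : ∀ (i : ℤ) (X : L), gr.proj i ⁅ε, X⁆ = (i : ℝ) • gr.proj i X := fun i X => by
    induction X using gr.induction_piece with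
    | mem j X hX =>
      rw [hε j X hX, map_smul, gr.proj_of_mem_piece j i hX]
      split_ifs with h
      · rw [h]
      · simp
    | add X Y h h' => simp [h, h']
  have hstable : ∀ X ∈ gr.neg, ⁅σ.symm ε, X⁆ ∈ gr.neg := fun X hX => by
    rw [← gr.sum_proj X, lie_sum]
    refine Submodule.sum_mem _ fun i _ => ?_
    by_cases hi : 0 ≤ i
    · rw [mem_neg_iff.1 hX i hi, lie_zero]; exact zero_mem _
    · exact (le_iSup₂_of_le (f := fun i (_ : i < 0) => gr.piece i) i (by omega) le_rfl)
        (by simpa using gr.lie_mem 0 i _ h _ (gr.proj_mem i X))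
  -- An element of `σ(L_-)` whose components of degree `< -t` vanish has no components of degree
  -- `≥ 0`: apply `ad ε + t` to kill the component of degree `-t`.
  have key : ∀ t : ℕ, ∀ X ∈ gr.neg, (∀ j < -(t : ℤ), gr.proj j (σ X) = 0) → σ X ∈ gr.neg := by
    intro t
    induction t with
    | zero =>
      intro X hX hj
      have h1 : X ∈ gr.filt 0 := (hσ X).1 (gr.mem_filt_iff.2 (by simpa using hj))
      have : X = 0 := gr.eq_zero_of_proj fun i => by
        by_cases hi : 0 ≤ i
        · exact mem_neg_iff.1 hX i hi
        · exact gr.mem_filt_iff.1 h1 i (by omega)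
      rw [this, map_zero]; exact zero_mem _
    | succ t ih =>
      intro X hX hj
      let l : ℤ := -((t + 1 : ℕ) : ℤ)
      have h1 : σ (⁅σ.symm ε, X⁆ - (l : ℝ) • X) = ⁅ε, σ X⁆ - (l : ℝ) • σ X := by
        rw [map_sub, map_smul, LieEquiv.map_lie, LieEquiv.apply_symm_apply]
      have h2 : ∀ i, gr.proj i (σ (⁅σ.symm ε, X⁆ - (l : ℝ) • X))
          = ((i : ℝ) - l) • gr.proj i (σ X) := fun i => by
        rw [h1, map_sub, hproj, map_smul, sub_smul]
      have h3 := ih (⁅σ.symm ε, X⁆ - (l : ℝ) • X)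
        (sub_mem (hstable X hX) (Submodule.smul_mem _ _ hX)) fun j hjt => by
          rw [h2]
          rcases (show j ≤ l by simp only [l]; push_cast; omega).lt_or_eq with h | h
          · rw [hj j h, smul_zero]
          · rw [h, sub_self, zero_smul]
      rw [mem_neg_iff] at h3 ⊢
      intro i hi
      have h4 := h3 i hi
      rw [h2] at h4
      refine (smul_eq_zero.1 h4).resolve_left (sub_ne_zero.2 ?_)
      have : i ≠ l := by simp only [l]; push_cast; omega
      exact_mod_cast this
  have hle : gr.neg.map (σ : L →ₗ[ℝ] L) ≤ gr.neg := by
    rintro _ ⟨X, hX, rfl⟩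
    exact key gr.k X hX fun j hj => gr.piece_eq_zero (by simp; omega) (gr.proj_mem j _)
  have heq : gr.neg.map (σ : L →ₗ[ℝ] L) = gr.neg :=
    Submodule.eq_of_le_of_finrank_eq hle (LinearEquiv.finrank_map_eq σ.toLinearEquiv gr.neg)
  intro X
  refine ⟨fun hX => ?_, fun hX => hle ⟨X, hX, rfl⟩⟩
  rw [← heq] at hX
  obtain ⟨Y, hY, hYX⟩ := hX
  rwa [← σ.injective hYX]

/-- A Lie algebra automorphism that preserves the parabolic subalgebra and maps the grading element
into `L_0` fixes the grading element. -/
theorem IsGradingElement.map_eq_self (hε : gr.IsGradingElement ε) (σ : L ≃ₗ⁅ℝ⁆ L)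
    (hσ : ∀ X, σ X ∈ gr.filt 0 ↔ X ∈ gr.filt 0) (h : σ ε ∈ gr.piece 0) : σ ε = ε := by
  have hσ1 : ∀ X ∈ gr.filt 1, σ X ∈ gr.filt 1 := fun X hX => by
    rw [hε.mem_filt_one_iff] at hX ⊢
    intro Y hY
    have h1 := hX (σ.symm Y) ((hσ _).1 (by simpa using hY))
    rwa [← LieAlgebra.killingForm_of_equiv_apply σ, LieEquiv.apply_symm_apply] at h1
  have hc : ∀ X ∈ gr.piece 0, ⁅σ ε, X⁆ = 0 := fun X hX => by
    have h1 : σ.symm X ∈ gr.filt 0 :=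
      (hσ _).1 (by simpa using gr.piece_le_filt le_rfl hX)
    have h2 : ⁅ε, σ.symm X⁆ ∈ gr.filt 1 := by
      have h3 := gr.sub_proj_mem_filt h1
      have h4 : ⁅ε, σ.symm X⁆ = ⁅ε, σ.symm X - gr.proj 0 (σ.symm X)⁆ := by
        rw [lie_sub, hε 0 _ (gr.proj_mem 0 _)]; simp
      rw [h4]
      simpa using gr.lie_mem_filt_add (gr.piece_le_filt le_rfl hε.mem_piece_zero) h3
    have h5 := hσ1 _ h2
    rw [LieEquiv.map_lie, LieEquiv.apply_symm_apply] at h5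
    have h6 : ⁅σ ε, X⁆ ∈ gr.piece 0 := gr.lie_mem 0 0 _ h _ hX
    rw [← gr.proj_self h6]
    exact gr.mem_filt_iff.1 h5 0 (by norm_num)
  have hsymm : σ.symm ε ∈ gr.piece 0 := by
    rw [hε.mem_piece_iff]
    have h1 : σ ⁅ε, σ.symm ε⁆ = 0 := by
      rw [LieEquiv.map_lie, LieEquiv.apply_symm_apply, hc ε hε.mem_piece_zero]
    rw [← σ.map_zero] at h1
    rw [σ.injective h1]
    simp
  have hneg := hε.map_mem_neg σ hσ hsymm
  -- Modulo the derived algebra `D₂`, the algebra `L_-` is `L_{-1}`.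
  let D₂ : Submodule ℝ L := Submodule.span ℝ {Z | ∃ X ∈ gr.neg, ∃ Y ∈ gr.neg, ⁅X, Y⁆ = Z}
  have hD1 : ∀ X ∈ gr.neg, X - gr.proj (-1) X ∈ D₂ := fun X hX => by
    refine neg_induction (motive := fun X => X - gr.proj (-1) X ∈ D₂) hX (fun X hX => ?_)
      (fun X Y h h' => ?_) (fun a X h => ?_) fun X hX Y hY h h' => ?_
    · rw [gr.proj_self hX, sub_self]; exact zero_mem _
    · rw [map_add, add_sub_add_comm]; exact add_mem h h'
    · rw [map_smul, ← smul_sub]; exact Submodule.smul_mem _ _ h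
    · rw [(lie_mem_neg hX hY).2, sub_zero]
      exact Submodule.subset_span ⟨X, hX, Y, hY, rfl⟩
  have hD2 : ∀ X ∈ D₂, gr.proj (-1) (σ X) = 0 := by
    have : D₂ ≤ LinearMap.ker (gr.proj (-1) ∘ₗ (σ : L →ₗ[ℝ] L)) := by
      refine Submodule.span_le.2 ?_
      rintro _ ⟨X, hX, Y, hY, rfl⟩
      have h1 : gr.proj (-1) (σ ⁅X, Y⁆) = 0 := by
        rw [LieEquiv.map_lie]; exact (lie_mem_neg ((hneg X).2 hX) ((hneg Y).2 hY)).2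
      exact h1
    exact fun X hX => this hX
  have h1 : ∀ X ∈ gr.piece (-1), ⁅σ ε, X⁆ + X = 0 := fun X hX => by
    have hX' : X ∈ gr.neg :=
      (le_iSup₂_of_le (f := fun i (_ : i < 0) => gr.piece i) (-1) (by norm_num) le_rfl) hX
    have hW : σ.symm X ∈ gr.neg := (hneg _).1 (by simpa using hX')
    have hZ : ⁅ε, σ.symm X⁆ + σ.symm X ∈ gr.neg := by
      rw [mem_neg_iff]
      intro j hj
      rw [← gr.sum_proj (σ.symm X), lie_sum, ← Finset.sum_add_distrib, map_sum]
      refine Finset.sum_eq_zero fun i _ => ?_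
      rw [hε i _ (gr.proj_mem i _), map_add, map_smul]
      by_cases hi : 0 ≤ i
      · rw [mem_neg_iff.1 hW i hi]; simp
      · rw [gr.proj_of_ne (gr.proj_mem i _) (by omega), smul_zero, add_zero]
    have hZ1 : gr.proj (-1) (⁅ε, σ.symm X⁆ + σ.symm X) = 0 := by
      rw [← gr.sum_proj (σ.symm X), lie_sum, ← Finset.sum_add_distrib, map_sum]
      refine Finset.sum_eq_zero fun i _ => ?_
      rw [hε i _ (gr.proj_mem i _), map_add, map_smul]
      by_cases hi : i = -1
      · rw [hi]; simp
      · rw [gr.proj_of_ne (gr.proj_mem i _) hi, smul_zero, add_zero]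
    have h2 := hD2 _ (by simpa [hZ1] using hD1 _ hZ)
    rw [map_add, LieEquiv.map_lie, LieEquiv.apply_symm_apply] at h2
    rwa [gr.proj_self] at h2
    exact add_mem (by simpa using gr.lie_mem 0 (-1) _ h _ hX) hX
  rw [← sub_eq_zero]
  refine hε.eq_zero_of_centralizes (sub_mem h hε.mem_piece_zero) (fun X hX => ?_) fun X hX => ?_
  · rw [sub_lie, hc X hX, hε 0 X hX]; simp
  · rw [sub_lie, eq_neg_of_add_eq_zero_left (h1 X hX), hε _ X hX]; simp

end Killing

end KGrading

/-! ### The adjoint representation and the bracket -/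

section AdjointRepresentation

open VectorField Filter Topology

/-- The model space of `n`-dimensional manifolds. -/
abbrev Model (n : ℕ) : Type := EuclideanSpace ℝ (Fin n)

variable {n : ℕ} {G : Type*} [TopologicalSpace G] [ChartedSpace (EuclideanSpace ℝ (Fin n)) G]
  [Group G]

/-- The Lie algebra is by definition the model space; instance search does not see through this. -/
instance : FiniteDimensional ℝ (GroupLieAlgebra (𝓡 n) G) :=
  inferInstanceAs (FiniteDimensional ℝ (EuclideanSpace ℝ (Fin n)))

/-- The multiplication of a Lie group, in the chart at `1`. -/
def chartMul (n : ℕ) (G : Type*) [TopologicalSpace G]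
    [ChartedSpace (EuclideanSpace ℝ (Fin n)) G] [Group G] (z : Model n × Model n) : Model n :=
  extChartAt (𝓡 n) (1 : G)
    ((extChartAt (𝓡 n) (1 : G)).symm z.1 * (extChartAt (𝓡 n) (1 : G)).symm z.2)

/-- The coordinates of `1` in the chart at `1`. -/
def chartOne (n : ℕ) (G : Type*) [TopologicalSpace G]
    [ChartedSpace (EuclideanSpace ℝ (Fin n)) G] [Group G] : Model n := extChartAt (𝓡 n) (1 : G) 1

theorem symm_chartOne : (extChartAt (𝓡 n) (1 : G)).symm (chartOne n G) = 1 :=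
  extChartAt_to_inv (1 : G)

variable [LieGroup (𝓡 n) ∞ G]

theorem contMDiffAt_chart_symm {x : Model n} (hx : x ∈ (extChartAt (𝓡 n) (1 : G)).target) :
    ContMDiffAt (𝓡 n) (𝓡 n) ∞ (extChartAt (𝓡 n) (1 : G)).symm x :=
  (contMDiffOn_extChartAt_symm (n := ∞) (1 : G)).contMDiffAt
    ((isOpen_extChartAt_target (I := 𝓡 n) (1 : G)).mem_nhds hx)

theorem hasMFDerivAt_chart_symm_chartOne :
    HasMFDerivAt (𝓡 n) (𝓡 n) (extChartAt (𝓡 n) (1 : G)).symm (chartOne n G)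
      (ContinuousLinearMap.id ℝ (Model n)) := by
  have h1 := (contMDiffAt_chart_symm (G := G) (mem_extChartAt_target (I := 𝓡 n) (1 : G)))
  have h2 := (h1.mdifferentiableAt (by simp)).hasMFDerivAt
  have h3 := mfderivWithin_range_extChartAt_symm (I := 𝓡 n) (x := (1 : G))
  rw [ModelWithCorners.range_eq_univ, mfderivWithin_univ] at h3
  have h4 : mfderiv (𝓡 n) (𝓡 n) (extChartAt (𝓡 n) (1 : G)).symm (chartOne n G)
    = ContinuousLinearMap.id ℝ (Model n) := h3
  rw [← h4]
  exact h2

theorem contDiffAt_chartMul_of_mem {x : Model n} (hx : x ∈ (extChartAt (𝓡 n) (1 : G)).target) :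
    ContDiffAt ℝ ∞ (chartMul n G) (x, chartOne n G) := by
  rw [← contMDiffAt_iff_contDiffAt]
  have h1 := contMDiffAt_chart_symm (G := G) (mem_extChartAt_target (I := 𝓡 n) (1 : G))
  have h2 : ContMDiffAt 𝓘(ℝ, Model n × Model n) (𝓡 n) ∞ (fun z : Model n × Model n =>
      (extChartAt (𝓡 n) (1 : G)).symm z.1 * (extChartAt (𝓡 n) (1 : G)).symm z.2)
      (x, chartOne n G) :=
    ((contMDiffAt_chart_symm hx).comp (x, chartOne n G) contDiff_fst.contMDiff.contMDiffAt).mul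
      (h1.comp (x, chartOne n G) contDiff_snd.contMDiff.contMDiffAt)
  refine ContMDiffAt.comp (I' := 𝓡 n) (x, chartOne n G) (g := extChartAt (𝓡 n) (1 : G)) ?_ h2
  simp only [symm_chartOne, mul_one]
  refine contMDiffAt_extChartAt' ?_
  have := (extChartAt (𝓡 n) (1 : G)).map_target hx
  rwa [extChartAt_source] at this

theorem contDiffAt_chartMul : ContDiffAt ℝ ∞ (chartMul n G) (chartOne n G, chartOne n G) :=
  contDiffAt_chartMul_of_mem (mem_extChartAt_target (I := 𝓡 n) (1 : G))

omit [LieGroup (𝓡 n) ∞ G] in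
theorem eventually_mem_chart_target :
    ∀ᶠ x in 𝓝 (chartOne n G), x ∈ (extChartAt (𝓡 n) (1 : G)).target :=
  (isOpen_extChartAt_target (I := 𝓡 n) (1 : G)).mem_nhds (mem_extChartAt_target (I := 𝓡 n) (1 : G))

/-- Left translation in the chart at `1`. -/
theorem fderiv_chartMul_right {x : Model n} (hx : x ∈ (extChartAt (𝓡 n) (1 : G)).target)
    (hd : DifferentiableAt ℝ (chartMul n G) (x, chartOne n G)) (Y : GroupLieAlgebra (𝓡 n) G) :
    fderiv ℝ (chartMul n G) (x, chartOne n G) (0, Y)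
      = mfderiv (𝓡 n) (𝓡 n) (extChartAt (𝓡 n) (1 : G)) ((extChartAt (𝓡 n) (1 : G)).symm x)
        (mulInvariantVectorField Y ((extChartAt (𝓡 n) (1 : G)).symm x)) := by
  set g := (extChartAt (𝓡 n) (1 : G)).symm x with hg
  have hgs : g ∈ (chartAt (Model n) (1 : G)).source := by
    have := (extChartAt (𝓡 n) (1 : G)).map_target hx
    rwa [extChartAt_source] at this
  have h1 : HasFDerivAt (fun y => chartMul n G (x, y))
      ((fderiv ℝ (chartMul n G) (x, chartOne n G)).comp
        (ContinuousLinearMap.inr ℝ (Model n) (Model n))) (chartOne n G) :=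
    hd.hasFDerivAt.comp (chartOne n G) (hasFDerivAt_prodMk_right x (chartOne n G))
  have h2 : HasMFDerivAt (𝓡 n) (𝓡 n) (fun a : G => g * a)
      ((extChartAt (𝓡 n) (1 : G)).symm (chartOne n G))
      (mfderiv (𝓡 n) (𝓡 n) (fun a : G => g * a) 1) := by
    rw [symm_chartOne]
    exact ((contMDiff_mul_left (I := 𝓡 n) (n := ∞)).mdifferentiable (by simp) 1).hasMFDerivAt
  have h3 : HasMFDerivAt (𝓡 n) (𝓡 n) (extChartAt (𝓡 n) (1 : G))
      (g * (extChartAt (𝓡 n) (1 : G)).symm (chartOne n G))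
      (mfderiv (𝓡 n) (𝓡 n) (extChartAt (𝓡 n) (1 : G)) g) := by
    rw [symm_chartOne, mul_one]
    exact (mdifferentiableAt_extChartAt hgs).hasMFDerivAt
  have h4 := h3.comp (chartOne n G) (h2.comp (chartOne n G) hasMFDerivAt_chart_symm_chartOne)
  have h5 := h1.unique (hasMFDerivAt_iff_hasFDerivAt.1 h4)
  exact congrArg (fun T : Model n →L[ℝ] Model n => T Y) h5

theorem fderiv_chartMul_left {x : Model n} (hx : x ∈ (extChartAt (𝓡 n) (1 : G)).target)
    (hd : DifferentiableAt ℝ (chartMul n G) (chartOne n G, x)) (Y : GroupLieAlgebra (𝓡 n) G) :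
    fderiv ℝ (chartMul n G) (chartOne n G, x) (Y, 0)
      = mfderiv (𝓡 n) (𝓡 n) (extChartAt (𝓡 n) (1 : G)) ((extChartAt (𝓡 n) (1 : G)).symm x)
        ((mfderiv (𝓡 n) (𝓡 n) (fun a : G => a * ((extChartAt (𝓡 n) (1 : G)).symm x)) 1 :
          Model n →L[ℝ] Model n) Y) := by
  set g := (extChartAt (𝓡 n) (1 : G)).symm x with hg
  have hgs : g ∈ (chartAt (Model n) (1 : G)).source := by
    have := (extChartAt (𝓡 n) (1 : G)).map_target hx
    rwa [extChartAt_source] at this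
  have h1 : HasFDerivAt (fun y => chartMul n G (y, x))
      ((fderiv ℝ (chartMul n G) (chartOne n G, x)).comp
        (ContinuousLinearMap.inl ℝ (Model n) (Model n))) (chartOne n G) :=
    HasFDerivAt.comp (g := chartMul n G) (f := fun y => (y, x)) (chartOne n G) hd.hasFDerivAt
      (hasFDerivAt_prodMk_left (chartOne n G) x)
  have h2 : HasMFDerivAt (𝓡 n) (𝓡 n) (fun a : G => a * g)
      ((extChartAt (𝓡 n) (1 : G)).symm (chartOne n G))
      (mfderiv (𝓡 n) (𝓡 n) (fun a : G => a * g) 1) := by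
    rw [symm_chartOne]
    exact ((contMDiff_mul_right (I := 𝓡 n) (n := ∞)).mdifferentiable (by simp) 1).hasMFDerivAt
  have h3 : HasMFDerivAt (𝓡 n) (𝓡 n) (extChartAt (𝓡 n) (1 : G))
      ((extChartAt (𝓡 n) (1 : G)).symm (chartOne n G) * g)
      (mfderiv (𝓡 n) (𝓡 n) (extChartAt (𝓡 n) (1 : G)) g) := by
    rw [symm_chartOne, one_mul]
    exact (mdifferentiableAt_extChartAt hgs).hasMFDerivAt
  have h4 := h3.comp (chartOne n G) (h2.comp (chartOne n G) hasMFDerivAt_chart_symm_chartOne)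
  have h5 := h1.unique (hasMFDerivAt_iff_hasFDerivAt.1 h4)
  exact congrArg (fun T : Model n →L[ℝ] Model n => T Y) h5

/-- Left translation is right translation after the adjoint action. -/
theorem mfderiv_mul_right_Ad (g : G) (Y : GroupLieAlgebra (𝓡 n) G) :
    (mfderiv (𝓡 n) (𝓡 n) (fun a : G => a * g) 1 : Model n →L[ℝ] Model n) (Ad n g Y)
      = mulInvariantVectorField Y g := by
  have e : (fun a : G => g * a) = (fun a : G => a * g) ∘ (fun x : G => g * x * g⁻¹) := by
    ext a; simp
  have h1 : g * 1 * g⁻¹ = (1 : G) := by simp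
  have h2 : HasMFDerivAt (𝓡 n) (𝓡 n) (fun a : G => a * g) (g * 1 * g⁻¹)
      (mfderiv (𝓡 n) (𝓡 n) (fun a : G => a * g) 1) := by
    rw [h1]
    exact ((contMDiff_mul_right (I := 𝓡 n) (n := ∞)).mdifferentiable (by simp) 1).hasMFDerivAt
  have h3 := h2.comp (1 : G) (mdifferentiable_conj g 1).hasMFDerivAt
  rw [← e] at h3
  exact (congrArg (fun T : Model n →L[ℝ] Model n => T Y) h3.mfderiv).symm

/-- `Ad`, in the chart at `1`. -/
def chartAd (n : ℕ) (G : Type*) [TopologicalSpace G]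
    [ChartedSpace (EuclideanSpace ℝ (Fin n)) G] [Group G] (x : Model n) : Model n →L[ℝ] Model n :=
  Ad n ((extChartAt (𝓡 n) (1 : G)).symm x)

theorem eventually_differentiableAt_chartMul :
    (∀ᶠ x in 𝓝 (chartOne n G), DifferentiableAt ℝ (chartMul n G) (x, chartOne n G)) ∧
    ∀ᶠ x in 𝓝 (chartOne n G), DifferentiableAt ℝ (chartMul n G) (chartOne n G, x) := by
  have h : ∀ᶠ z in 𝓝 (chartOne n G, chartOne n G), DifferentiableAt ℝ (chartMul n G) z :=
    ((contDiffAt_chartMul (n := n) (G := G)).of_le (m := 1) (by simp)).eventually (by simp) |>.mono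
      fun z hz => hz.differentiableAt (by simp)
  have h1 : ContinuousAt (fun x : Model n => (x, chartOne n G)) (chartOne n G) := by fun_prop
  have h2 : ContinuousAt (fun x : Model n => (chartOne n G, x)) (chartOne n G) := by fun_prop
  exact ⟨h1.eventually h, h2.eventually h⟩

/-- The relation `dL_g = dR_g ∘ Ad g`, in the chart at `1`. -/
theorem eventually_fderiv_chartMul_eq :
    ∀ᶠ x in 𝓝 (chartOne n G),
      (fderiv ℝ (chartMul n G) (x, chartOne n G)).comp (ContinuousLinearMap.inr ℝ _ _)
      = ((fderiv ℝ (chartMul n G) (chartOne n G, x)).comp (ContinuousLinearMap.inl ℝ _ _)).comp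
        (chartAd n G x) := by
  filter_upwards [eventually_mem_chart_target (n := n) (G := G),
    (eventually_differentiableAt_chartMul (n := n) (G := G)).1,
    (eventually_differentiableAt_chartMul (n := n) (G := G)).2] with x hx h1 h2
  ext1 Y
  simp only [ContinuousLinearMap.comp_apply, ContinuousLinearMap.inr_apply,
    ContinuousLinearMap.inl_apply]
  refine (fderiv_chartMul_right hx h1 Y).trans
    (Eq.trans ?_ (fderiv_chartMul_left hx h2 (Ad n ((extChartAt (𝓡 n) (1 : G)).symm x) Y)).symm)
  exact congrArg _ (mfderiv_mul_right_Ad _ _).symm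

theorem fderiv_chartMul_chartOne :
    (fderiv ℝ (chartMul n G) (chartOne n G, chartOne n G)).comp (ContinuousLinearMap.inl ℝ _ _)
      = ContinuousLinearMap.id ℝ (Model n) := by
  ext1 Y
  have h1 : mfderiv (𝓡 n) (𝓡 n) (extChartAt (𝓡 n) (1 : G)) (1 : G)
      = ContinuousLinearMap.id ℝ (TangentSpace (𝓡 n) (1 : G)) := mfderiv_extChartAt_self
  have h2 : (fun a : G => a * 1) = id := by ext; simp
  simp only [ContinuousLinearMap.comp_apply, ContinuousLinearMap.inl_apply]
  refine (fderiv_chartMul_left (x := chartOne n G) (mem_extChartAt_target (I := 𝓡 n) (1 : G))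
    (contDiffAt_chartMul.differentiableAt (by simp)) Y).trans ?_
  rw [symm_chartOne, h1, h2, mfderiv_id]
  rfl

theorem contDiffAt_chartAd : ContDiffAt ℝ ∞ (chartAd n G) (chartOne n G) := by
  have h : ContDiffAt ℝ ∞ (fderiv ℝ (chartMul n G)) (chartOne n G, chartOne n G) :=
    contDiffAt_chartMul.fderiv_right (m := ∞) (by simp)
  have hA : ContDiffAt ℝ ∞ (fun x => (fderiv ℝ (chartMul n G) (x, chartOne n G)).comp
      (ContinuousLinearMap.inr ℝ (Model n) (Model n))) (chartOne n G) :=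
    (ContDiffAt.comp (g := fderiv ℝ (chartMul n G)) (f := fun x => (x, chartOne n G))
      (chartOne n G) h (contDiffAt_id.prodMk contDiffAt_const)).clm_comp contDiffAt_const
  have hC : ContDiffAt ℝ ∞ (fun x => (fderiv ℝ (chartMul n G) (chartOne n G, x)).comp
      (ContinuousLinearMap.inl ℝ (Model n) (Model n))) (chartOne n G) :=
    (ContDiffAt.comp (g := fderiv ℝ (chartMul n G)) (f := fun x => (chartOne n G, x))
      (chartOne n G) h (contDiffAt_const.prodMk contDiffAt_id)).clm_comp contDiffAt_const
  have hinv : ContDiffAt ℝ ∞ (fun x => ((fderiv ℝ (chartMul n G) (chartOne n G, x)).comp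
      (ContinuousLinearMap.inl ℝ (Model n) (Model n))).inverse) (chartOne n G) := by
    refine ContDiffAt.comp (g := ContinuousLinearMap.inverse) (chartOne n G) ?_ hC
    rw [fderiv_chartMul_chartOne]
    exact contDiffAt_map_inverse (ContinuousLinearEquiv.refl ℝ (Model n))
  have hmem : ∀ᶠ x in 𝓝 (chartOne n G), (fderiv ℝ (chartMul n G) (chartOne n G, x)).comp
      (ContinuousLinearMap.inl ℝ (Model n) (Model n)) ∈
      Set.range ((↑) : (Model n ≃L[ℝ] Model n) → Model n →L[ℝ] Model n) := by
    refine hC.continuousAt.eventually_mem ?_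
    rw [fderiv_chartMul_chartOne]
    exact ContinuousLinearEquiv.nhds (ContinuousLinearEquiv.refl ℝ (Model n))
  refine (hinv.clm_comp hA).congr_of_eventuallyEq ?_
  filter_upwards [eventually_fderiv_chartMul_eq (n := n) (G := G), hmem] with x h1 h2
  obtain ⟨e, he⟩ := h2
  rw [h1, ← he, ContinuousLinearMap.inverse_equiv, ← ContinuousLinearMap.comp_assoc,
    ContinuousLinearEquiv.coe_symm_comp_coe, ContinuousLinearMap.id_comp]

/-- `Ad g`, as an endomorphism of the model space. -/
def adModel (n : ℕ) {G : Type*} [TopologicalSpace G]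
    [ChartedSpace (EuclideanSpace ℝ (Fin n)) G] [Group G] (g : G) : Model n →L[ℝ] Model n := Ad n g

/-- The adjoint representation is smooth: near `1` it is `(dR_g)⁻¹ ∘ dL_g`, and `Ad` is
multiplicative. -/
theorem contMDiff_adModel :
    ContMDiff (𝓡 n) 𝓘(ℝ, Model n →L[ℝ] Model n) ∞ (fun g : G => adModel n g) := by
  have h1 : ContMDiffAt (𝓡 n) 𝓘(ℝ, Model n →L[ℝ] Model n) ∞ (fun g : G => adModel n g) 1 := by
    have h2 : ContMDiffAt (𝓡 n) 𝓘(ℝ, Model n →L[ℝ] Model n) ∞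
        (fun g : G => chartAd n G (extChartAt (𝓡 n) (1 : G) g)) 1 :=
      ContMDiffAt.comp (I' := 𝓡 n) (1 : G) (g := chartAd n G)
        (contDiffAt_chartAd (n := n) (G := G)).contMDiffAt contMDiffAt_extChartAt
    refine h2.congr_of_eventuallyEq ?_
    filter_upwards [extChartAt_source_mem_nhds (I := 𝓡 n) (1 : G)] with g hg
    rw [chartAd, (extChartAt (𝓡 n) (1 : G)).left_inv hg]
    rfl
  intro g₀
  have e : (fun g : G => adModel n g) = fun g => (adModel n g₀).comp (adModel n (g₀⁻¹ * g)) := by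
    ext1 g
    have := Ad_mul (n := n) g₀ (g₀⁻¹ * g)
    rw [mul_inv_cancel_left] at this
    exact this
  rw [e]
  have h3 : ContMDiffAt (𝓡 n) 𝓘(ℝ, Model n →L[ℝ] Model n) ∞
      (fun g : G => adModel n (g₀⁻¹ * g)) g₀ := by
    refine ContMDiffAt.comp (I' := 𝓡 n) (g := fun g : G => adModel n g) g₀ ?_
      (contMDiff_mul_left (I := 𝓡 n) (n := ∞)).contMDiffAt
    rw [inv_mul_cancel]; exact h1
  exact contMDiffAt_const.clm_comp h3

/-- The derivative at `1` of the adjoint representation is the bracket. -/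
theorem fderiv_chartAd (X Y : GroupLieAlgebra (𝓡 n) G) :
    (fderiv ℝ (chartAd n G) (chartOne n G) X Y : GroupLieAlgebra (𝓡 n) G) = ⁅X, Y⁆ := by
  set e := chartOne n G with he
  set D := fderiv ℝ (fderiv ℝ (chartMul n G)) (e, e) with hD
  have hD0 : HasFDerivAt (fderiv ℝ (chartMul n G)) D (e, e) :=
    ((contDiffAt_chartMul.fderiv_right (m := ∞) (by simp)).differentiableAt (by simp)).hasFDerivAt
  have hsymm : ∀ v w, D v w = D w v := fun v w =>
    second_derivative_symmetric_of_eventually (f := chartMul n G) (f' := fderiv ℝ (chartMul n G))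
      (((contDiffAt_chartMul (n := n) (G := G)).of_le (m := 1) (by simp)).eventually (by simp)
        |>.mono fun z hz => (hz.differentiableAt (by simp)).hasFDerivAt) hD0 v w
  have hA : HasFDerivAt (fun x => fderiv ℝ (chartMul n G) (x, e))
      (D.comp (ContinuousLinearMap.inl ℝ (Model n) (Model n))) e :=
    HasFDerivAt.comp (g := fderiv ℝ (chartMul n G)) (f := fun x => (x, e)) e hD0
      (hasFDerivAt_prodMk_left e e)
  have hC : HasFDerivAt (fun x => fderiv ℝ (chartMul n G) (e, x))
      (D.comp (ContinuousLinearMap.inr ℝ (Model n) (Model n))) e :=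
    HasFDerivAt.comp (g := fderiv ℝ (chartMul n G)) (f := fun x => (e, x)) e hD0
      (hasFDerivAt_prodMk_right e e)
  have hα : HasFDerivAt (chartAd n G) (fderiv ℝ (chartAd n G) e) e :=
    (contDiffAt_chartAd.differentiableAt (by simp)).hasFDerivAt
  have hα1 : chartAd n G e = ContinuousLinearMap.id ℝ (Model n) := by
    rw [chartAd, he, symm_chartOne]; exact Ad_one
  have hAv : ∀ Z : Model n, HasFDerivAt (fun x => fderiv ℝ (chartMul n G) (x, e) (0, Z))
      ((D.comp (ContinuousLinearMap.inl ℝ (Model n) (Model n))).flip (0, Z)) e := fun Z => by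
    simpa using hA.clm_apply (hasFDerivAt_const ((0 : Model n), Z) e)
  -- Differentiate the relation `dL_g = dR_g ∘ Ad g`.
  have key : ∀ X Y : Model n, D (X, 0) (0, Y) = D (0, X) (Y, 0)
      + fderiv ℝ (chartAd n G) e X Y := by
    intro X Y
    have h1 := hC.clm_apply ((hα.clm_apply (hasFDerivAt_const Y e)).prodMk
      (hasFDerivAt_const (0 : Model n) e))
    have h2 : (fun x => fderiv ℝ (chartMul n G) (x, e) (0, Y)) =ᶠ[𝓝 e]
        fun x => fderiv ℝ (chartMul n G) (e, x) (chartAd n G x Y, 0) := by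
      filter_upwards [eventually_fderiv_chartMul_eq (n := n) (G := G)] with x hx
      exact congrArg (fun T : Model n →L[ℝ] Model n => T Y) hx
    have h3 := congrArg (fun T : Model n →L[ℝ] Model n => T X)
      ((hAv Y).unique (h1.congr_of_eventuallyEq h2))
    have h4 : ∀ Z : Model n, fderiv ℝ (chartMul n G) (e, e) (Z, 0) = Z := fun Z =>
      congrArg (fun T : Model n →L[ℝ] Model n => T Z) (fderiv_chartMul_chartOne (n := n) (G := G))
    simp [hα1, h4] at h3
    rw [h3, add_comm]
  have hV : ∀ Y : GroupLieAlgebra (𝓡 n) G, (fun x => fderiv ℝ (chartMul n G) (x, e) (0, Y)) =ᶠ[𝓝 e]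
      mpullbackWithin (𝓡 n) (𝓡 n) (extChartAt (𝓡 n) (1 : G)).symm (mulInvariantVectorField Y)
        (Set.range (𝓡 n)) := fun Y => by
    filter_upwards [eventually_mem_chart_target (n := n) (G := G),
      (eventually_differentiableAt_chartMul (n := n) (G := G)).1] with x hx h1
    refine (fderiv_chartMul_right hx h1 Y).trans ?_
    rw [mpullbackWithin_apply]
    exact congrArg (fun T : Model n →L[ℝ] Model n =>
      T (mulInvariantVectorField Y ((extChartAt (𝓡 n) (1 : G)).symm x)))
      (ContinuousLinearMap.inverse_eq (mfderivWithin_extChartAt_symm_comp_mfderiv_extChartAt hx)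
        (mfderiv_extChartAt_comp_mfderivWithin_extChartAt_symm hx)).symm
  have hbr : (⁅X, Y⁆ : GroupLieAlgebra (𝓡 n) G) = lieBracket ℝ
      (fun x => fderiv ℝ (chartMul n G) (x, e) (0, X))
      (fun x => fderiv ℝ (chartMul n G) (x, e) (0, Y)) e := by
    rw [GroupLieAlgebra.bracket_def, ← mlieBracketWithin_univ, mlieBracketWithin_apply,
      (hV X).lieBracket_vectorField_eq (hV Y)]
    simp only [Set.preimage_univ, Set.univ_inter]
    rw [ModelWithCorners.range_eq_univ (𝓡 n)]
    have h1 : mfderiv (𝓡 n) (𝓡 n) (extChartAt (𝓡 n) (1 : G)) (1 : G)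
        = ContinuousLinearMap.id ℝ (TangentSpace (𝓡 n) (1 : G)) := mfderiv_extChartAt_self
    exact (congrArg (fun T : Model n →L[ℝ] Model n => T _)
      ((congrArg ContinuousLinearMap.inverse h1).trans ContinuousLinearMap.inverse_id)).trans
      (congrFun lieBracketWithin_univ e)
  have hE : ∀ Z : Model n, fderiv ℝ (chartMul n G) (e, e) (0, Z) = Z := fun Z => by
    have h1 := (eventually_fderiv_chartMul_eq (n := n) (G := G)).self_of_nhds
    rw [fderiv_chartMul_chartOne, ← he, hα1] at h1
    exact congrArg (fun T : Model n →L[ℝ] Model n => T Z) h1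
  have hfin : ∀ X Y : Model n, lieBracket ℝ (fun x => fderiv ℝ (chartMul n G) (x, e) (0, X))
      (fun x => fderiv ℝ (chartMul n G) (x, e) (0, Y)) e = fderiv ℝ (chartAd n G) e X Y := by
    intro X Y
    rw [lieBracket_eq]
    dsimp only
    rw [(hAv X).fderiv, (hAv Y).fderiv, hE, hE]
    simp only [ContinuousLinearMap.flip_apply, ContinuousLinearMap.comp_apply,
      ContinuousLinearMap.inl_apply]
    rw [key X Y, hsymm (Y, 0) (0, X)]
    abel
  rw [hbr]
  exact (hfin X Y).symm

end AdjointRepresentation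

/-! ### One-parameter groups -/

section OneParameterGroups

open VectorField Filter Topology

variable {n : ℕ} {G : Type*} [TopologicalSpace G] [ChartedSpace (EuclideanSpace ℝ (Fin n)) G]
  [Group G] [LieGroup (𝓡 n) ∞ G] {γ δ : ℝ → G} {X Y : GroupLieAlgebra (𝓡 n) G}

theorem hasMFDerivAt_mul_left (g a : G) :
    HasMFDerivAt (𝓡 n) (𝓡 n) (fun a : G => g * a) a (mfderiv (𝓡 n) (𝓡 n) (fun a : G => g * a) a) :=
  ((contMDiff_mul_left (I := 𝓡 n) (n := ∞)).mdifferentiable (by simp) a).hasMFDerivAt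

theorem mfderiv_mul_left_mulInvariantVectorField (g a : G) (X : GroupLieAlgebra (𝓡 n) G) :
    (mfderiv (𝓡 n) (𝓡 n) (fun a : G => g * a) a : Model n →L[ℝ] Model n)
      (mulInvariantVectorField X a) = mulInvariantVectorField X (g * a) := by
  have e : (fun x : G => g * a * x) = (fun x : G => g * x) ∘ fun x : G => a * x := by
    ext x; simp [mul_assoc]
  have h1 : HasMFDerivAt (𝓡 n) (𝓡 n) (fun x : G => g * x) (a * 1)
      (mfderiv (𝓡 n) (𝓡 n) (fun x : G => g * x) a) := by
    rw [mul_one]; exact hasMFDerivAt_mul_left g a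
  have h2 := h1.comp (1 : G) (hasMFDerivAt_mul_left a 1)
  rw [← e] at h2
  exact (congrArg (fun T : Model n →L[ℝ] Model n => T X) h2.mfderiv).symm

/-- Left translates of integral curves of a left invariant vector field are integral curves. -/
theorem IsMIntegralCurveOn.mul_left {s : Set ℝ}
    (h : IsMIntegralCurveOn (I := 𝓡 n) γ (mulInvariantVectorField X) s) (g : G) :
    IsMIntegralCurveOn (I := 𝓡 n) (fun t => g * γ t) (mulInvariantVectorField X) s := by
  intro t ht
  have h1 := (hasMFDerivAt_mul_left (n := n) g (γ t)).comp_hasMFDerivWithinAt t (h t ht)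
  refine h1.congr_mfderiv ?_
  ext1
  change (mfderiv (𝓡 n) (𝓡 n) (fun a : G => g * a) (γ t) : Model n →L[ℝ] Model n)
    ((1 : ℝ) • _) = (1 : ℝ) • _
  rw [one_smul, one_smul]
  exact mfderiv_mul_left_mulInvariantVectorField g (γ t) X

theorem contMDiff_one_mulInvariantVectorField (X : GroupLieAlgebra (𝓡 n) G) :
    ContMDiff (𝓡 n) (𝓡 n).tangent 1
      (fun g : G => (⟨g, mulInvariantVectorField X g⟩ : TangentBundle (𝓡 n) G)) :=
  (contMDiff_mulInvariantVectorField X).of_le (by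
    rw [minSmoothness_of_isRCLikeNormedField]; norm_num)

/-- One-parameter groups are integral curves of left invariant vector fields. -/
theorem IsOneParameterGroup.isMIntegralCurve (h : IsOneParameterGroup n γ X) :
    IsMIntegralCurve (I := 𝓡 n) γ (mulInvariantVectorField X) := by
  intro t
  have e : γ = (fun x : G => γ t * x) ∘ γ ∘ fun s => s - t := by
    ext s; simp [← h.map_add]
  have h1 : HasMFDerivAt 𝓘(ℝ, ℝ) 𝓘(ℝ, ℝ) (fun s : ℝ => s - t) t (ContinuousLinearMap.id ℝ ℝ) :=
    ((hasFDerivAt_id t).sub_const t).hasMFDerivAt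
  have h2 : HasMFDerivAt 𝓘(ℝ, ℝ) (𝓡 n) γ (t - t) (mfderiv 𝓘(ℝ, ℝ) (𝓡 n) γ 0) := by
    rw [sub_self]
    exact (h.contMDiff.mdifferentiable (by simp) 0).hasMFDerivAt
  have h3 : HasMFDerivAt (𝓡 n) (𝓡 n) (fun x : G => γ t * x) ((γ ∘ fun s => s - t) t)
      (mfderiv (𝓡 n) (𝓡 n) (fun x : G => γ t * x) 1) := by
    have : (γ ∘ fun s => s - t) t = 1 := by simp [h.map_zero]
    rw [this]
    exact hasMFDerivAt_mul_left (n := n) _ _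
  have h4 := h3.comp t (HasMFDerivAt.comp (f := fun s : ℝ => s - t) t h2 h1)
  rw [← e] at h4
  refine h4.congr_mfderiv ?_
  ext1
  change (mfderiv (𝓡 n) (𝓡 n) (fun x : G => γ t * x) 1 : Model n →L[ℝ] Model n)
    ((mfderiv 𝓘(ℝ, ℝ) (𝓡 n) γ 0 : ℝ →L[ℝ] Model n) 1) = (1 : ℝ) • mulInvariantVectorField X (γ t)
  rw [one_smul]
  exact congrArg (mfderiv (𝓡 n) (𝓡 n) (fun x : G => γ t * x) 1 : Model n →L[ℝ] Model n) h.velocity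

theorem IsOneParameterGroup.eq [T2Space G] (hγ : IsOneParameterGroup n γ X)
    (hδ : IsOneParameterGroup n δ X) : γ = δ :=
  isMIntegralCurve_Ioo_eq_of_contMDiff_boundaryless (t₀ := 0)
    (contMDiff_one_mulInvariantVectorField X) hγ.isMIntegralCurve hδ.isMIntegralCurve
    (by rw [hγ.map_zero, hδ.map_zero])

/-- The left invariant vector field with value `X` at `1`, in the chart at `1`. -/
def chartField (X : GroupLieAlgebra (𝓡 n) G) (x : Model n) : Model n :=
  fderiv ℝ (chartMul n G) (x, chartOne n G) (0, X)

theorem contDiffOn_chartField (X : GroupLieAlgebra (𝓡 n) G) :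
    ContDiffOn ℝ ∞ (chartField X) (extChartAt (𝓡 n) (1 : G)).target := by
  intro x hx
  have h : ContDiffAt ℝ ∞ (fderiv ℝ (chartMul n G)) (x, chartOne n G) :=
    (contDiffAt_chartMul_of_mem hx).fderiv_right (m := ∞) (by simp)
  exact ((ContDiffAt.comp (g := fderiv ℝ (chartMul n G)) (f := fun x => (x, chartOne n G))
      x h (contDiffAt_id.prodMk contDiffAt_const)).clm_apply contDiffAt_const).contDiffWithinAt

theorem hasDerivAt_chart {t : ℝ} (hγ : HasMFDerivAt 𝓘(ℝ, ℝ) (𝓡 n) γ t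
      ((1 : ℝ →L[ℝ] ℝ).smulRight (mulInvariantVectorField X (γ t))))
    (ht : γ t ∈ (extChartAt (𝓡 n) (1 : G)).source) :
    HasDerivAt (fun t => extChartAt (𝓡 n) (1 : G) (γ t))
      (chartField X (extChartAt (𝓡 n) (1 : G) (γ t))) t := by
  have h1 := fderiv_chartMul_right ((extChartAt (𝓡 n) (1 : G)).map_source ht)
    ((contDiffAt_chartMul_of_mem ((extChartAt (𝓡 n) (1 : G)).map_source ht)).differentiableAt
      (by simp)) X
  rw [(extChartAt (𝓡 n) (1 : G)).left_inv ht] at h1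
  have h2 : HasMFDerivAt (𝓡 n) (𝓡 n) (extChartAt (𝓡 n) (1 : G)) (γ t)
      (mfderiv (𝓡 n) (𝓡 n) (extChartAt (𝓡 n) (1 : G)) (γ t)) :=
    (mdifferentiableAt_extChartAt (by rwa [extChartAt_source] at ht)).hasMFDerivAt
  have h3 : HasFDerivAt (𝕜 := ℝ) (E := ℝ) (F := Model n)
      (fun t => extChartAt (𝓡 n) (1 : G) (γ t)) _ t :=
    hasMFDerivAt_iff_hasFDerivAt.1 (h2.comp t hγ)
  refine h3.hasDerivAt.congr_deriv ?_
  change (mfderiv (𝓡 n) (𝓡 n) (extChartAt (𝓡 n) (1 : G)) (γ t) : Model n →L[ℝ] Model n)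
    ((1 : ℝ) • _) = _
  rw [one_smul, chartField]
  exact h1.symm

/-- Integral curves of left invariant vector fields are smooth, by the regularity theory of ordinary
differential equations in the chart at `1`. -/
theorem contMDiffAt_zero_of_isMIntegralCurve
    (h : IsMIntegralCurve (I := 𝓡 n) γ (mulInvariantVectorField X)) (h0 : γ 0 = 1) :
    ContMDiffAt 𝓘(ℝ, ℝ) (𝓡 n) ∞ γ 0 := by
  have hc : Continuous γ := h.continuous
  have hs : ∀ᶠ t in 𝓝 (0 : ℝ), γ t ∈ (extChartAt (𝓡 n) (1 : G)).source :=
    hc.continuousAt.eventually_mem (by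
      rw [h0]; exact extChartAt_source_mem_nhds (I := 𝓡 n) (1 : G))
  obtain ⟨r, hr, hball⟩ := Metric.eventually_nhds_iff_ball.1 hs
  have hmem : ∀ t ∈ Set.Icc (-(r / 2)) (r / 2), γ t ∈ (extChartAt (𝓡 n) (1 : G)).source :=
    fun t ht => hball t (by
      rw [Real.ball_eq_Ioo]; exact ⟨by linarith [ht.1], by linarith [ht.2]⟩)
  have hu : ContDiffOn ℝ ∞ (fun t => extChartAt (𝓡 n) (1 : G) (γ t))
      (Set.Icc (-(r / 2)) (r / 2)) := by
    refine ODE.contDiffOn_enat_Icc_of_hasDerivWithinAt (n := ⊤) (f := fun _ => chartField X)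
      (u := (extChartAt (𝓡 n) (1 : G)).target) ?_ (fun t ht => ?_)
      fun t ht => (extChartAt (𝓡 n) (1 : G)).map_source (hmem t ht)
    · exact (contDiffOn_chartField X).comp contDiffOn_snd fun z hz => hz.2
    · exact (hasDerivAt_chart (h t) (hmem t ht)).hasDerivWithinAt
  have hu0 : ContMDiffAt 𝓘(ℝ, ℝ) (𝓡 n) ∞ (fun t => extChartAt (𝓡 n) (1 : G) (γ t)) 0 :=
    (hu.contDiffAt (Icc_mem_nhds (by linarith) (by linarith))).contMDiffAt
  have h1 : ContMDiffAt 𝓘(ℝ, ℝ) (𝓡 n) ∞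
      (fun t => (extChartAt (𝓡 n) (1 : G)).symm (extChartAt (𝓡 n) (1 : G) (γ t))) 0 := by
    refine ContMDiffAt.comp (I' := 𝓡 n) (g := (extChartAt (𝓡 n) (1 : G)).symm) 0
      (contMDiffAt_chart_symm ?_) hu0
    rw [h0]; exact mem_extChartAt_target (1 : G)
  refine h1.congr_of_eventuallyEq ?_
  filter_upwards [hs] with t ht
  exact ((extChartAt (𝓡 n) (1 : G)).left_inv ht).symm

/-- Every element of the Lie algebra generates a one-parameter group. -/
theorem exists_isOneParameterGroup [T2Space G] (X : GroupLieAlgebra (𝓡 n) G) :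
    ∃ γ, IsOneParameterGroup n γ X := by
  obtain ⟨γ₀, h0, hγ₀⟩ := exists_isMIntegralCurveAt_of_contMDiffAt_boundaryless (I := 𝓡 n) 0
    (contMDiff_one_mulInvariantVectorField X (1 : G))
  obtain ⟨ε, hε, hγ₀⟩ := isMIntegralCurveAt_iff'.1 hγ₀
  obtain ⟨γ, h1, hγ⟩ := exists_isMIntegralCurve_of_isMIntegralCurveOn (I := 𝓡 n)
    (contMDiff_one_mulInvariantVectorField X) hε (fun g => ⟨fun t => g * γ₀ t, by simp [h0], by
      have := IsMIntegralCurveOn.mul_left hγ₀ g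
      rwa [Real.ball_eq_Ioo, zero_sub, zero_add] at this⟩) (1 : G)
  have hadd : ∀ s t, γ (s + t) = γ s * γ t := fun s t => by
    have h2 : IsMIntegralCurve (I := 𝓡 n) (fun t => γ s * γ t) (mulInvariantVectorField X) := by
      rw [isMIntegralCurve_iff_isMIntegralCurveOn] at hγ ⊢
      exact IsMIntegralCurveOn.mul_left hγ _
    have h3 := hγ.comp_add s
    have h4 := isMIntegralCurve_Ioo_eq_of_contMDiff_boundaryless (t₀ := 0)
      (contMDiff_one_mulInvariantVectorField X) h3 h2 (by simp [h1])
    have h5 := congrFun h4 t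
    simpa [add_comm] using h5
  have hsm := contMDiffAt_zero_of_isMIntegralCurve hγ h1
  refine ⟨γ, fun t => ?_, h1, hadd, ?_⟩
  · have e : γ = fun s => γ t * γ (s - t) := by ext s; simp [← hadd]
    rw [e]
    refine contMDiffAt_const.mul (ContMDiffAt.comp (I' := 𝓘(ℝ, ℝ)) (g := γ) t ?_
      (contDiff_id.sub contDiff_const).contMDiff.contMDiffAt)
    simpa using hsm
  · rw [(hγ 0).mfderiv]
    have : mulInvariantVectorField X (1 : G) = X := by
      have e : (fun x : G => 1 * x) = id := by ext; simp
      rw [mulInvariantVectorField, e, mfderiv_id]; rfl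
    change (1 : ℝ) • (mulInvariantVectorField X (γ 0) : Model n) = X
    rw [one_smul, h1]
    exact this

theorem chartField_chartOne (X : GroupLieAlgebra (𝓡 n) G) : chartField X (chartOne n G) = X := by
  have hm := mem_extChartAt_target (I := 𝓡 n) (1 : G)
  have h1 : mfderiv (𝓡 n) (𝓡 n) (extChartAt (𝓡 n) (1 : G)) (1 : G)
      = ContinuousLinearMap.id ℝ (TangentSpace (𝓡 n) (1 : G)) := mfderiv_extChartAt_self
  have e : (fun x : G => 1 * x) = id := by ext; simp
  refine (fderiv_chartMul_right (x := chartOne n G) hm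
    ((contDiffAt_chartMul_of_mem hm).differentiableAt (by simp)) X).trans ?_
  rw [symm_chartOne, h1, mulInvariantVectorField, e, mfderiv_id]
  rfl

/-- `ad X`, as an endomorphism of the model space. -/
def bracketModel (X : GroupLieAlgebra (𝓡 n) G) : Model n →L[ℝ] Model n :=
  LinearMap.toContinuousLinearMap (E := Model n) (F' := Model n)
    (LieAlgebra.ad ℝ (GroupLieAlgebra (𝓡 n) G) X : _ →ₗ[ℝ] _)

theorem adModel_mul (g h : G) : adModel n (g * h) = (adModel n g).comp (adModel n h) := Ad_mul g h

omit [LieGroup (𝓡 n) ∞ G] in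
theorem adModel_one : adModel n (1 : G) = ContinuousLinearMap.id ℝ (Model n) := Ad_one

theorem IsOneParameterGroup.hasDerivAt_adModel_zero (h : IsOneParameterGroup n γ X) :
    HasDerivAt (fun t => adModel n (γ t)) (bracketModel X) 0 := by
  have hm := mem_extChartAt_source (I := 𝓡 n) (1 : G)
  have h1 := hasDerivAt_chart (h.isMIntegralCurve 0) (by rw [h.map_zero]; exact hm)
  have h2 : HasFDerivAt (chartAd n G) (fderiv ℝ (chartAd n G) (chartOne n G))
      (extChartAt (𝓡 n) (1 : G) (γ 0)) := by
    rw [h.map_zero]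
    exact (contDiffAt_chartAd.differentiableAt (by simp)).hasFDerivAt
  have h3 := h2.comp_hasDerivAt 0 h1
  have h4 : (fderiv ℝ (chartAd n G) (chartOne n G)) (chartField X (extChartAt (𝓡 n) (1 : G) (γ 0)))
      = bracketModel X := by
    rw [h.map_zero]
    have : chartField X (extChartAt (𝓡 n) (1 : G) 1) = X := chartField_chartOne X
    rw [this]
    ext1 Y
    exact fderiv_chartAd X Y
  rw [h4] at h3
  refine h3.congr_of_eventuallyEq ?_
  have hs : ∀ᶠ t in 𝓝 (0 : ℝ), γ t ∈ (extChartAt (𝓡 n) (1 : G)).source :=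
    h.contMDiff.continuous.continuousAt.eventually_mem (by
      rw [h.map_zero]; exact extChartAt_source_mem_nhds (I := 𝓡 n) (1 : G))
  filter_upwards [hs] with t ht
  simp only [Function.comp_apply, chartAd]
  rw [(extChartAt (𝓡 n) (1 : G)).left_inv ht]
  rfl

theorem IsOneParameterGroup.hasDerivAt_adModel (h : IsOneParameterGroup n γ X) (t : ℝ) :
    HasDerivAt (fun t => adModel n (γ t)) ((adModel n (γ t)).comp (bracketModel X)) t := by
  have e : (fun t => adModel n (γ t)) = fun s =>
      (adModel n (γ t)).comp (adModel n (γ (s - t))) := by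
    ext1 s; rw [← adModel_mul, ← h.map_add]; simp
  rw [e]
  have h1 : HasDerivAt (fun s => adModel n (γ (s - t))) (bracketModel X) t := by
    have h2 := h.hasDerivAt_adModel_zero
    rw [← sub_self t] at h2
    exact h2.comp_sub_const t t
  simpa using (hasDerivAt_const t (adModel n (γ t))).clm_comp h1

/-- The solution of the linear differential equation `a' = a b` with `a 0 = 1`. -/
theorem eq_exp_of_hasDerivAt {A : Type*} [NormedRing A] [NormedAlgebra ℝ A] [CompleteSpace A]
    {a : ℝ → A} {b : A} (h : ∀ t, HasDerivAt a (a t * b) t) (h0 : a 0 = 1) (t : ℝ) :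
    a t = NormedSpace.exp (t • b) := by
  let _ : NormedAlgebra ℚ A := NormedAlgebra.restrictScalars ℚ ℝ A
  have h1 : ∀ s, HasDerivAt (fun s => a s * NormedSpace.exp (s • -b)) 0 s := by
    intro s
    refine ((h s).mul (hasDerivAt_exp_smul_const' (𝕂 := ℝ) (-b) s)).congr_deriv ?_
    rw [neg_mul, mul_neg, mul_assoc, add_neg_cancel]
  have h2 : a t * NormedSpace.exp (t • -b) = a 0 * NormedSpace.exp ((0 : ℝ) • -b) :=
    is_const_of_deriv_eq_zero (fun s => (h1 s).differentiableAt) (fun s => (h1 s).deriv) t 0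
  rw [zero_smul, NormedSpace.exp_zero, h0, mul_one, smul_neg] at h2
  have h3 : NormedSpace.exp (-(t • b)) * NormedSpace.exp (t • b) = 1 := by
    rw [← NormedSpace.exp_add_of_commute (Commute.refl _).neg_left, neg_add_cancel,
      NormedSpace.exp_zero]
  calc a t = a t * (NormedSpace.exp (-(t • b)) * NormedSpace.exp (t • b)) := by rw [h3, mul_one]
    _ = _ := by rw [← mul_assoc, h2, one_mul]

/-- `Ad (exp (tX)) = exp (t ad X)`. -/
theorem IsOneParameterGroup.adModel_eq_exp (h : IsOneParameterGroup n γ X) (t : ℝ) :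
    adModel n (γ t) = NormedSpace.exp (t • bracketModel X) :=
  eq_exp_of_hasDerivAt (A := Model n →L[ℝ] Model n) (a := fun t => adModel n (γ t))
    (fun s => h.hasDerivAt_adModel s) (by rw [h.map_zero]; exact adModel_one) t

theorem IsOneParameterGroup.conj (h : IsOneParameterGroup n γ X) (g : G) :
    IsOneParameterGroup n (fun t => g * γ t * g⁻¹) (Ad n g X) := by
  refine ⟨?_, by simp [h.map_zero], fun s t => by simp [h.map_add, mul_assoc], ?_⟩
  · exact (contMDiff_const.mul h.contMDiff).mul contMDiff_const
  · have h1 : HasMFDerivAt (𝓡 n) (𝓡 n) (fun x : G => g * x * g⁻¹) (γ 0) (Ad n g) := by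
      rw [h.map_zero]; exact (mdifferentiable_conj g 1).hasMFDerivAt
    have h2 := h1.comp (0 : ℝ) (h.contMDiff.mdifferentiable (by simp) 0).hasMFDerivAt
    have h3 : mfderiv 𝓘(ℝ, ℝ) (𝓡 n) (fun t => g * γ t * g⁻¹) 0 = _ := h2.mfderiv
    rw [h3]
    change adModel n g ((mfderiv 𝓘(ℝ, ℝ) (𝓡 n) γ 0 : ℝ →L[ℝ] Model n) 1) = adModel n g X
    exact congrArg _ h.velocity

omit [LieGroup (𝓡 n) ∞ G] in
theorem IsOneParameterGroup.comp_mul (h : IsOneParameterGroup n γ X) (a : ℝ) :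
    IsOneParameterGroup n (fun t => γ (a * t)) (a • X) := by
  refine ⟨?_, by simp [h.map_zero], fun s t => by rw [mul_add, h.map_add], ?_⟩
  · exact h.contMDiff.comp (contDiff_const.mul contDiff_id).contMDiff
  · have h0 : HasMFDerivAt 𝓘(ℝ, ℝ) 𝓘(ℝ, ℝ) (fun s : ℝ => a * s) 0
        (a • ContinuousLinearMap.id ℝ ℝ) :=
      ((hasFDerivAt_id (0 : ℝ)).const_mul a).hasMFDerivAt
    have h1 : HasMFDerivAt 𝓘(ℝ, ℝ) (𝓡 n) γ (a * 0) (mfderiv 𝓘(ℝ, ℝ) (𝓡 n) γ 0) := by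
      rw [mul_zero]; exact (h.contMDiff.mdifferentiable (by simp) 0).hasMFDerivAt
    have h3 : mfderiv 𝓘(ℝ, ℝ) (𝓡 n) (fun t => γ (a * t)) 0 = _ :=
      (HasMFDerivAt.comp (f := fun s : ℝ => a * s) 0 h1 h0).mfderiv
    rw [h3]
    change (mfderiv 𝓘(ℝ, ℝ) (𝓡 n) γ 0 : ℝ →L[ℝ] Model n) (a • 1) = a • X
    rw [map_smul]
    exact congrArg (fun Z : Model n => a • Z) h.velocity

/-- `Ad g` preserves the bracket: differentiate `Ad (g γ g⁻¹) ∘ Ad g = Ad g ∘ Ad γ` along the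
one-parameter group `γ` of `X`. -/
theorem Ad_lie [T2Space G] (g : G) (X Y : GroupLieAlgebra (𝓡 n) G) :
    Ad n g ⁅X, Y⁆ = ⁅Ad n g X, Ad n g Y⁆ := by
  obtain ⟨γ, hγ⟩ := exists_isOneParameterGroup X
  have h1 := ((hγ.conj g).hasDerivAt_adModel_zero).clm_apply
    (hasDerivAt_const (F := Model n) (0 : ℝ) (adModel n g Y))
  have h2 := (hasDerivAt_const (0 : ℝ) (adModel n g)).clm_apply
    (hγ.hasDerivAt_adModel_zero.clm_apply (hasDerivAt_const (F := Model n) (0 : ℝ) Y))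
  have e : (fun t => adModel n (g * γ t * g⁻¹) (adModel n g Y))
      = fun t => adModel n g (adModel n (γ t) Y) := by
    ext1 t
    have h3 : adModel n (g * γ t * g⁻¹) * adModel n g = adModel n g * adModel n (γ t) := by
      rw [ContinuousLinearMap.mul_def, ContinuousLinearMap.mul_def, ← adModel_mul, ← adModel_mul,
        inv_mul_cancel_right]
    exact congrArg (fun T : Model n →L[ℝ] Model n => T Y) h3
  rw [e] at h1
  have h4 := h2.unique h1
  simp only [map_zero, add_zero, zero_apply, zero_add] at h4
  exact h4

variable (n) in
/-- `Ad g`, as an automorphism of the Lie algebra. -/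
def adEquiv [T2Space G] (g : G) : GroupLieAlgebra (𝓡 n) G ≃ₗ⁅ℝ⁆ GroupLieAlgebra (𝓡 n) G :=
  { (Ad n g).toLinearMap with
    map_lie' := fun {X Y} => Ad_lie g X Y
    invFun := Ad n g⁻¹
    left_inv := fun X => by
      have h := Ad_mul (n := n) g⁻¹ g
      rw [inv_mul_cancel, Ad_one] at h
      exact (congrArg (fun T : Model n →L[ℝ] Model n => T X) h).symm
    right_inv := fun X => by
      have h := Ad_mul (n := n) g g⁻¹
      rw [mul_inv_cancel, Ad_one] at h
      exact (congrArg (fun T : Model n →L[ℝ] Model n => T X) h).symm }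

theorem adEquiv_apply [T2Space G] (g : G) (X : GroupLieAlgebra (𝓡 n) G) :
    adEquiv n g X = Ad n g X := rfl

/-- The exponential map is continuous at `0`: in the chart at `1`, the curve `exp(tX)` has velocity
at most `C ‖X‖` as long as it stays in a fixed ball, so that it cannot leave the ball before `t = 1`
if `X` is small. -/
theorem exists_forall_isOneParameterGroup_mem [T2Space G] {U : Set G} (hU : U ∈ 𝓝 1) :
    ∃ δ > 0, ∀ (X : Model n) (γ : ℝ → G), IsOneParameterGroup n γ X → ‖X‖ < δ → γ 1 ∈ U := by
  set φ := extChartAt (𝓡 n) (1 : G) with hφ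
  set e := chartOne n G with he
  have hm : e ∈ φ.target := mem_extChartAt_target (1 : G)
  have hD : ContinuousAt (fun x => fderiv ℝ (chartMul n G) (x, e)) e := by
    have h : ContDiffAt ℝ ∞ (fderiv ℝ (chartMul n G)) (e, e) :=
      contDiffAt_chartMul.fderiv_right (m := ∞) (by simp)
    exact ContinuousAt.comp (g := fderiv ℝ (chartMul n G)) (f := fun x => (x, e)) h.continuousAt
      (by fun_prop)
  set C := ‖fderiv ℝ (chartMul n G) (e, e)‖ + 1 with hC
  have hC0 : 0 < C := by positivity
  have h1 : ∀ᶠ x in 𝓝 e, x ∈ φ.target ∧ φ.symm x ∈ U ∧ ‖fderiv ℝ (chartMul n G) (x, e)‖ < C := by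
    refine (eventually_mem_chart_target (n := n) (G := G)).and (Filter.Eventually.and ?_ ?_)
    · have : ContinuousAt φ.symm e := (contMDiffAt_chart_symm hm).continuousAt
      refine this.eventually_mem ?_
      rw [he, hφ, symm_chartOne]; exact hU
    · exact hD.norm.eventually_lt continuousAt_const (lt_add_one _)
  obtain ⟨r, hr, hball⟩ := Metric.nhds_basis_closedBall.eventually_iff.1 h1
  refine ⟨r / C, by positivity, fun X γ hγ hX => ?_⟩
  have hCX : C * ‖X‖ < r := by rwa [lt_div_iff₀' hC0] at hX
  set K : Set G := φ.symm '' Metric.closedBall e r with hK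
  have hKs : K ⊆ φ.source := by
    rintro _ ⟨x, hx, rfl⟩; exact φ.map_target (hball hx).1
  have hKu : ∀ g ∈ K, φ g ∈ Metric.closedBall e r := by
    rintro _ ⟨x, hx, rfl⟩; rwa [φ.right_inv (hball hx).1]
  have hKc : IsClosed K := by
    refine (IsCompact.image_of_continuousOn (isCompact_closedBall e r) ?_).isClosed
    exact (continuousOn_extChartAt_symm (1 : G)).mono fun x hx => (hball hx).1
  have hγc : Continuous γ := hγ.contMDiff.continuous
  set u : ℝ → Model n := fun t => φ (γ t) with hu
  have hu0 : u 0 = e := by simp only [hu, hγ.map_zero]; rfl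
  set S : Set ℝ := {t | γ t ∈ K ∧ ‖u t - e‖ ≤ C * ‖X‖ * t} with hS
  have hder : ∀ t, γ t ∈ K → HasDerivAt u (chartField (G := G) X (u t)) t ∧
      ‖chartField (G := G) X (u t)‖ ≤ C * ‖X‖ := fun t ht => by
    refine ⟨hasDerivAt_chart (hγ.isMIntegralCurve t) (hKs ht), ?_⟩
    refine (ContinuousLinearMap.le_opNorm _ _).trans ?_
    have h2 : ‖((0 : Model n), (X : Model n))‖ = ‖X‖ := by simp [Prod.norm_def]
    refine mul_le_mul (hball (hKu _ ht)).2.2.le h2.le (norm_nonneg _) hC0.le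
  have hSc : IsClosed (S ∩ Set.Icc 0 1) := by
    have hA : IsClosed (γ ⁻¹' K ∩ Set.Icc 0 1) := (hKc.preimage hγc).inter isClosed_Icc
    have hcont : ContinuousOn (fun t => ‖u t - e‖ - C * ‖X‖ * t) (γ ⁻¹' K ∩ Set.Icc 0 1) := by
      have : ContinuousOn u (γ ⁻¹' K ∩ Set.Icc 0 1) := fun t ht =>
        (hder t ht.1).1.continuousAt.continuousWithinAt
      fun_prop
    have h2 := hcont.preimage_isClosed_of_isClosed hA isClosed_Iic (t := Set.Iic (0 : ℝ))
    convert h2 using 1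
    ext t
    simp only [hS, Set.mem_inter_iff, Set.mem_ofPred_eq, Set.mem_preimage, Set.mem_Iic, sub_nonpos]
    tauto
  have h0S : (0 : ℝ) ∈ S := by
    refine ⟨⟨e, Metric.mem_closedBall_self hr.le, ?_⟩, by rw [hu0]; simp⟩
    rw [hγ.map_zero]; exact symm_chartOne
  have hstep : ∀ t ∈ S ∩ Set.Ico 0 1, ∀ y ∈ Set.Ioi t, (S ∩ Set.Ioc t y).Nonempty := by
    rintro t ⟨⟨htK, htu⟩, ht0, ht1⟩ y hy
    have h2 : ‖u t - e‖ < r := by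
      refine lt_of_le_of_lt htu (lt_of_le_of_lt ?_ hCX)
      exact mul_le_of_le_one_right (by positivity) ht1.le
    have h3 : ∀ᶠ s in 𝓝 t, γ s ∈ K := by
      have hs : ∀ᶠ s in 𝓝 t, γ s ∈ φ.source :=
        hγc.continuousAt.eventually_mem ((isOpen_extChartAt_source (1 : G)).mem_nhds (hKs htK))
      have hb : ∀ᶠ s in 𝓝 t, u s ∈ Metric.ball e r :=
        (hder t htK).1.continuousAt.eventually_mem
          (Metric.isOpen_ball.mem_nhds (by rwa [mem_ball_iff_norm]))
      filter_upwards [hs, hb] with s hs hb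
      exact ⟨u s, Metric.ball_subset_closedBall hb, φ.left_inv hs⟩
    obtain ⟨η, hη, hηK⟩ := Metric.eventually_nhds_iff_ball.1 h3
    set s := min y (t + η / 2) with hs
    have hts : t < s := lt_min hy (by linarith)
    have hseg : ∀ x ∈ Set.Icc t s, γ x ∈ K := fun x hx => hηK x (by
      rw [Real.ball_eq_Ioo]
      exact ⟨by linarith [hx.1], by linarith [hx.2, min_le_right y (t + η / 2)]⟩)
    refine ⟨s, ⟨hseg s ⟨hts.le, le_rfl⟩, ?_⟩, hts, min_le_left _ _⟩
    have h4 := (convex_Icc t s).norm_image_sub_le_of_norm_hasDerivWithin_le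
      (fun x hx => (hder x (hseg x hx)).1.hasDerivWithinAt) (fun x hx => (hder x (hseg x hx)).2)
      (Set.left_mem_Icc.2 hts.le) (Set.right_mem_Icc.2 hts.le)
    rw [Real.norm_of_nonneg (by linarith : 0 ≤ s - t)] at h4
    calc ‖u s - e‖ ≤ ‖u s - u t‖ + ‖u t - e‖ := norm_sub_le_norm_sub_add_norm_sub _ _ _
      _ ≤ C * ‖X‖ * (s - t) + C * ‖X‖ * t := add_le_add h4 htu
      _ = _ := by ring
  have hfin := hSc.Icc_subset_of_forall_exists_gt h0S hstep
  obtain ⟨⟨x, hx, hx1⟩, -⟩ := hfin (Set.right_mem_Icc.2 zero_le_one)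
  rw [← hx1]
  exact (hball hx).2.1

end OneParameterGroups

/-! ### The adjoint action of exponentials on a graded Lie algebra -/

section ExponentialSeries

variable {V : Type*} [NormedAddCommGroup V] [NormedSpace ℝ V] [CompleteSpace V]

theorem hasSum_exp_apply (T : V →L[ℝ] V) (v : V) :
    HasSum (fun k : ℕ => ((k.factorial : ℝ)⁻¹) • (T ^ k) v) (NormedSpace.exp T v) := by
  have h : HasSum (fun k : ℕ => ((k.factorial : ℝ)⁻¹) • T ^ k) (NormedSpace.exp T) :=
    NormedSpace.exp_series_hasSum_exp' (𝕂 := ℝ) T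
  have h2 := ContinuousLinearMap.hasSum (ContinuousLinearMap.apply ℝ V v) h
  simpa only [ContinuousLinearMap.apply_apply, smul_apply] using h2

/-- The remainder of the exponential series lies in each closed subspace that contains all its
terms. -/
theorem exp_apply_sub_sum_mem (T : V →L[ℝ] V) (v : V) {W : Submodule ℝ V}
    (hW : IsClosed (W : Set V)) (N : ℕ) (h : ∀ k, N ≤ k → (T ^ k) v ∈ W) :
    NormedSpace.exp T v - ∑ k ∈ Finset.range N, ((k.factorial : ℝ)⁻¹) • (T ^ k) v ∈ W := by
  have h1 := (hasSum_nat_add_iff' N).2 (hasSum_exp_apply T v)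
  exact hW.mem_of_tendsto h1 (Filter.Eventually.of_forall fun s =>
    sum_mem fun k _ => W.smul_mem _ (h _ (by omega)))

theorem exp_apply_of_eigenvector (T : V →L[ℝ] V) {v : V} {a : ℝ} (h : T v = a • v) :
    NormedSpace.exp T v = Real.exp a • v := by
  have hk : ∀ k : ℕ, (T ^ k) v = a ^ k • v := fun k => by
    induction k with
    | zero => simp
    | succ k ih => rw [pow_succ', mul_apply_eq_comp, ih, map_smul, h, smul_smul, pow_succ]
  have h1 := hasSum_exp_apply T v
  simp_rw [hk] at h1
  have h2 := (NormedSpace.exp_series_hasSum_exp' (𝕂 := ℝ) a).smul_const v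
  rw [← Real.exp_eq_exp_ℝ] at h2
  refine h1.unique ?_
  simpa [smul_smul] using h2

end ExponentialSeries

section GradedAdjoint

variable {n : ℕ} {G : Type*} [TopologicalSpace G] [ChartedSpace (EuclideanSpace ℝ (Fin n)) G]
  [Group G] [LieGroup (𝓡 n) ∞ G] {γ : ℝ → G} {X : GroupLieAlgebra (𝓡 n) G}

omit [LieGroup (𝓡 n) ∞ G] in
theorem isClosed_submodule (W : Submodule ℝ (GroupLieAlgebra (𝓡 n) G)) :
    IsClosed (W : Set (GroupLieAlgebra (𝓡 n) G)) := by
  have h : ∀ W : Submodule ℝ (Model n), IsClosed (W : Set (Model n)) :=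
    fun W => W.closed_of_finiteDimensional
  exact h W

theorem IsOneParameterGroup.Ad_sub_mem (h : IsOneParameterGroup n γ X)
    {W : Submodule ℝ (GroupLieAlgebra (𝓡 n) G)} {Y : GroupLieAlgebra (𝓡 n) G}
    (hY : ⁅X, Y⁆ ∈ W) (hW : ∀ Z ∈ W, ⁅X, Z⁆ ∈ W) (t : ℝ) :
    Ad n (γ t) Y - Y ∈ W := by
  set T : Model n →L[ℝ] Model n := t • bracketModel X with hT
  have h1 : ∀ k, 1 ≤ k → ((T ^ k) Y : GroupLieAlgebra (𝓡 n) G) ∈ W := by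
    intro k hk
    induction k, hk using Nat.le_induction with
    | base => rw [pow_one]; exact W.smul_mem t hY
    | succ k _ ih => rw [pow_succ']; exact W.smul_mem t (hW _ ih)
  have h2 := exp_apply_sub_sum_mem T (Y : Model n) (W := W) (isClosed_submodule W) 1 h1
  rw [hT, ← h.adModel_eq_exp] at h2
  simp only [Finset.sum_range_succ, Finset.sum_range_zero, Nat.factorial, Nat.cast_one, inv_one,
    pow_zero, one_smul, zero_add] at h2
  exact h2

theorem IsOneParameterGroup.Ad_sub_sub_mem (h : IsOneParameterGroup n γ X)
    {W : Submodule ℝ (GroupLieAlgebra (𝓡 n) G)} {Y : GroupLieAlgebra (𝓡 n) G}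
    (hY : ⁅X, ⁅X, Y⁆⁆ ∈ W) (hW : ∀ Z ∈ W, ⁅X, Z⁆ ∈ W) (t : ℝ) :
    Ad n (γ t) Y - Y - t • ⁅X, Y⁆ ∈ W := by
  set T : Model n →L[ℝ] Model n := t • bracketModel X with hT
  have h1 : ∀ k, 2 ≤ k → ((T ^ k) Y : GroupLieAlgebra (𝓡 n) G) ∈ W := by
    intro k hk
    induction k, hk using Nat.le_induction with
    | base =>
      rw [pow_two]
      have : T (T Y) = t • t • (⁅X, ⁅X, Y⁆⁆ : GroupLieAlgebra (𝓡 n) G) :=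
        congrArg (fun Z : Model n => t • Z) (map_smul (bracketModel X) t _)
      change T (T Y) ∈ W
      rw [this]
      exact W.smul_mem t (W.smul_mem t hY)
    | succ k _ ih => rw [pow_succ']; exact W.smul_mem t (hW _ ih)
  have h2 := exp_apply_sub_sum_mem T (Y : Model n) (W := W) (isClosed_submodule W) 2 h1
  rw [hT, ← h.adModel_eq_exp] at h2
  simp only [Finset.sum_range_succ, Finset.sum_range_zero] at h2
  simp only [Nat.factorial, Nat.cast_one, inv_one, pow_zero, one_smul, pow_one, zero_add,
    Nat.mul_one, ← sub_sub] at h2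
  exact h2

theorem IsOneParameterGroup.Ad_eigenvector (h : IsOneParameterGroup n γ X)
    {Y : GroupLieAlgebra (𝓡 n) G} {a : ℝ} (hY : ⁅X, Y⁆ = a • Y) (t : ℝ) :
    Ad n (γ t) Y = Real.exp (t * a) • Y := by
  have h1 : (t • bracketModel X : Model n →L[ℝ] Model n) (Y : Model n)
      = (t * a) • (Y : Model n) := by
    rw [mul_smul]
    exact congrArg (fun Z : Model n => t • Z) hY
  have h2 := exp_apply_of_eigenvector (V := Model n) _ h1
  rw [← h.adModel_eq_exp] at h2
  exact h2

theorem Ad_inv_Ad (g : G) (X : GroupLieAlgebra (𝓡 n) G) : Ad n g⁻¹ (Ad n g X) = X := by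
  have h := Ad_mul (n := n) g⁻¹ g
  rw [inv_mul_cancel, Ad_one] at h
  exact (congrArg (fun T : Model n →L[ℝ] Model n => T X) h).symm

theorem Ad_mul_apply (g h : G) (X : GroupLieAlgebra (𝓡 n) G) :
    Ad n (g * h) X = Ad n g (Ad n h X) :=
  congrArg (fun T : Model n →L[ℝ] Model n => T X) (Ad_mul g h)

omit [LieGroup (𝓡 n) ∞ G] in
theorem Ad_one_apply (X : GroupLieAlgebra (𝓡 n) G) : Ad n (1 : G) X = X :=
  congrArg (fun T : Model n →L[ℝ] Model n => T X) Ad_one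

variable {gr : KGrading (GroupLieAlgebra (𝓡 n) G)}

theorem IsOneParameterGroup.Ad_mem_piece (h : IsOneParameterGroup n γ X) (hX : X ∈ gr.piece 0)
    {i : ℤ} {Y : GroupLieAlgebra (𝓡 n) G} (hY : Y ∈ gr.piece i) (t : ℝ) :
    Ad n (γ t) Y ∈ gr.piece i := by
  have hb : ∀ Z ∈ gr.piece i, ⁅X, Z⁆ ∈ gr.piece i := fun Z hZ => by
    simpa using gr.lie_mem 0 i X hX Z hZ
  simpa using add_mem (h.Ad_sub_mem (hb Y hY) hb t) hY

/-- The adjoint action of `exp (tX)`, `X` homogeneous of degree `i ≥ 1`, modulo higher degree. -/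
theorem IsOneParameterGroup.Ad_sub_sub_mem_filt (h : IsOneParameterGroup n γ X) {i : ℤ} (hi : 1 ≤ i)
    (hX : X ∈ gr.piece i) {Y : GroupLieAlgebra (𝓡 n) G} (hY : Y ∈ gr.filt 0) (t : ℝ) :
    Ad n (γ t) Y - Y - t • ⁅X, Y⁆ ∈ gr.filt (i + 1) := by
  have hX' := gr.piece_le_filt le_rfl hX
  refine h.Ad_sub_sub_mem ?_ (fun Z hZ => ?_) t
  · exact gr.filt_anti (by omega) (gr.lie_mem_filt_add hX' (gr.lie_mem_filt_add hX' hY))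
  · exact gr.filt_anti (by omega) (gr.lie_mem_filt_add hX' hZ)

/-- Conjugation by `exp (tε)`, `ε` the grading element, contracts `p₊` as `t → -∞`. -/
theorem IsOneParameterGroup.tendsto_Ad_atBot {ε : GroupLieAlgebra (𝓡 n) G}
    (hε : gr.IsGradingElement ε) (h : IsOneParameterGroup n γ ε) {Y : GroupLieAlgebra (𝓡 n) G}
    (hY : Y ∈ gr.filt 1) :
    Filter.Tendsto (fun t => (adModel n (γ t) Y : Model n)) Filter.atBot (nhds 0) := by
  have h1 : ∀ j : ℤ, 1 ≤ j → ∀ Z ∈ gr.piece j,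
      Filter.Tendsto (fun t => (adModel n (γ t) Z : Model n)) Filter.atBot (nhds 0) := by
    intro j hj Z hZ
    have e : (fun t => (adModel n (γ t) Z : Model n)) = fun t => Real.exp (t * j) • (Z : Model n) :=
      funext fun t => h.Ad_eigenvector (hε j Z hZ) t
    rw [e]
    have h2 : Filter.Tendsto (fun t : ℝ => Real.exp (t * j)) Filter.atBot (nhds 0) := by
      refine Real.tendsto_exp_atBot.comp ?_
      exact Filter.tendsto_id.atBot_mul_const (by exact_mod_cast hj)
    have h3 := h2.smul_const (Z : Model n)
    rwa [zero_smul] at h3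
  refine Submodule.iSup_induction' (p := fun j : ℤ => ⨆ _ : 1 ≤ j, gr.piece j)
    (motive := fun Y _ =>
      Filter.Tendsto (fun t => (adModel n (γ t) Y : Model n)) Filter.atBot (nhds 0))
    (fun j Z hZ => ?_) ?_ (fun Z W _ _ h1 h2 => ?_) hY
  · by_cases hj : 1 ≤ j
    · simp only [hj, iSup_pos] at hZ
      exact h1 j hj Z hZ
    · simp only [hj, iSup_false, Submodule.mem_bot] at hZ
      have : (fun t => (adModel n (γ t) Z : Model n)) = fun _ => 0 := by
        funext t; rw [hZ]; exact _root_.map_zero (adModel n (γ t))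
      rw [this]; exact tendsto_const_nhds
  · have : (fun t => (adModel n (γ t) (0 : Model n) : Model n)) = fun _ => 0 := by
      funext t; exact _root_.map_zero (adModel n (γ t))
    exact this ▸ tendsto_const_nhds
  · have h3 := h1.add h2
    rw [add_zero] at h3
    refine h3.congr fun t => ?_
    exact (_root_.map_add (adModel n (γ t)) Z W).symm

end GradedAdjoint

/-! ### The structure of a parabolic subgroup -/

section ParabolicSubgroup

variable {n m : ℕ} {G : Type*} [TopologicalSpace G]
  [ChartedSpace (EuclideanSpace ℝ (Fin n)) G] [Group G] [LieGroup (𝓡 n) ∞ G]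
  {P : Subgroup G} [ChartedSpace (EuclideanSpace ℝ (Fin m)) P] [LieGroup (𝓡 m) ∞ P]
  {gr : KGrading (GroupLieAlgebra (𝓡 n) G)} {ε : GroupLieAlgebra (𝓡 n) G}

omit [LieGroup (𝓡 n) ∞ G] [LieGroup (𝓡 m) ∞ P] in
theorem IsClosedLieSubgroup.isOneParameterGroup_coe (hP : IsClosedLieSubgroup (n := n) (m := m) P)
    {γ : ℝ → P} {X : GroupLieAlgebra (𝓡 m) P} (h : IsOneParameterGroup m γ X) :
    IsOneParameterGroup n (fun t => (γ t : G)) (lieIncl n m P X) := by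
  refine ⟨hP.contMDiff.comp h.contMDiff, by simp [h.map_zero], fun s t => by simp [h.map_add], ?_⟩
  have h1 : HasMFDerivAt (𝓡 m) (𝓡 n) (fun p : P => (p : G)) (γ 0) (lieIncl n m P) := by
    rw [h.map_zero]; exact (hP.contMDiff.mdifferentiable (by simp) 1).hasMFDerivAt
  have h2 := h1.comp (0 : ℝ) (h.contMDiff.mdifferentiable (by simp) 0).hasMFDerivAt
  have h3 : mfderiv 𝓘(ℝ, ℝ) (𝓡 n) (fun t => (γ t : G)) 0 = _ := h2.mfderiv
  rw [h3]
  exact congrArg (lieIncl n m P : Model m → Model n) h.velocity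

theorem IsClosedLieSubgroup.Ad_lieIncl (hP : IsClosedLieSubgroup (n := n) (m := m) P) (p : P)
    (X : GroupLieAlgebra (𝓡 m) P) :
    Ad n (p : G) (lieIncl n m P X) = lieIncl n m P (Ad m p X) := by
  have hd := (hP.contMDiff.mdifferentiable (by simp) 1).hasMFDerivAt
  have e : (fun x : G => (p : G) * x * (p : G)⁻¹) ∘ (fun p : P => (p : G))
      = (fun p : P => (p : G)) ∘ (fun x : P => p * x * p⁻¹) := by ext x; simp
  have h1 : HasMFDerivAt (𝓡 n) (𝓡 n) (fun x : G => (p : G) * x * (p : G)⁻¹) ((1 : P) : G)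
      (Ad n (p : G)) := by
    rw [OneMemClass.coe_one]; exact (mdifferentiable_conj _ 1).hasMFDerivAt
  have h2 : HasMFDerivAt (𝓡 m) (𝓡 n) (fun p : P => (p : G)) (p * 1 * p⁻¹) (lieIncl n m P) := by
    rw [mul_one, mul_inv_cancel]; exact hd
  have h3 := h1.comp (1 : P) hd
  have h4 := h2.comp (1 : P) (mdifferentiable_conj p 1).hasMFDerivAt
  rw [e] at h3
  exact congrArg (fun T : Model m →L[ℝ] Model n => T X) (hasMFDerivAt_unique h3 h4)

namespace IsParabolicType

variable (hP : IsParabolicType (m := m) P gr)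
include hP

omit [LieGroup (𝓡 m) ∞ P] in
theorem isKilling : LieAlgebra.IsKilling ℝ (GroupLieAlgebra (𝓡 n) G) := by
  have := hP.semisimple
  infer_instance

omit [LieGroup (𝓡 m) ∞ P] in
theorem lieIncl_mem (X : GroupLieAlgebra (𝓡 m) P) : lieIncl n m P X ∈ gr.filt 0 := by
  have : lieIncl n m P X ∈ gr.parabolic.toSubmodule := by
    rw [← hP.lieAlgebra_eq]; exact ⟨X, rfl⟩
  exact this

omit [LieGroup (𝓡 m) ∞ P] in
theorem exists_lieIncl_eq {X : GroupLieAlgebra (𝓡 n) G} (hX : X ∈ gr.filt 0) :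
    ∃ X', lieIncl n m P X' = X := by
  have : X ∈ LinearMap.range (lieIncl n m P).toLinearMap := by
    rw [hP.lieAlgebra_eq]; exact hX
  exact this

theorem Ad_mem_filt_zero (p : P) {X : GroupLieAlgebra (𝓡 n) G} (hX : X ∈ gr.filt 0) :
    Ad n (p : G) X ∈ gr.filt 0 := by
  obtain ⟨X', rfl⟩ := hP.exists_lieIncl_eq hX
  rw [hP.closedSubgroup.Ad_lieIncl]
  exact hP.lieIncl_mem _

theorem Ad_mem_filt_zero_iff (p : P) {X : GroupLieAlgebra (𝓡 n) G} :
    Ad n (p : G) X ∈ gr.filt 0 ↔ X ∈ gr.filt 0 := by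
  refine ⟨fun h => ?_, hP.Ad_mem_filt_zero p⟩
  have := hP.Ad_mem_filt_zero p⁻¹ h
  rwa [InvMemClass.coe_inv, Ad_inv_Ad] at this

variable [T2Space G]

theorem exists_isOneParameterGroup {X : GroupLieAlgebra (𝓡 n) G} (hX : X ∈ gr.filt 0) :
    ∃ γ : ℝ → P, ContMDiff 𝓘(ℝ, ℝ) (𝓡 m) ∞ γ ∧ IsOneParameterGroup n (fun t => (γ t : G)) X := by
  obtain ⟨X', rfl⟩ := hP.exists_lieIncl_eq hX
  obtain ⟨γ, hγ⟩ := ParabolicGeometry.exists_isOneParameterGroup X'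
  exact ⟨γ, hγ.contMDiff, hP.closedSubgroup.isOneParameterGroup_coe hγ⟩

omit hP [LieGroup (𝓡 m) ∞ P] [T2Space G] [ChartedSpace (EuclideanSpace ℝ (Fin m)) P] in
theorem mem_PPlus {γ : ℝ → P} {X : GroupLieAlgebra (𝓡 n) G} (hX : X ∈ gr.filt 1)
    (hγ : IsOneParameterGroup n (fun t => (γ t : G)) X) (t : ℝ) : γ t ∈ PPlus P gr := by
  have h : IsOneParameterGroup n (fun s => (γ (t * s) : G)) (t • X) := hγ.comp_mul t
  exact Subgroup.subset_closure ⟨fun s => γ (t * s), t • X, Submodule.smul_mem _ t hX, h, by simp⟩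

/-- `p₊` is the annihilator of `p` for the Killing form, and hence invariant under `P`. -/
theorem Ad_mem_filt_one (hε : gr.IsGradingElement ε) (p : P) {X : GroupLieAlgebra (𝓡 n) G}
    (hX : X ∈ gr.filt 1) : Ad n (p : G) X ∈ gr.filt 1 := by
  have := hP.isKilling
  rw [hε.mem_filt_one_iff] at hX ⊢
  intro Y hY
  have h := LieAlgebra.killingForm_of_equiv_apply (adEquiv n (p : G)) X (Ad n (p : G)⁻¹ Y)
  have h2 : adEquiv n (p : G) (Ad n (p : G)⁻¹ Y) = Y := by
    have := Ad_inv_Ad (p : G)⁻¹ Y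
    rwa [inv_inv] at this
  rw [h2, adEquiv_apply] at h
  rw [h]
  refine hX _ ?_
  have := hP.Ad_mem_filt_zero p⁻¹ hY
  rwa [InvMemClass.coe_inv] at this

theorem conj_mem_PPlus (hε : gr.IsGradingElement ε) (p : P) {h : P} (hh : h ∈ PPlus P gr) :
    p * h * p⁻¹ ∈ PPlus P gr := by
  induction hh using Subgroup.closure_induction with
  | mem h hh =>
    obtain ⟨γ, X, hX, hγ, rfl⟩ := hh
    exact Subgroup.subset_closure ⟨fun t => p * γ t * p⁻¹, Ad n (p : G) X,
      hP.Ad_mem_filt_one hε p hX, by simpa using hγ.conj (p : G), rfl⟩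
  | one => simp [one_mem]
  | mul x y _ _ hx hy =>
    have e : p * (x * y) * p⁻¹ = (p * x * p⁻¹) * (p * y * p⁻¹) := by group
    rw [e]; exact mul_mem hx hy
  | inv x _ hx =>
    have e : p * x⁻¹ * p⁻¹ = (p * x * p⁻¹)⁻¹ := by group
    rw [e]; exact inv_mem hx

omit [ChartedSpace (EuclideanSpace ℝ (Fin m)) P] [LieGroup (𝓡 m) ∞ P] hP in
/-- `P₊` acts freely on the orbit of the grading element: an element of `P₊` fixing `ε` commutes
with `exp (tε)`, and conjugation by `exp (tε)` contracts `P₊` to `1` as `t → -∞`. -/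
theorem eq_one_of_Ad_eq (hε : gr.IsGradingElement ε) {h : P} (hh : h ∈ PPlus P gr)
    (hfix : Ad n (h : G) ε = ε) : h = 1 := by
  have := topologicalGroup_of_lieGroup (𝓡 n) ∞ (G := G)
  obtain ⟨γ, hγ⟩ := ParabolicGeometry.exists_isOneParameterGroup ε
  have hc : ∀ t, (h : G) * γ t * (h : G)⁻¹ = γ t := fun t => by
    have h1 := hγ.conj (h : G)
    rw [hfix] at h1
    exact congrFun (h1.eq hγ) t
  have hlim : Filter.Tendsto (fun t => γ t * (h : G) * (γ t)⁻¹) Filter.atBot (nhds 1) := by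
    clear hfix hc
    induction hh using Subgroup.closure_induction with
    | mem h hh =>
      obtain ⟨δ, X, hX, hδ, rfl⟩ := hh
      intro U hU
      obtain ⟨r, hr, hU'⟩ := exists_forall_isOneParameterGroup_mem (n := n) hU
      have h2 := (hγ.tendsto_Ad_atBot hε hX).eventually (Metric.ball_mem_nhds 0 hr)
      refine Filter.mem_map.2 ?_
      filter_upwards [h2] with t ht
      exact hU' (Ad n (γ t) X : Model n) _ (hδ.conj (γ t)) (mem_ball_zero_iff.1 ht)
    | one => simp
    | mul x y _ _ hx hy =>
      have := hx.mul hy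
      rw [mul_one] at this
      refine this.congr fun t => ?_
      simp only [Subgroup.coe_mul]; group
    | inv x _ hx =>
      have := hx.inv
      rw [inv_one] at this
      refine this.congr fun t => ?_
      simp only [InvMemClass.coe_inv]; group
  have h3 : (fun t => γ t * (h : G) * (γ t)⁻¹) = fun _ => (h : G) := funext fun t => by
    rw [← mul_left_inj (γ t), inv_mul_cancel_right]
    have := hc t
    rw [mul_inv_eq_iff_eq_mul] at this
    exact this.symm
  rw [h3] at hlim
  exact Subtype.ext (tendsto_nhds_unique tendsto_const_nhds hlim)

/-- A family of elements of `P₊` that acts like a given linear map into `g_i`, modulo higher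
degree. -/
theorem exists_family_of_linearMap {i : ℤ} (hi : 1 ≤ i)
    (R : GroupLieAlgebra (𝓡 n) G →ₗ[ℝ] GroupLieAlgebra (𝓡 n) G) (hR : ∀ Z, R Z ∈ gr.piece i) :
    ∃ e : Model n → P, ContMDiff (𝓡 n) (𝓡 m) ∞ e ∧ ∀ Z : GroupLieAlgebra (𝓡 n) G,
      e Z ∈ PPlus P gr ∧ ∀ Y ∈ gr.filt 0, Ad n (e Z : G) Y - Y - ⁅R Z, Y⁆ ∈ gr.filt (i + 1) := by
  have hrank1 : ∀ (φ : GroupLieAlgebra (𝓡 n) G →ₗ[ℝ] ℝ), ∀ v ∈ gr.piece i,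
      ∃ e : Model n → P, ContMDiff (𝓡 n) (𝓡 m) ∞ e ∧ ∀ Z : GroupLieAlgebra (𝓡 n) G,
      e Z ∈ PPlus P gr ∧
        ∀ Y ∈ gr.filt 0, Ad n (e Z : G) Y - Y - ⁅φ Z • v, Y⁆ ∈ gr.filt (i + 1) := by
    intro φ v hv
    obtain ⟨γ, hγ, hγ'⟩ := hP.exists_isOneParameterGroup (gr.piece_le_filt (by omega : 0 ≤ i) hv)
    refine ⟨fun Z => γ (φ Z), hγ.comp ?_, fun Z =>
      ⟨mem_PPlus (gr.piece_le_filt hi hv) hγ' _, fun Y hY => ?_⟩⟩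
    · have hl : ∀ φ : Model n →ₗ[ℝ] ℝ, ContMDiff (𝓡 n) 𝓘(ℝ, ℝ) ∞ φ :=
        fun φ => φ.toContinuousLinearMap.contMDiff
      exact hl φ
    · rw [smul_lie]; exact hγ'.Ad_sub_sub_mem_filt hi hv hY _
  have hsum : ∀ (s : Finset (Module.Basis.ofVectorSpaceIndex ℝ (gr.piece i))),
      ∃ e : Model n → P, ContMDiff (𝓡 n) (𝓡 m) ∞ e ∧ ∀ Z : GroupLieAlgebra (𝓡 n) G,
      e Z ∈ PPlus P gr ∧ ∀ Y ∈ gr.filt 0, Ad n (e Z : G) Y - Y -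
        ⁅(∑ a ∈ s, (Module.Basis.ofVectorSpace ℝ (gr.piece i)).coord a ⟨R Z, hR Z⟩ •
          ((Module.Basis.ofVectorSpace ℝ (gr.piece i) a : gr.piece i) :
            GroupLieAlgebra (𝓡 n) G)), Y⁆ ∈ gr.filt (i + 1) := by
    intro s
    classical
    induction s using Finset.induction_on with
    | empty => exact ⟨fun _ => 1, contMDiff_const, fun Z => ⟨one_mem _, fun Y _ => by
        simp [Ad_one_apply]⟩⟩
    | insert a s ha ih =>
      obtain ⟨e₁, he₁, h₁⟩ := hrank1
        ((Module.Basis.ofVectorSpace ℝ (gr.piece i)).coord a ∘ₗ R.codRestrict _ hR)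
        (Module.Basis.ofVectorSpace ℝ (gr.piece i) a : gr.piece i) (Subtype.coe_prop _)
      obtain ⟨e₂, he₂, h₂⟩ := ih
      refine ⟨fun Z => e₁ Z * e₂ Z, he₁.mul he₂, fun Z => ⟨mul_mem (h₁ Z).1 (h₂ Z).1,
        fun Y hY => ?_⟩⟩
      rw [Finset.sum_insert ha]
      have ea : ((Module.Basis.ofVectorSpace ℝ (gr.piece i)).coord a ∘ₗ R.codRestrict _ hR) Z
        = (Module.Basis.ofVectorSpace ℝ (gr.piece i)).coord a ⟨R Z, hR Z⟩ := rfl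
      have hs : (∑ a ∈ s, (Module.Basis.ofVectorSpace ℝ (gr.piece i)).coord a ⟨R Z, hR Z⟩ •
          ((Module.Basis.ofVectorSpace ℝ (gr.piece i) a : gr.piece i) :
            GroupLieAlgebra (𝓡 n) G)) ∈ gr.piece i :=
        sum_mem fun b _ => Submodule.smul_mem _ _ (Subtype.coe_prop _)
      have hv : ((Module.Basis.ofVectorSpace ℝ (gr.piece i)).coord a ⟨R Z, hR Z⟩ •
          ((Module.Basis.ofVectorSpace ℝ (gr.piece i) a : gr.piece i) :
            GroupLieAlgebra (𝓡 n) G)) ∈ gr.piece i :=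
        Submodule.smul_mem _ _ (Subtype.coe_prop _)
      have h₁ := (h₁ Z).2
      rw [ea] at h₁
      have h₂ := (h₂ Z).2
      generalize (∑ a ∈ s, (Module.Basis.ofVectorSpace ℝ (gr.piece i)).coord a ⟨R Z, hR Z⟩ •
          ((Module.Basis.ofVectorSpace ℝ (gr.piece i) a : gr.piece i) :
            GroupLieAlgebra (𝓡 n) G)) = S at hs h₂ ⊢
      generalize ((Module.Basis.ofVectorSpace ℝ (gr.piece i)).coord a ⟨R Z, hR Z⟩ •
          ((Module.Basis.ofVectorSpace ℝ (gr.piece i) a : gr.piece i) :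
            GroupLieAlgebra (𝓡 n) G)) = v at hv h₁ ⊢
      have hvf := gr.piece_le_filt le_rfl hv
      have hSf := gr.piece_le_filt le_rfl hs
      -- `Ad (e₁) D ≡ D` for `D` of degree at least `i`
      have h3 : ∀ D ∈ gr.filt i, Ad n (e₁ Z : G) D - D ∈ gr.filt (i + 1) := fun D hD => by
        have := add_mem (h₁ D (gr.filt_anti (by omega) hD))
          (gr.filt_anti (by omega : i + 1 ≤ i + i) (gr.lie_mem_filt_add hvf hD))
        simpa using this
      have hSY : ⁅S, Y⁆ ∈ gr.filt i := by simpa using gr.lie_mem_filt_add hSf hY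
      have hD : Ad n (e₂ Z : G) Y - Y ∈ gr.filt i := by
        have := add_mem (gr.filt_anti (by omega : i ≤ i + 1) (h₂ Y hY)) hSY
        simpa using this
      have h4 := add_mem (add_mem (h3 _ hD) (h₁ Y hY)) (h₂ Y hY)
      rw [map_sub] at h4
      rw [Subgroup.coe_mul, Ad_mul_apply, add_lie]
      convert h4 using 1
      abel
  obtain ⟨e, he, h⟩ := hsum Finset.univ
  refine ⟨e, he, fun Z => ⟨(h Z).1, fun Y hY => ?_⟩⟩
  have hZ : (∑ a, (Module.Basis.ofVectorSpace ℝ (gr.piece i)).coord a ⟨R Z, hR Z⟩ •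
          ((Module.Basis.ofVectorSpace ℝ (gr.piece i) a : gr.piece i) :
            GroupLieAlgebra (𝓡 n) G)) = R Z := by
    have := (Module.Basis.ofVectorSpace ℝ (gr.piece i)).sum_repr ⟨R Z, hR Z⟩
    have := congrArg (fun W : gr.piece i => (W : GroupLieAlgebra (𝓡 n) G)) this
    simpa using this
  have h5 := (h Z).2 Y hY
  rwa [hZ] at h5

/-- If `ad F`, `F ∈ g_0`, is surjective on each `g_j`, `j ≥ 1`, then `F + Z`, `Z ∈ p₊`, is conjugate
to `F` by an element of `P₊` that depends smoothly on `Z`: the components of `Z` are removed one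
after the other, in ascending degree. -/
theorem exists_smooth_conj {F : GroupLieAlgebra (𝓡 n) G} (hF : F ∈ gr.piece 0)
    (hsurj : ∀ j : ℤ, 1 ≤ j → ∀ X ∈ gr.piece j, ∃ Y ∈ gr.piece j, ⁅F, Y⁆ = X) :
    ∃ q : Model n → P, ContMDiff (𝓡 n) (𝓡 m) ∞ q ∧ ∀ Z ∈ gr.filt 1,
      q Z ∈ PPlus P gr ∧ Ad n (q Z : G) (F + Z) = F := by
  have key : ∀ N : ℕ, ∀ i : ℤ, 1 ≤ i → (gr.k : ℤ) < i + N →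
      ∃ q : Model n → P, ContMDiff (𝓡 n) (𝓡 m) ∞ q ∧ ∀ Z ∈ gr.filt i,
        q Z ∈ PPlus P gr ∧ Ad n (q Z : G) (F + Z) = F := by
    intro N
    induction N with
    | zero =>
      intro i hi hk
      refine ⟨fun _ => 1, contMDiff_const, fun Z hZ => ⟨one_mem _, ?_⟩⟩
      rw [gr.filt_eq_bot (by simpa using hk) hZ, add_zero, OneMemClass.coe_one, Ad_one_apply]
    | succ N ih =>
      intro i hi hk
      obtain ⟨q, hq, hq'⟩ := ih (i + 1) (by omega) (by push_cast at hk; omega)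
      let T : gr.piece i →ₗ[ℝ] gr.piece i :=
        ((LieAlgebra.ad ℝ (GroupLieAlgebra (𝓡 n) G) F : _ →ₗ[ℝ] _)).restrict
          (fun X hX => by simpa using gr.lie_mem 0 i F hF X hX)
      have hT : LinearMap.range T = ⊤ := LinearMap.range_eq_top.2 fun X => by
        obtain ⟨Y, hY, h⟩ := hsurj i hi X X.2
        exact ⟨⟨Y, hY⟩, Subtype.ext h⟩
      obtain ⟨S, hS⟩ := T.exists_rightInverse_of_surjective hT
      let R : GroupLieAlgebra (𝓡 n) G →ₗ[ℝ] GroupLieAlgebra (𝓡 n) G :=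
        (gr.piece i).subtype ∘ₗ S ∘ₗ (gr.proj i).codRestrict _ (gr.proj_mem i)
      have hR : ∀ Z, R Z ∈ gr.piece i := fun Z => Subtype.coe_prop _
      have hR' : ∀ Z, ⁅R Z, F⁆ = - gr.proj i Z := fun Z => by
        rw [← lie_skew]
        have := congrArg (fun f : gr.piece i →ₗ[ℝ] gr.piece i =>
          (f ⟨gr.proj i Z, gr.proj_mem i Z⟩ : GroupLieAlgebra (𝓡 n) G)) hS
        exact congrArg Neg.neg this
      obtain ⟨e, he, hep⟩ := hP.exists_family_of_linearMap hi R hR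
      let F' : Model n := F
      have hsm : ContMDiff (𝓡 n) (𝓡 n) ∞
          (fun Z : Model n => adModel n (e Z : G) (F' + Z) - F') := by
        have h1 := (contMDiff_adModel (n := n) (G := G)).comp (hP.closedSubgroup.contMDiff.comp he)
        exact (h1.clm_apply (contMDiff_const.add contMDiff_id)).sub contMDiff_const
      refine ⟨_, (hq.comp hsm).mul he, fun Z hZ => ?_⟩
      have hF0 : F ∈ gr.filt 0 := gr.piece_le_filt le_rfl hF
      have hZ0 : Z ∈ gr.filt 0 := gr.filt_anti (by omega) hZ
      have h1 := (hep Z).2 (F + Z) (add_mem hF0 hZ0)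
      have hW : Ad n (e Z : G) (F + Z) - F ∈ gr.filt (i + 1) := by
        rw [lie_add, hR'] at h1
        have h2 : ⁅R Z, Z⁆ ∈ gr.filt (i + 1) := gr.filt_anti (by omega : i + 1 ≤ i + i)
          (gr.lie_mem_filt_add (gr.piece_le_filt le_rfl (hR Z)) hZ)
        have h3 := add_mem (add_mem h1 h2) (gr.sub_proj_mem_filt hZ)
        convert h3 using 1
        abel
      obtain ⟨h4, h5⟩ := hq' _ hW
      refine ⟨mul_mem h4 (hep Z).1, ?_⟩
      rw [add_sub_cancel] at h5
      refine (Ad_mul_apply _ _ _).trans h5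
  exact key gr.k 1 le_rfl (by omega)

end IsParabolicType
end ParabolicSubgroup

/-! ### The Levi factor and the extension of scale representations to the parabolic subgroup -/

theorem KGrading.sub_proj_zero_mem_filt {L : Type*} [LieRing L] [LieAlgebra ℝ L]
    (gr : KGrading L) {X : L} (hX : X ∈ gr.filt 0) : X - gr.proj 0 X ∈ gr.filt 1 := by
  have h := gr.sub_proj_mem_filt hX
  rwa [zero_add] at h

theorem KGrading.IsGradingElement.eq_zero_of_lie_eq_zero {L : Type*} [LieRing L] [LieAlgebra ℝ L]
    {gr : KGrading L} {ε : L} (hε : gr.IsGradingElement ε) {X : L} (hX : X ∈ gr.filt 1)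
    (h : ⁅ε, X⁆ = 0) : X = 0 := by
  refine gr.eq_zero_of_proj fun i => ?_
  by_cases hi : i < 1
  · exact gr.mem_filt_iff.1 hX i hi
  · have h0 : X ∈ gr.piece 0 := by rw [hε.mem_piece_iff, h]; simp
    exact gr.proj_of_ne h0 (by omega)

section LeviFactor

variable {n m : ℕ} {G : Type*} [TopologicalSpace G] [T2Space G]
  [ChartedSpace (EuclideanSpace ℝ (Fin n)) G] [Group G] [LieGroup (𝓡 n) ∞ G]
  {P : Subgroup G} [ChartedSpace (EuclideanSpace ℝ (Fin m)) P] [LieGroup (𝓡 m) ∞ P]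
  {gr : KGrading (GroupLieAlgebra (𝓡 n) G)} {ε : GroupLieAlgebra (𝓡 n) G}

omit [LieGroup (𝓡 m) ∞ P] [ChartedSpace (EuclideanSpace ℝ (Fin m)) P] in
theorem mem_GZero_of_Ad_eq (hε : gr.IsGradingElement ε) {p : P} (h : Ad n (p : G) ε = ε) :
    p ∈ GZero P gr := by
  have key : ∀ q : P, Ad n (q : G) ε = ε → ∀ i, ∀ X ∈ gr.piece i, Ad n (q : G) X ∈ gr.piece i := by
    intro q hq i X hX
    rw [hε.mem_piece_iff] at hX ⊢
    conv_lhs => rw [← hq]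
    rw [← Ad_lie, hX, map_smul]
  have h' : Ad n ((p⁻¹ : P) : G) ε = ε := by
    rw [InvMemClass.coe_inv]
    conv_lhs => rw [← h]
    exact Ad_inv_Ad _ _
  intro i
  refine le_antisymm (Submodule.map_le_iff_le_comap.2 fun X hX => key p h i X hX) fun X hX => ?_
  refine ⟨Ad n ((p⁻¹ : P) : G) X, key _ h' i X hX, ?_⟩
  have := Ad_inv_Ad (p : G)⁻¹ X
  rwa [inv_inv] at this

namespace IsParabolicType

variable (hP : IsParabolicType (m := m) P gr) (hε : gr.IsGradingElement ε)
include hP hε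

/-- The grading element is the only element of its `P`-orbit that lies in `g_0`. -/
theorem Ad_eq_of_mem_piece {p : P} (h : Ad n (p : G) ε ∈ gr.piece 0) : Ad n (p : G) ε = ε := by
  have := hP.isKilling
  exact hε.map_eq_self (adEquiv n (p : G)) (fun X => hP.Ad_mem_filt_zero_iff p) h

/-- `G₀` is the stabilizer of the grading element in `P`. -/
theorem mem_GZero_iff {p : P} : p ∈ GZero P gr ↔ Ad n (p : G) ε = ε := by
  refine ⟨fun h => hP.Ad_eq_of_mem_piece hε ?_, mem_GZero_of_Ad_eq hε⟩
  have h0 : Ad n (p : G) ε ∈ (gr.piece 0).map (Ad n (p : G)).toLinearMap :=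
    ⟨ε, hε.mem_piece_zero, rfl⟩
  rwa [h 0] at h0

/-- If `Ad p ε` has `g_0`-component `E'`, then `ad E'` is onto on each `g_j`, `j ≥ 1`: `ad (Ad p ε)`
is injective on `p₊`, and preserves the filtration. -/
theorem exists_lie_proj_eq (p : P) {j : ℤ} (hj : 1 ≤ j) {X : GroupLieAlgebra (𝓡 n) G}
    (hX : X ∈ gr.piece j) : ∃ Y ∈ gr.piece j, ⁅gr.proj 0 (Ad n (p : G) ε), Y⁆ = X := by
  set E := Ad n (p : G) ε with hE
  have hE0 : E ∈ gr.filt 0 := hP.Ad_mem_filt_zero p (gr.piece_le_filt le_rfl hε.mem_piece_zero)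
  let T : gr.filt j →ₗ[ℝ] gr.filt j :=
    ((LieAlgebra.ad ℝ (GroupLieAlgebra (𝓡 n) G) E : _ →ₗ[ℝ] _)).restrict
      (fun X hX => by simpa using gr.lie_mem_filt_add hE0 hX)
  have hT : Function.Injective T := by
    rw [injective_iff_map_eq_zero]
    rintro ⟨Y, hY⟩ h
    have h1 : ⁅E, Y⁆ = 0 := congrArg Subtype.val h
    have h2 := congrArg (Ad n (p : G)⁻¹) h1
    rw [Ad_lie, hE, Ad_inv_Ad, map_zero] at h2
    have h3 := hP.Ad_mem_filt_one hε p⁻¹ (gr.filt_anti hj hY)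
    rw [InvMemClass.coe_inv] at h3
    have h4 := hε.eq_zero_of_lie_eq_zero h3 h2
    have h5 := Ad_inv_Ad (p : G)⁻¹ Y
    rw [h4, map_zero] at h5
    exact Subtype.ext h5.symm
  obtain ⟨⟨Y, hY⟩, hY'⟩ := LinearMap.injective_iff_surjective.1 hT ⟨X, gr.piece_le_filt le_rfl hX⟩
  have h6 : ⁅E, Y⁆ = X := congrArg Subtype.val hY'
  refine ⟨gr.proj j Y, gr.proj_mem j Y, ?_⟩
  have h7 : ⁅E, Y⁆ - ⁅gr.proj 0 E, gr.proj j Y⁆ ∈ gr.filt (j + 1) := by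
    have e : ⁅E, Y⁆ - ⁅gr.proj 0 E, gr.proj j Y⁆
        = ⁅E - gr.proj 0 E, Y⁆ + ⁅gr.proj 0 E, Y - gr.proj j Y⁆ := by
      rw [sub_lie, lie_sub]; abel
    rw [e]
    refine add_mem ?_ ?_
    · exact gr.filt_anti (by omega) (gr.lie_mem_filt_add (gr.sub_proj_mem_filt hE0) hY)
    · exact gr.filt_anti (by omega) (gr.lie_mem_filt_add
        (gr.piece_le_filt le_rfl (gr.proj_mem 0 E)) (gr.sub_proj_mem_filt hY))
  have h8 := gr.mem_filt_iff.1 h7 j (by omega)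
  have h9 : ⁅gr.proj 0 E, gr.proj j Y⁆ ∈ gr.piece j := by
    simpa using gr.lie_mem 0 j _ (gr.proj_mem 0 E) _ (gr.proj_mem j Y)
  rw [map_sub, h6, gr.proj_self hX, gr.proj_self h9, sub_eq_zero] at h8
  exact h8.symm

/-- The orbit of the grading element `ε` under `P` lies in `ε + p₊`: an element of `P₊` moves
`Ad p ε` to its `g_0`-component, which is `ε` as it lies in the `P`-orbit of `ε`. -/
theorem Ad_sub_mem_filt_one (p : P) : Ad n (p : G) ε - ε ∈ gr.filt 1 := by
  have hE0 : Ad n (p : G) ε ∈ gr.filt 0 :=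
    hP.Ad_mem_filt_zero p (gr.piece_le_filt le_rfl hε.mem_piece_zero)
  have hs := fun (j : ℤ) (hj : 1 ≤ j) X hX => hP.exists_lie_proj_eq hε p hj (X := X) hX
  obtain ⟨E, hE⟩ : ∃ E, E = Ad n (p : G) ε := ⟨_, rfl⟩
  rw [← hE] at hE0 hs ⊢
  have hZ : E - gr.proj 0 E ∈ gr.filt 1 := gr.sub_proj_zero_mem_filt hE0
  obtain ⟨h, h1⟩ : ∃ h : P, Ad n (h : G) (gr.proj 0 E + (E - gr.proj 0 E)) = gr.proj 0 E := by
    obtain ⟨q, -, hq⟩ := hP.exists_smooth_conj (gr.proj_mem 0 E) hs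
    exact ⟨_, (hq _ hZ).2⟩
  rw [add_sub_cancel, hE] at h1
  have h2 := (Ad_mul_apply (h : G) (p : G) ε).trans h1
  rw [← Subgroup.coe_mul] at h2
  have h3 := hP.Ad_eq_of_mem_piece hε (by rw [h2]; exact gr.proj_mem 0 _)
  rw [h2, ← hE] at h3
  rwa [h3] at hZ

/-- `P₊` acts transitively on `ε + p₊`, by elements that can be chosen to depend smoothly on the
point. -/
theorem exists_smooth_retraction :
    ∃ q : Model n → P, ContMDiff (𝓡 n) (𝓡 m) ∞ q ∧ ∀ Z ∈ gr.filt 1,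
      q Z ∈ PPlus P gr ∧ Ad n (q Z : G) (ε + Z) = ε := by
  refine hP.exists_smooth_conj hε.mem_piece_zero fun j hj X hX => ?_
  have h := hP.exists_lie_proj_eq hε 1 hj hX
  rwa [OneMemClass.coe_one, Ad_one_apply, gr.proj_self hε.mem_piece_zero] at h

theorem eq_one_of_mem {p : P} (h1 : p ∈ PPlus P gr) (h2 : p ∈ GZero P gr) : p = 1 :=
  eq_one_of_Ad_eq hε h1 ((hP.mem_GZero_iff hε).1 h2)

/-- The projection of `P = P₊ ⋊ G₀` onto the Levi factor `G₀`, as a smooth map. -/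
theorem exists_levi_projection :
    ∃ a : P →* P, ContMDiff (𝓡 m) (𝓡 m) ∞ a ∧ (∀ p, a p ∈ GZero P gr) ∧
      (∀ p, a p * p⁻¹ ∈ PPlus P gr) ∧ (∀ p ∈ PPlus P gr, a p = 1) ∧ ∀ g ∈ GZero P gr, a g = g := by
  obtain ⟨q, hq, hq'⟩ := hP.exists_smooth_retraction hε
  let ε' : Model n := ε
  let a : P → P := fun p => q (adModel n (p : G) ε' - ε') * p
  have ha : ContMDiff (𝓡 m) (𝓡 m) ∞ a := by
    have h1 := (contMDiff_adModel (n := n) (G := G)).comp hP.closedSubgroup.contMDiff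
    have h2 : ContMDiff (𝓡 m) (𝓡 n) ∞ (fun p : P => adModel n (p : G) ε' - ε') :=
      (h1.clm_apply contMDiff_const).sub contMDiff_const
    exact (hq.comp h2).mul contMDiff_id
  have haG : ∀ p, a p ∈ GZero P gr := fun p => mem_GZero_of_Ad_eq hε (by
    have h := (hq' _ (hP.Ad_sub_mem_filt_one hε p)).2
    rw [add_sub_cancel] at h
    exact (Ad_mul_apply _ _ _).trans h)
  have haP : ∀ p, a p * p⁻¹ ∈ PPlus P gr := fun p => by
    change q (Ad n (p : G) ε - ε) * p * p⁻¹ ∈ _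
    rw [mul_inv_cancel_right]
    exact (hq' _ (hP.Ad_sub_mem_filt_one hε p)).1
  have huniq : ∀ p g, g ∈ GZero P gr → g * p⁻¹ ∈ PPlus P gr → a p = g := fun p g hg hgp => by
    have h1 : a p * g⁻¹ ∈ PPlus P gr := by
      have := mul_mem (haP p) (inv_mem hgp)
      simpa [mul_assoc] using this
    exact mul_inv_eq_one.1 (hP.eq_one_of_mem hε h1 (mul_mem (haG p) (inv_mem hg)))
  have hmul : ∀ p p', a (p * p') = a p * a p' := fun p p' => by
    refine huniq _ _ (mul_mem (haG p) (haG p')) ?_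
    have := mul_mem (haP p) (hP.conj_mem_PPlus hε p (haP p'))
    convert this using 1
    group
  have hone : a 1 = 1 := huniq _ _ (one_mem _) (by simp [one_mem])
  exact ⟨⟨⟨a, hone⟩, hmul⟩, ha, haG, haP, fun p hp => huniq _ _ (one_mem _) (by simpa using hp),
    fun g hg => huniq _ _ hg (by simp [one_mem])⟩

/-- The extension of `λ` to a smooth homomorphism `P → ℝ_{>0}` that is trivial on `P₊`; its
derivative at `1` is still `B(E_λ, ·)`. -/
theorem exists_extend_scale (lam : ScaleRepresentation (m := m) P gr) :
    ∃ χ : P →* ℝ, ContMDiff (𝓡 m) 𝓘(ℝ, ℝ) ∞ χ ∧ (∀ p, 0 < χ p) ∧ (∀ p ∈ PPlus P gr, χ p = 1) ∧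
      (∀ g : GZero P gr, χ g = lam.toHom g) ∧
      ∀ X : GroupLieAlgebra (𝓡 m) P, (mfderiv (𝓡 m) 𝓘(ℝ, ℝ) χ 1 : Model m →L[ℝ] ℝ) X
        = killingForm ℝ (GroupLieAlgebra (𝓡 n) G) lam.E (lieIncl n m P X) := by
  obtain ⟨a, ha, haG, haP, ha1, hag⟩ := hP.exists_levi_projection hε
  let χ : P →* ℝ := lam.toHom.comp (a.codRestrict _ haG)
  have hχ : ∀ p, χ p = lam.toHom ⟨a p, haG p⟩ := fun p => rfl
  have hsm : ContMDiff (𝓡 m) 𝓘(ℝ, ℝ) ∞ χ := fun p => by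
    obtain ⟨f, hf, hfe⟩ := lam.smooth ⟨a p, haG p⟩
    refine (ContMDiffAt.comp (g := f) p hf (ha p)).congr_of_eventuallyEq ?_
    filter_upwards [(ha p).continuousAt.eventually hfe] with p' hp'
    exact (hp' (haG p')).symm
  have hPl : ∀ p ∈ PPlus P gr, χ p = 1 := fun p hp => by
    rw [hχ]; simp only [ha1 p hp]; exact map_one _
  have hG0 : ∀ g : GZero P gr, χ g = lam.toHom g := fun g => by
    rw [hχ]; congr 1; exact Subtype.ext (hag g g.2)
  obtain ⟨D, hD⟩ : ∃ D : Model m →L[ℝ] ℝ,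
      D = (mfderiv (𝓡 m) 𝓘(ℝ, ℝ) χ 1 : Model m →L[ℝ] ℝ) := ⟨_, rfl⟩
  have hcurve : ∀ {γ : ℝ → P} {X : GroupLieAlgebra (𝓡 m) P}, IsOneParameterGroup m γ X →
      HasDerivAt (fun t => χ (γ t)) (D X) 0 := by
    intro γ X hγ
    have h1 : HasMFDerivAt (𝓡 m) 𝓘(ℝ, ℝ) χ (γ 0) (mfderiv (𝓡 m) 𝓘(ℝ, ℝ) χ (γ 0)) :=
      (hsm.mdifferentiable (by simp) _).hasMFDerivAt
    have h2 := (h1.comp (0 : ℝ) (hγ.contMDiff.mdifferentiable (by simp) 0).hasMFDerivAt)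
    have h3 : HasFDerivAt (𝕜 := ℝ) (E := ℝ) (F := ℝ) (fun t => χ (γ t)) _ 0 :=
      hasMFDerivAt_iff_hasFDerivAt.1 h2
    refine h3.hasDerivAt.congr_deriv ?_
    change (mfderiv (𝓡 m) 𝓘(ℝ, ℝ) χ (γ 0) : Model m →L[ℝ] ℝ)
      ((mfderiv 𝓘(ℝ, ℝ) (𝓡 m) γ 0 : ℝ →L[ℝ] Model m) 1) = _
    have e : ∀ p : P, p = 1 → (mfderiv (𝓡 m) 𝓘(ℝ, ℝ) χ p : Model m →L[ℝ] ℝ)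
        = (mfderiv (𝓡 m) 𝓘(ℝ, ℝ) χ 1 : Model m →L[ℝ] ℝ) := by rintro _ rfl; rfl
    rw [e _ hγ.map_zero, ← hD]
    exact congrArg D hγ.velocity
  have hZ : ∀ X : GroupLieAlgebra (𝓡 m) P, lieIncl n m P X ∈ gr.filt 1 →
      D X = killingForm ℝ (GroupLieAlgebra (𝓡 n) G) lam.E (lieIncl n m P X) := fun X hX => by
    have := hP.isKilling
    obtain ⟨γ, hγ⟩ := ParabolicGeometry.exists_isOneParameterGroup X
    have h1 := hcurve hγ
    have e : (fun t => χ (γ t)) = fun _ => 1 := funext fun t =>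
      hPl _ (mem_PPlus hX (hP.closedSubgroup.isOneParameterGroup_coe hγ) t)
    rw [e] at h1
    rw [h1.unique (hasDerivAt_const 0 1), LieModule.traceForm_comm]
    exact (hε.mem_filt_one_iff.1 hX _ (gr.piece_le_filt le_rfl lam.E_mem)).symm
  have hA : ∀ X : GroupLieAlgebra (𝓡 m) P, lieIncl n m P X ∈ gr.piece 0 →
      D X = killingForm ℝ (GroupLieAlgebra (𝓡 n) G) lam.E (lieIncl n m P X) := fun X hX => by
    obtain ⟨γ, hγ⟩ := ParabolicGeometry.exists_isOneParameterGroup X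
    have hγ' := hP.closedSubgroup.isOneParameterGroup_coe hγ
    have hm : ∀ t, γ t ∈ GZero P gr := fun t =>
      (hP.mem_GZero_iff hε).2 (hP.Ad_eq_of_mem_piece hε (hγ'.Ad_mem_piece hX hε.mem_piece_zero t))
    have h1 := hcurve hγ
    have h2 := lam.deriv γ _ hm hγ'
    exact h1.unique (by simpa only [← hG0] using h2)
  refine ⟨χ, hsm, fun p => lam.pos _, hPl, hG0, fun X => ?_⟩
  rw [← hD]
  have hX := hP.lieIncl_mem X
  obtain ⟨X₀, hX₀⟩ := hP.exists_lieIncl_eq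
    (gr.piece_le_filt (le_refl 0) (gr.proj_mem 0 (lieIncl n m P X)))
  have h1 := hA X₀ (by rw [hX₀]; exact gr.proj_mem 0 _)
  have h2 := hZ (X - X₀) (by rw [map_sub, hX₀]; exact gr.sub_proj_zero_mem_filt hX)
  have h3 : D (X - X₀) = D X - D X₀ := _root_.map_sub D (X : Model m) (X₀ : Model m)
  rw [h3, h1, map_sub, map_sub] at h2
  exact sub_left_injective h2

end IsParabolicType
end LeviFactor

/-! ### Differential calculus with respect to the Cartan connection -/

namespace CartanGeometry

section Calculus

variable {n m b d : ℕ} {G : Type*} [TopologicalSpace G]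
  [ChartedSpace (EuclideanSpace ℝ (Fin n)) G] [Group G]
  {P : Subgroup G} [ChartedSpace (EuclideanSpace ℝ (Fin m)) P]
  {B : Type*} [TopologicalSpace B] [ChartedSpace (EuclideanSpace ℝ (Fin b)) B]
  [IsManifold (𝓡 b) ∞ B] [MulAction Pᵐᵒᵖ B]
  {M : Type*} [TopologicalSpace M] [ChartedSpace (EuclideanSpace ℝ (Fin d)) M]
  (C : CartanGeometry n m b d P B M)
  {E : Type*} [NormedAddCommGroup E] [NormedSpace ℝ E]

/-- The Cartan connection at `u`, as an isomorphism of the model space of `B` with that of `G`. -/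
def cartanEquiv (u : B) : Model b ≃L[ℝ] Model n :=
  LinearEquiv.toContinuousLinearEquiv (E := Model b) (F := Model n)
    (LinearEquiv.ofBijective (ContinuousLinearMap.toLinearMap (M := Model b) (M₂ := Model n)
      (C.cartan u)) (C.bijective u))

/-- The derivative of `h : B → E` along the vector fields that `ω` makes constant:
`C.cderiv h u X = dh_u (ω_u⁻¹ X)`. -/
def cderiv (h : B → E) (u : B) : Model n →L[ℝ] E :=
  (mfderiv (𝓡 b) 𝓘(ℝ, E) h u : Model b →L[ℝ] E).comp
    ((C.cartanEquiv u).symm : Model n →L[ℝ] Model b)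

theorem cderiv_cartan (h : B → E) (u : B) (v : Model b) :
    C.cderiv h u (C.cartan u v) = (mfderiv (𝓡 b) 𝓘(ℝ, E) h u : Model b →L[ℝ] E) v :=
  congrArg (mfderiv (𝓡 b) 𝓘(ℝ, E) h u : Model b →L[ℝ] E) ((C.cartanEquiv u).symm_apply_apply v)

/-- The Cartan connection in the chart at `u₀`. -/
def chartCartan (u₀ : B) (x : Model b) : Model b →L[ℝ] Model n :=
  (C.cartan ((extChartAt (𝓡 b) u₀).symm x) : Model b →L[ℝ] Model n).comp
    (mfderiv (𝓡 b) (𝓡 b) (extChartAt (𝓡 b) u₀).symm x : Model b →L[ℝ] Model b)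

theorem contDiffOn_chartCartan (u₀ : B) :
    ContDiffOn ℝ ∞ (C.chartCartan u₀) (extChartAt (𝓡 b) u₀).target := by
  have ho := isOpen_extChartAt_target (I := 𝓡 b) u₀
  refine contDiffOn_clm_apply.2 fun v x hx => ?_
  have h1 := (contMDiffOn_extChartAt_symm (I := 𝓡 b) (n := ∞) u₀).contMDiffOn_tangentMapWithin
    (m := ∞) (by simp) ho.uniqueMDiffOn
  have h2 : ContMDiff (𝓡 b) (𝓡 b).tangent ∞
      (fun y : Model b => (⟨y, v⟩ : TangentBundle (𝓡 b) (Model b))) := fun y =>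
    contMDiffAt_vectorSpace_iff_contDiffAt.2 contDiffAt_const
  have h3 := C.contMDiff_cartan.comp_contMDiffOn (h1.comp h2.contMDiffOn fun y hy => hy)
  refine (contMDiffOn_iff_contDiffOn.1 h3 x hx).congr (fun y hy => ?_) ?_
  · change _ = C.cartan _ (mfderivWithin (𝓡 b) (𝓡 b) (extChartAt (𝓡 b) u₀).symm _ y v)
    rw [mfderivWithin_of_isOpen ho hy]
    rfl
  · change _ = C.cartan _ (mfderivWithin (𝓡 b) (𝓡 b) (extChartAt (𝓡 b) u₀).symm _ x v)
    rw [mfderivWithin_of_isOpen ho hx]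
    rfl

theorem isInvertible_chartCartan (u₀ : B) {x : Model b} (hx : x ∈ (extChartAt (𝓡 b) u₀).target) :
    (C.chartCartan u₀ x).IsInvertible := by
  have h := isInvertible_mfderivWithin_extChartAt_symm (I := 𝓡 b) hx
  rw [ModelWithCorners.range_eq_univ, mfderivWithin_univ] at h
  exact ContinuousLinearMap.IsInvertible.comp
    (g := (C.cartanEquiv ((extChartAt (𝓡 b) u₀).symm x) : Model b →L[ℝ] Model n))
    (f := (mfderiv (𝓡 b) (𝓡 b) (extChartAt (𝓡 b) u₀).symm x : Model b →L[ℝ] Model b)) ⟨_, rfl⟩ h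

theorem hasMFDerivAt_extChartAt_symm (u₀ : B) {x : Model b}
    (hx : x ∈ (extChartAt (𝓡 b) u₀).target) :
    HasMFDerivAt (𝓡 b) (𝓡 b) (extChartAt (𝓡 b) u₀).symm x
      (mfderiv (𝓡 b) (𝓡 b) (extChartAt (𝓡 b) u₀).symm x) :=
  (((contMDiffOn_extChartAt_symm (I := 𝓡 b) (n := ∞) u₀).contMDiffAt
    ((isOpen_extChartAt_target (I := 𝓡 b) u₀).mem_nhds hx)).mdifferentiableAt
      (by simp)).hasMFDerivAt

/-- The derivative of a function in the chart at `u₀`. -/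
theorem hasFDerivAt_chart (u₀ : B) {x : Model b} (hx : x ∈ (extChartAt (𝓡 b) u₀).target) {h : B → E}
    (hh : MDifferentiableAt (𝓡 b) 𝓘(ℝ, E) h ((extChartAt (𝓡 b) u₀).symm x)) :
    HasFDerivAt (fun x => h ((extChartAt (𝓡 b) u₀).symm x))
      ((C.cderiv h ((extChartAt (𝓡 b) u₀).symm x)).comp (C.chartCartan u₀ x)) x := by
  have h1 : HasFDerivAt (𝕜 := ℝ) (E := Model b) (F := E)
      (fun x => h ((extChartAt (𝓡 b) u₀).symm x)) _ x :=
    hasMFDerivAt_iff_hasFDerivAt.1 (hh.hasMFDerivAt.comp x (hasMFDerivAt_extChartAt_symm u₀ hx))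
  refine h1.congr_fderiv ?_
  ext1 v
  exact (C.cderiv_cartan h _ _).symm

theorem contMDiff_iff_chart {k : WithTop ℕ∞} (hk : k ≤ ∞) {h : B → E} :
    ContMDiff (𝓡 b) 𝓘(ℝ, E) k h ↔ ∀ u₀ : B, ContDiffOn ℝ k
      (fun x => h ((extChartAt (𝓡 b) u₀).symm x)) (extChartAt (𝓡 b) u₀).target := by
  have : IsManifold (𝓡 b) k B := IsManifold.of_le hk
  constructor
  · intro hh u₀
    exact contMDiffOn_iff_contDiffOn.1 (hh.comp_contMDiffOn
      ((contMDiffOn_extChartAt_symm (I := 𝓡 b) (n := ∞) u₀).of_le hk))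
  · intro hh u₀
    have h1 : ContMDiffAt (𝓡 b) 𝓘(ℝ, E) k (fun x => h ((extChartAt (𝓡 b) u₀).symm x))
        (extChartAt (𝓡 b) u₀ u₀) :=
      ((hh u₀).contDiffAt ((isOpen_extChartAt_target (I := 𝓡 b) u₀).mem_nhds
        (mem_extChartAt_target u₀))).contMDiffAt
    have h2 := h1.comp u₀ (contMDiffAt_extChartAt (I := 𝓡 b) (n := k) (x := u₀))
    refine h2.congr_of_eventuallyEq ?_
    filter_upwards [extChartAt_source_mem_nhds (I := 𝓡 b) u₀] with u hu
    simp only [Function.comp_apply, (extChartAt (𝓡 b) u₀).left_inv hu]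

theorem contMDiff_cderiv {h : B → E} (hh : ContMDiff (𝓡 b) 𝓘(ℝ, E) ∞ h) :
    ContMDiff (𝓡 b) 𝓘(ℝ, Model n →L[ℝ] E) ∞ (C.cderiv h) := by
  rw [contMDiff_iff_chart le_rfl] at hh ⊢
  have hh' := (contMDiff_iff_chart (B := B) (b := b) (E := E) (h := h) le_rfl).2 hh
  intro u₀
  have ho := isOpen_extChartAt_target (I := 𝓡 b) u₀
  have h1 : ContDiffOn ℝ ∞ (fderiv ℝ (fun x => h ((extChartAt (𝓡 b) u₀).symm x)))
      (extChartAt (𝓡 b) u₀).target := (hh u₀).fderiv_of_isOpen ho (by simp)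
  have h2 : ContDiffOn ℝ ∞ (fun x => (C.chartCartan u₀ x).inverse)
      (extChartAt (𝓡 b) u₀).target := by
    intro x hx
    obtain ⟨e, he⟩ := C.isInvertible_chartCartan u₀ hx
    have h3 : ContDiffAt ℝ ∞ ContinuousLinearMap.inverse (C.chartCartan u₀ x) := by
      rw [← he]; exact contDiffAt_map_inverse e
    exact h3.comp_contDiffWithinAt x (C.contDiffOn_chartCartan u₀ x hx)
  refine (h1.clm_comp h2).congr fun x hx => ?_
  rw [(C.hasFDerivAt_chart u₀ hx (hh'.mdifferentiable (by simp) _)).fderiv]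
  obtain ⟨e, he⟩ := C.isInvertible_chartCartan u₀ hx
  rw [← he, ContinuousLinearMap.inverse_equiv]
  ext1 v
  simp

/-- A function whose derivative along the constant vector fields is `C^k` is `C^(k+1)`. -/
theorem contMDiff_succ_of_cderiv {k : ℕ} {F : B → E} {D : B → Model n →L[ℝ] E}
    (hD : ContMDiff (𝓡 b) 𝓘(ℝ, Model n →L[ℝ] E) k D)
    (hF : ∀ u₀ : B, ∀ x ∈ (extChartAt (𝓡 b) u₀).target,
      HasFDerivAt (fun x => F ((extChartAt (𝓡 b) u₀).symm x))
        ((D ((extChartAt (𝓡 b) u₀).symm x)).comp (C.chartCartan u₀ x)) x) :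
    ContMDiff (𝓡 b) 𝓘(ℝ, E) (k + 1 : ℕ) F := by
  rw [contMDiff_iff_chart (by exact_mod_cast le_top)] at hD ⊢
  intro u₀
  have ho := isOpen_extChartAt_target (I := 𝓡 b) u₀
  have e : ((k + 1 : ℕ) : WithTop ℕ∞) = (k : WithTop ℕ∞) + 1 := by push_cast; rfl
  rw [e, contDiffOn_succ_iff_fderiv_of_isOpen ho]
  refine ⟨fun x hx => (hF u₀ x hx).differentiableAt.differentiableWithinAt, by simp, ?_⟩
  have h1 := (hD u₀).clm_comp ((C.contDiffOn_chartCartan u₀).of_le (by exact_mod_cast le_top))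
  exact h1.congr fun x hx => (hF u₀ x hx).fderiv

theorem cderiv_comp_aut (Φ : C.Aut) {h : B → E} (hh : ContMDiff (𝓡 b) 𝓘(ℝ, E) ∞ h) (u : B) :
    C.cderiv (fun u => h (Φ.1 u)) u = C.cderiv h (Φ.1 u) := by
  have h1 := (hh.mdifferentiable (by simp) (Φ.1 u)).hasMFDerivAt.comp u
    (Φ.2.1.mdifferentiable (by simp) u).hasMFDerivAt
  have h2 : mfderiv (𝓡 b) 𝓘(ℝ, E) (fun u => h (Φ.1 u)) u = _ := h1.mfderiv
  ext1 X
  obtain ⟨v, rfl⟩ := (C.bijective u).2 X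
  refine (C.cderiv_cartan _ u v).trans ?_
  rw [h2]
  have h3 := C.cderiv_cartan h (Φ.1 u) (mfderiv (𝓡 b) (𝓡 b) Φ.1 u v)
  rw [Φ.2.2.2.2 u v] at h3
  exact h3.symm

include C in
theorem contMDiff_act_left [LieGroup (𝓡 m) ∞ P] (p : P) :
    ContMDiff (𝓡 b) (𝓡 b) ∞ (fun u : B => u <• p) :=
  C.contMDiff_act.comp (contMDiff_id.prodMk contMDiff_const)

include C in
theorem contMDiff_act_right (u : B) :
    ContMDiff (𝓡 m) (𝓡 b) ∞ (fun p : P => u <• p) :=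
  C.contMDiff_act.comp (contMDiff_const.prodMk contMDiff_id)

theorem cderiv_comp_act [LieGroup (𝓡 m) ∞ P] (p : P) {h : B → E}
    (hh : ContMDiff (𝓡 b) 𝓘(ℝ, E) ∞ h) (u : B) :
    C.cderiv (fun u => h (u <• p)) u = (C.cderiv h (u <• p)).comp (adModel n (p : G)⁻¹) := by
  have h1 := (hh.mdifferentiable (by simp) (u <• p)).hasMFDerivAt.comp u
    ((C.contMDiff_act_left p).mdifferentiable (by simp) u).hasMFDerivAt
  have h2 : mfderiv (𝓡 b) 𝓘(ℝ, E) (fun u => h (u <• p)) u = _ := h1.mfderiv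
  ext1 X
  obtain ⟨v, rfl⟩ := (C.bijective u).2 X
  refine (C.cderiv_cartan _ u v).trans ?_
  rw [h2]
  have h3 := C.cderiv_cartan h (u <• p) (mfderiv (𝓡 b) (𝓡 b) (fun u : B => u <• p) u v)
  rw [C.equivariant p u v] at h3
  exact h3.symm

theorem cderiv_lieIncl {h : B → E} (hh : ContMDiff (𝓡 b) 𝓘(ℝ, E) ∞ h) (u : B)
    (X : GroupLieAlgebra (𝓡 m) P) :
    C.cderiv h u (lieIncl n m P X)
      = (mfderiv (𝓡 m) 𝓘(ℝ, E) (fun p : P => h (u <• p)) 1 : Model m →L[ℝ] E) X := by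
  have h0 : HasMFDerivAt (𝓡 b) 𝓘(ℝ, E) h (u <• (1 : P)) (mfderiv (𝓡 b) 𝓘(ℝ, E) h u) := by
    rw [MulOpposite.op_one, one_smul]
    exact (hh.mdifferentiable (by simp) u).hasMFDerivAt
  have h1 := h0.comp (1 : P) ((C.contMDiff_act_right u).mdifferentiable (by simp) 1).hasMFDerivAt
  have h2 : mfderiv (𝓡 m) 𝓘(ℝ, E) (fun p : P => h (u <• p)) 1 = _ := h1.mfderiv
  rw [h2, ← C.fundamental u X]
  exact C.cderiv_cartan h u _

end Calculus
end CartanGeometry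

/-! ### Scale functions and their logarithmic derivatives -/

section KillingDual

variable {n : ℕ} {G : Type*} [TopologicalSpace G]
  [ChartedSpace (EuclideanSpace ℝ (Fin n)) G] [Group G] [LieGroup (𝓡 n) ∞ G]

theorem eq_of_killingForm_eq [LieAlgebra.IsKilling ℝ (GroupLieAlgebra (𝓡 n) G)]
    {X Y : GroupLieAlgebra (𝓡 n) G}
    (h : ∀ Z, killingForm ℝ (GroupLieAlgebra (𝓡 n) G) X Z
      = killingForm ℝ (GroupLieAlgebra (𝓡 n) G) Y Z) : X = Y := by
  refine sub_eq_zero.1 ((LieAlgebra.IsKilling.killingForm_nondegenerate ℝ _).1 _ fun Z => ?_)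
  rw [map_sub, LinearMap.sub_apply, h, sub_self]

/-- The identification of the dual of a semisimple Lie algebra with the Lie algebra. -/
theorem exists_killing_dual [LieAlgebra.IsKilling ℝ (GroupLieAlgebra (𝓡 n) G)] :
    ∃ K : (Model n →L[ℝ] ℝ) →L[ℝ] Model n, ∀ (D : Model n →L[ℝ] ℝ) (X : GroupLieAlgebra (𝓡 n) G),
      killingForm ℝ (GroupLieAlgebra (𝓡 n) G) (K D) X = D X := by
  let T := LinearMap.BilinForm.toDual (killingForm ℝ (GroupLieAlgebra (𝓡 n) G))
    (LieAlgebra.IsKilling.killingForm_nondegenerate ℝ _)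
  let K₀ : (Model n →L[ℝ] ℝ) →ₗ[ℝ] Model n :=
    { toFun := fun D => T.symm (D.toLinearMap : Model n →ₗ[ℝ] ℝ)
      map_add' := fun D D' => map_add T.symm _ _
      map_smul' := fun c D => map_smul T.symm _ _ }
  refine ⟨LinearMap.toContinuousLinearMap K₀, fun D X => ?_⟩
  exact LinearMap.BilinForm.apply_toDual_symm_apply (hB :=
    LieAlgebra.IsKilling.killingForm_nondegenerate ℝ (GroupLieAlgebra (𝓡 n) G)) _ _

end KillingDual

namespace CartanGeometry

section Weyl

variable {n m b d : ℕ} {G : Type*} [TopologicalSpace G] [T2Space G]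
  [ChartedSpace (EuclideanSpace ℝ (Fin n)) G] [Group G] [LieGroup (𝓡 n) ∞ G]
  {P : Subgroup G} [ChartedSpace (EuclideanSpace ℝ (Fin m)) P] [LieGroup (𝓡 m) ∞ P]
  {gr : KGrading (GroupLieAlgebra (𝓡 n) G)}
  {B : Type*} [TopologicalSpace B] [ChartedSpace (EuclideanSpace ℝ (Fin b)) B]
  [IsManifold (𝓡 b) ∞ B] [MulAction Pᵐᵒᵖ B]
  {M : Type*} [TopologicalSpace M] [ChartedSpace (EuclideanSpace ℝ (Fin d)) M]
  (C : CartanGeometry n m b d P B M)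

omit [TopologicalSpace G] [T2Space G] [ChartedSpace (EuclideanSpace ℝ (Fin n)) G]
  [LieGroup (𝓡 n) ∞ G] [ChartedSpace (EuclideanSpace ℝ (Fin m)) P] [LieGroup (𝓡 m) ∞ P]
  [TopologicalSpace B] [ChartedSpace (EuclideanSpace ℝ (Fin b)) B] [IsManifold (𝓡 b) ∞ B] in
theorem act_act (u : B) (p q : P) : (u <• p) <• q = u <• (p * q) := by
  rw [MulOpposite.op_mul, mul_smul]

omit [T2Space G] [LieGroup (𝓡 m) ∞ P] in
theorem toBZero_act (u : B) {h : P} (hh : h ∈ PPlus P gr) :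
    C.toBZero gr (u <• h) = C.toBZero gr u :=
  Quotient.sound ⟨⟨MulOpposite.op h, hh⟩, rfl⟩

omit [T2Space G] [LieGroup (𝓡 m) ∞ P] in
theorem scaleMk_act (lam : ScaleRepresentation (m := m) P gr) (u : B) (g : GZero P gr)
    (r : {r : ℝ // 0 < r}) : C.scaleMk lam (u <• (g : P)) r
      = C.scaleMk lam u ⟨lam.toHom g * r.1, mul_pos (lam.pos g) r.2⟩ :=
  Quot.sound ⟨u, g, r, rfl, rfl⟩

omit [T2Space G] [LieGroup (𝓡 n) ∞ G] [LieGroup (𝓡 m) ∞ P] in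
theorem cderiv_const_mul (c : ℝ) {f : B → ℝ} (hf : ContMDiff (𝓡 b) 𝓘(ℝ, ℝ) ∞ f) (u : B) :
    C.cderiv (fun u => c * f u) u = c • C.cderiv f u := by
  have h1 := const_smul_mfderiv (hf.mdifferentiable (by simp) u) c
  ext1 X
  obtain ⟨v, rfl⟩ := (C.bijective u).2 X
  refine (C.cderiv_cartan _ u v).trans ?_
  have h2 : (mfderiv (𝓡 b) 𝓘(ℝ, ℝ) (fun u => c * f u) u : Model b →L[ℝ] ℝ)
    = c • (mfderiv (𝓡 b) 𝓘(ℝ, ℝ) f u : Model b →L[ℝ] ℝ) := h1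
  rw [h2]
  exact congrArg (fun t : ℝ => c * t) (C.cderiv_cartan f u v).symm

/-- A smooth positive function on `B` that transforms under `P` by the inverse of the character `χ`
extending a scale representation. It amounts to a global scale. -/
structure IsScaleFunction (χ : P → ℝ) (f : B → ℝ) : Prop where
  contMDiff : ContMDiff (𝓡 b) 𝓘(ℝ, ℝ) ∞ f
  pos : ∀ u, 0 < f u
  act : ∀ (u : B) (p : P), f (u <• p) = (χ p)⁻¹ * f u

variable {χ : P →* ℝ} {f : B → ℝ} {lam : ScaleRepresentation (m := m) P gr}
  {ε : GroupLieAlgebra (𝓡 n) G}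

/-- The negative of the logarithmic derivative of a scale function, read as an element of the Lie
algebra by the Cartan connection and the Killing form, is a smooth equivariant map into the affine
space `E_λ + p₊`. -/
theorem exists_log_derivative (hP : IsParabolicType (m := m) P gr) (hε : gr.IsGradingElement ε)
    (hχ : ContMDiff (𝓡 m) 𝓘(ℝ, ℝ) ∞ χ) (hχ0 : ∀ p, 0 < χ p)
    (hχ' : ∀ X : GroupLieAlgebra (𝓡 m) P, (mfderiv (𝓡 m) 𝓘(ℝ, ℝ) χ 1 : Model m →L[ℝ] ℝ) X
        = killingForm ℝ (GroupLieAlgebra (𝓡 n) G) lam.E (lieIncl n m P X))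
    (hf : IsScaleFunction (b := b) χ f) :
    ∃ F : B → GroupLieAlgebra (𝓡 n) G, ContMDiff (M' := Model n) (𝓡 b) (𝓡 n) ∞ F ∧
      (∀ (u : B) (X : GroupLieAlgebra (𝓡 n) G),
        killingForm ℝ (GroupLieAlgebra (𝓡 n) G) (F u) X = -((f u)⁻¹ * C.cderiv f u X)) ∧
      (∀ u, F u - lam.E ∈ gr.filt 1) ∧
      (∀ (u : B) (p : P), F (u <• p) = Ad n (p : G)⁻¹ (F u)) ∧
      ∀ Φ : C.Aut, (∀ u, f (Φ.1 u) = f u) → ∀ u, F (Φ.1 u) = F u := by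
  have := hP.isKilling
  obtain ⟨K, hK⟩ := exists_killing_dual (n := n) (G := G)
  obtain ⟨F, hF0⟩ : ∃ F : B → GroupLieAlgebra (𝓡 n) G, ∀ u, F u = K (-(f u)⁻¹ • C.cderiv f u) :=
    ⟨fun u => K (-(f u)⁻¹ • C.cderiv f u), fun u => rfl⟩
  have hF : ∀ (u : B) (X : GroupLieAlgebra (𝓡 n) G),
      killingForm ℝ (GroupLieAlgebra (𝓡 n) G) (F u) X = -((f u)⁻¹ * C.cderiv f u X) := fun u X => by
    rw [hF0]
    exact (hK _ _).trans (neg_mul _ _)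
  refine ⟨F, ?_, hF, fun u => ?_, fun u p => ?_, fun Φ hΦ u => ?_⟩
  · have h1 : ContMDiff (𝓡 b) 𝓘(ℝ, ℝ) ∞ (fun u => -(f u)⁻¹) :=
      (hf.contMDiff.inv₀ fun u => (hf.pos u).ne').neg
    rw [funext hF0]
    exact K.contMDiff.comp (h1.smul (C.contMDiff_cderiv hf.contMDiff))
  · rw [hε.mem_filt_one_iff]
    intro Y hY
    obtain ⟨X, rfl⟩ := hP.exists_lieIncl_eq hY
    rw [map_sub, LinearMap.sub_apply, sub_eq_zero, hF, C.cderiv_lieIncl hf.contMDiff, ← hχ']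
    have hχ1 : HasMFDerivAt (𝓡 m) 𝓘(ℝ, ℝ) χ 1 (mfderiv (𝓡 m) 𝓘(ℝ, ℝ) χ 1) :=
      (hχ.mdifferentiable (by simp) 1).hasMFDerivAt
    have h1 : HasDerivAt (fun x : ℝ => x⁻¹ * f u) (-f u) (χ 1) :=
      ((hasDerivAt_inv (x := χ 1) (hχ0 1).ne').mul_const (f u)).congr_deriv (by
        rw [map_one]; simp)
    have h3 : HasMFDerivAt (𝓡 m) 𝓘(ℝ, ℝ) (fun p => (χ p)⁻¹ * f u) 1 _ :=
      h1.hasFDerivAt.hasMFDerivAt.comp (1 : P) hχ1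
    have e : (fun p : P => f (u <• p)) = fun p => (χ p)⁻¹ * f u := funext fun p => hf.act u p
    rw [e, h3.mfderiv]
    obtain ⟨D, hD⟩ : ∃ D : Model m →L[ℝ] ℝ, D = mfderiv (𝓡 m) 𝓘(ℝ, ℝ) χ 1 := ⟨_, rfl⟩
    rw [← hD]
    change -((f u)⁻¹ * (D X * -f u)) = D X
    have := (hf.pos u).ne'
    field_simp
  · refine eq_of_killingForm_eq (n := n) (G := G) fun Z => ?_
    have e1 := LieAlgebra.killingForm_of_equiv_apply (adEquiv n (p : G)⁻¹)
      (F u) (Ad n (p : G) Z)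
    rw [adEquiv_apply, adEquiv_apply, Ad_inv_Ad] at e1
    refine Eq.trans ?_ e1.symm
    rw [hF, hF]
    have h1 := C.cderiv_comp_act p hf.contMDiff u
    have e : (fun u : B => f (u <• p)) = fun u => (χ p)⁻¹ * f u := funext fun u => hf.act u p
    rw [e, C.cderiv_const_mul _ hf.contMDiff] at h1
    have h2 : (χ p)⁻¹ * C.cderiv f u (Ad n (p : G) Z)
        = C.cderiv f (u <• p) (Ad n (p : G)⁻¹ (Ad n (p : G) Z)) :=
      congrArg (fun T : Model n →L[ℝ] ℝ => T (Ad n (p : G) Z)) h1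
    rw [Ad_inv_Ad] at h2
    rw [← h2, hf.act]
    have := (hf.pos u).ne'
    have := (hχ0 p).ne'
    field_simp
  · have h1 := C.cderiv_comp_aut Φ hf.contMDiff u
    have e : (fun u : B => f (Φ.1 u)) = f := funext hΦ
    rw [e] at h1
    rw [hF0, hF0, hΦ, ← h1]

end Weyl
end CartanGeometry

/-! ### Exact Weyl structures from scale functions -/

namespace CartanGeometry

section Weyl

variable {n m b d : ℕ} {G : Type*} [TopologicalSpace G] [T2Space G]
  [ChartedSpace (EuclideanSpace ℝ (Fin n)) G] [Group G] [LieGroup (𝓡 n) ∞ G]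
  {P : Subgroup G} [ChartedSpace (EuclideanSpace ℝ (Fin m)) P] [LieGroup (𝓡 m) ∞ P]
  {gr : KGrading (GroupLieAlgebra (𝓡 n) G)}
  {B : Type*} [TopologicalSpace B] [ChartedSpace (EuclideanSpace ℝ (Fin b)) B]
  [IsManifold (𝓡 b) ∞ B] [MulAction Pᵐᵒᵖ B]
  {M : Type*} [TopologicalSpace M] [ChartedSpace (EuclideanSpace ℝ (Fin d)) M]
  (C : CartanGeometry n m b d P B M)
  {χ : P →* ℝ} {f : B → ℝ} {lam : ScaleRepresentation (m := m) P gr}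
  {ε : GroupLieAlgebra (𝓡 n) G}

include C in
/-- An equivariant map into `E + p₊`, `E` a nonzero multiple of the grading element, takes the value
`E` exactly once on each orbit of `P₊`; this selects a Weyl structure. -/
theorem exists_normalization (hP : IsParabolicType (m := m) P gr) (hε : gr.IsGradingElement ε)
    {c : ℝ} (hc : c ≠ 0) {F : B → GroupLieAlgebra (𝓡 n) G}
    (hF : ContMDiff (M' := Model n) (𝓡 b) (𝓡 n) ∞ F) (hF1 : ∀ u, F u - c • ε ∈ gr.filt 1)
    (hF2 : ∀ (u : B) (p : P), F (u <• p) = Ad n (p : G)⁻¹ (F u)) :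
    ∃ Q : B → P, ContMDiff (𝓡 b) (𝓡 b) ∞ (fun u => u <• Q u) ∧ (∀ u, Q u ∈ PPlus P gr) ∧
      (∀ u, F (u <• Q u) = c • ε) ∧ (∀ u, ∀ h ∈ PPlus P gr, F (u <• h) = c • ε → h = Q u) ∧
      ∀ u v, F u = F v → Q u = Q v := by
  obtain ⟨q, hq, hq'⟩ := hP.exists_smooth_retraction hε
  obtain ⟨z, hz⟩ : ∃ z : B → GroupLieAlgebra (𝓡 n) G, ∀ u, z u = c⁻¹ • F u - ε :=
    ⟨_, fun u => rfl⟩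
  have hZ : ∀ u, z u ∈ gr.filt 1 := fun u => by
    have := Submodule.smul_mem _ c⁻¹ (hF1 u)
    rwa [smul_sub, smul_smul, inv_mul_cancel₀ hc, one_smul, ← hz] at this
  have hq1 : ∀ u, Ad n (q (z u) : G) (F u) = c • ε := fun u => by
    have h1 := (hq' _ (hZ u)).2
    rw [hz, add_sub_cancel, ← hz, map_smul, inv_smul_eq_iff₀ hc] at h1
    exact h1
  have hqm := fun u => (hq' _ (hZ u)).1
  let ε' : Model n := ε
  have hQ : ContMDiff (𝓡 b) (𝓡 m) ∞ (fun u => (q (z u))⁻¹) := by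
    have h1 : ContMDiff (M' := Model n) (𝓡 b) (𝓡 n) ∞
        (fun u => ((c⁻¹ • ContinuousLinearMap.id ℝ (Model n)) (F u) - ε' : Model n)) :=
      ((c⁻¹ • ContinuousLinearMap.id ℝ (Model n)).contMDiff.comp hF).sub contMDiff_const
    have h2 : ContMDiff (M' := Model n) (𝓡 b) (𝓡 n) ∞ z := by rw [funext hz]; exact h1
    exact (hq.comp h2).inv
  have hval : ∀ u, F (u <• (q (z u))⁻¹) = c • ε := fun u => by
    rw [hF2, InvMemClass.coe_inv, inv_inv, hq1]
  refine ⟨fun u => (q (z u))⁻¹, C.contMDiff_act.comp (contMDiff_id.prodMk hQ),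
    fun u => inv_mem (hqm u), hval, fun u h hh hFh => ?_, fun u v huv => by
      simp only [hz, huv]⟩
  change h = (q (z u))⁻¹
  have hv := hval u
  have hy := inv_mem (hqm u)
  generalize (q (z u))⁻¹ = y at hv hy ⊢
  have h1 := hF2 (u <• y) (y⁻¹ * h)
  rw [act_act, mul_inv_cancel_left, hFh, hv, map_smul] at h1
  have h2 : Ad n (((y⁻¹ * h)⁻¹ : P) : G) ε = ε := (smul_right_injective _ hc h1).symm
  have h3 := IsParabolicType.eq_one_of_Ad_eq hε (inv_mem (mul_mem (inv_mem hy) hh)) h2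
  rw [inv_eq_one, inv_mul_eq_one] at h3
  exact h3.symm

variable {C}

omit [T2Space G] [LieGroup (𝓡 m) ∞ P] in
/-- The section of the scale bundle given by a scale function. -/
theorem exists_section (hχ0 : ∀ p ∈ PPlus P gr, χ p = 1) (hχ1 : ∀ g : GZero P gr, χ g = lam.toHom g)
    (hdec : ∀ p : P, ∃ g : GZero P gr, p * (g : P)⁻¹ ∈ PPlus P gr)
    (hf : IsScaleFunction (b := b) χ f) :
    ∃ s : M → C.ScaleBundle lam, ∀ u, s (C.π u) = C.scaleMk lam u ⟨f u, hf.pos u⟩ := by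
  refine ⟨fun x => C.scaleMk lam (C.exists_π_eq x).choose
    ⟨f (C.exists_π_eq x).choose, hf.pos _⟩, fun u => ?_⟩
  change C.scaleMk lam (C.exists_π_eq (C.π u)).choose
    ⟨f (C.exists_π_eq (C.π u)).choose, hf.pos _⟩ = _
  obtain ⟨p, hp⟩ := C.exists_act_eq (C.exists_π_eq (C.π u)).choose_spec
  generalize (C.exists_π_eq (C.π u)).choose = v at hp ⊢
  subst hp
  obtain ⟨g, hg⟩ := hdec p
  have e : v <• p = (v <• (p * (g : P)⁻¹)) <• (g : P) := by rw [act_act, inv_mul_cancel_right]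
  have hχp : χ p = lam.toHom g := by
    have := hχ0 _ hg
    rw [map_mul, ← hχ1] at *
    rw [← mul_one (χ p), ← map_one χ, ← inv_mul_cancel (g : P), map_mul, ← mul_assoc, this, one_mul]
  have e2 : C.scaleMk lam (v <• p) ⟨f (v <• p), hf.pos _⟩
      = C.scaleMk lam ((v <• (p * (g : P)⁻¹)) <• (g : P)) ⟨f (v <• p), hf.pos _⟩ :=
    congrArg (fun w => C.scaleMk lam w _) e
  rw [e2]
  have h1 := C.scaleMk_act lam (v <• (p * (g : P)⁻¹)) g ⟨f (v <• p), hf.pos _⟩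
  refine Eq.trans ?_ h1.symm
  have h2 := C.toBZero_act (gr := gr) v hg
  have h3 : ∀ r, C.scaleMk lam (v <• (p * (g : P)⁻¹)) r = C.scaleMk lam v r :=
    fun r => congrArg (fun x => Quot.mk _ (x, r)) h2
  rw [h3]
  congr 1
  refine Subtype.ext ?_
  change f v = lam.toHom g * f (v <• p)
  rw [hf.act, ← mul_assoc, hχp, mul_inv_cancel₀ (lam.pos g).ne', one_mul]

omit [T2Space G] [LieGroup (𝓡 m) ∞ P] in
/-- The fibre coordinate of the scale bundle is determined by its class. -/
theorem scaleMk_injective (hχ0 : ∀ p ∈ PPlus P gr, χ p = 1)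
    (hχ1 : ∀ g : GZero P gr, χ g = lam.toHom g) (hf : IsScaleFunction (b := b) χ f) {u : B}
    {r r' : {r : ℝ // 0 < r}} (h : C.scaleMk lam u r = C.scaleMk lam u r') : r = r' := by
  let F : C.BZero gr → ℝ := Quotient.lift f (by
    rintro _ v ⟨⟨q, hq⟩, rfl⟩
    have h1 := hf.act v q.unop
    rw [hχ0 _ hq, inv_one, one_mul] at h1
    exact h1)
  have hF : ∀ u, F (C.toBZero gr u) = f u := fun u => rfl
  let T : C.ScaleBundle lam → ℝ := Quot.lift (fun x => x.2.1 / F x.1) (by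
    rintro _ _ ⟨u, g, r, rfl, rfl⟩
    simp only [hF]
    rw [hf.act, hχ1]
    have := (lam.pos g).ne'
    have := (hf.pos u).ne'
    field_simp)
  have h1 : r.1 / f u = r'.1 / f u := congrArg T h
  exact Subtype.ext ((div_left_inj' (hf.pos u).ne').1 h1)

variable (C)

/-- A scale function gives rise to an exact Weyl structure; the construction is natural, so that the
automorphisms preserving the function preserve both the Weyl structure and its scale. -/
theorem exists_exactWeylStructure (hP : IsParabolicType (m := m) P gr)
    (hε : gr.IsGradingElement ε) {c : ℝ} (hc : c ≠ 0) (hlam : lam.E = c • ε)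
    (hχ : ContMDiff (𝓡 m) 𝓘(ℝ, ℝ) ∞ χ) (hχ0 : ∀ p ∈ PPlus P gr, χ p = 1)
    (hχ1 : ∀ g : GZero P gr, χ g = lam.toHom g) (hχpos : ∀ p, 0 < χ p)
    (hχ' : ∀ X : GroupLieAlgebra (𝓡 m) P, (mfderiv (𝓡 m) 𝓘(ℝ, ℝ) χ 1 : Model m →L[ℝ] ℝ) X
        = killingForm ℝ (GroupLieAlgebra (𝓡 n) G) lam.E (lieIncl n m P X))
    (hf : IsScaleFunction (b := b) χ f) (hinv : ∀ (Φ : C.Aut) u, f (Φ.1 u) = f u) :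
    ∃ W : C.ExactWeylStructure lam, C.exactAut W = Set.univ ∧ C.weylAut W.weyl = Set.univ := by
  have := hP.isKilling
  obtain ⟨F, hFs, hFk, hF1, hF2, hF3⟩ := C.exists_log_derivative hP hε hχ hχpos hχ' hf
  rw [hlam] at hF1
  obtain ⟨Q, hQs, hQP, hQF, hQu, hQc⟩ := C.exists_normalization hP hε hc hFs hF1 hF2
  have hdec : ∀ p : P, ∃ g : GZero P gr, p * (g : P)⁻¹ ∈ PPlus P gr := fun p => by
    obtain ⟨a, -, ha1, ha2, -⟩ := hP.exists_levi_projection hε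
    exact ⟨⟨a p, ha1 p⟩, by simpa using inv_mem (ha2 p)⟩
  have hQh : ∀ u, ∀ h ∈ PPlus P gr, (u <• h) <• Q (u <• h) = u <• Q u := fun u h hh => by
    rw [act_act]
    congr 2
    exact hQu u _ (mul_mem hh (hQP _)) (by rw [← act_act, hQF])
  have hfQ : ∀ u, f (u <• Q u) = f u := fun u => by
    rw [hf.act, hχ0 _ (hQP u), inv_one, one_mul]
  obtain ⟨s, hs⟩ := exists_section (C := C) (lam := lam) hχ0 hχ1 hdec hf
  let W : C.WeylStructure gr :=
    { σ := Quotient.lift (fun u => u <• Q u) (by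
        rintro _ v ⟨⟨q, hq⟩, rfl⟩
        exact hQh v q.unop hq)
      section_σ := fun x => by
        induction x using Quotient.inductionOn with
        | h u => exact C.toBZero_act u (hQP u)
      equivariant := fun u g hg => by
        change (u <• g) <• Q (u <• g) = (u <• Q u) <• g
        rw [act_act, act_act]
        have h1 : g * Q (u <• g) * g⁻¹ ∈ PPlus P gr := hP.conj_mem_PPlus hε g (hQP _)
        have h2 := hQu u _ h1 (by
          rw [← act_act, ← act_act, hF2, hQF, map_smul, InvMemClass.coe_inv, inv_inv,
            (hP.mem_GZero_iff hε).1 hg])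
        rw [← h2, inv_mul_cancel_right]
      contMDiff := hQs }
  have hW : ∀ u, W.σ (C.toBZero gr u) = u <• Q u := fun u => rfl
  let S : C.GlobalScale lam :=
    { s := s
      section_s := fun x => by
        obtain ⟨u, rfl⟩ := C.exists_π_eq x
        rw [hs]; rfl
      smooth := fun x => by
        obtain ⟨U, τ, κ, hU, hx, hτ, -, hπ, -⟩ := C.locallyTrivial x
        refine ⟨U, τ, fun y => ⟨f (τ y), hf.pos _⟩, hx, hU, hτ, hπ,
          hf.contMDiff.comp_contMDiffOn hτ, fun y hy => ?_⟩
        rw [← hs, hπ y hy] }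
  have hpar : C.IsParallel lam W s := by
    rintro U τ r ⟨hU, hτ, hπ, hr, hsr⟩ x hx v
    have hrf : ∀ y ∈ U, (r y : ℝ) = f (τ y <• Q (τ y)) := fun y hy => by
      rw [hfQ]
      have h1 := hsr y hy
      conv_lhs at h1 => rw [← hπ y hy, hs]
      exact congrArg Subtype.val (scaleMk_injective hχ0 hχ1 hf h1).symm
    have hτ' : ContMDiffOn (𝓡 d) (𝓡 b) ∞ (fun y => τ y <• Q (τ y)) U := hQs.comp_contMDiffOn hτ
    have h1 : HasMFDerivAt (𝓡 d) (𝓡 b) (fun y => τ y <• Q (τ y)) x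
        (mfderiv (𝓡 d) (𝓡 b) (fun y => τ y <• Q (τ y)) x) :=
      ((hτ'.contMDiffAt (hU.mem_nhds hx)).mdifferentiableAt (by simp)).hasMFDerivAt
    have h2 := (hf.contMDiff.mdifferentiable (by simp) (τ x <• Q (τ x))).hasMFDerivAt.comp x h1
    have h3 : HasMFDerivAt (𝓡 d) 𝓘(ℝ, ℝ) (fun y => (r y : ℝ)) x _ :=
      h2.congr_of_eventuallyEq (Filter.eventuallyEq_of_mem (hU.mem_nhds hx) hrf)
    have h4 := C.cderiv_cartan f (τ x <• Q (τ x))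
      (mfderiv (𝓡 d) (𝓡 b) (fun y => τ y <• Q (τ y)) x v)
    have h5 : realDifferential (fun y => (r y : ℝ)) x v = C.cderiv f (τ x <• Q (τ x))
        (C.cartan (τ x <• Q (τ x)) (mfderiv (𝓡 d) (𝓡 b) (fun y => τ y <• Q (τ y)) x v)) := by
      rw [h4, realDifferential, h3.mfderiv]; rfl
    have h6 := hFk (τ x <• Q (τ x))
      (C.cartan (τ x <• Q (τ x)) (mfderiv (𝓡 d) (𝓡 b) (fun y => τ y <• Q (τ y)) x v))
    rw [hQF, ← hlam, ← h5, ← hrf x hx] at h6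
    change scaleDeriv lam (C.cartan (τ x <• Q (τ x))
      (mfderiv (𝓡 d) (𝓡 b) (fun y => τ y <• Q (τ y)) x v)) + _ = 0
    have h7 : ∀ X, killingForm ℝ (GroupLieAlgebra (𝓡 n) G) lam.E (gr.proj 0 X)
        = killingForm ℝ (GroupLieAlgebra (𝓡 n) G) lam.E X := fun X => by
      induction X using gr.induction_piece with
      | mem i X hX =>
        by_cases hi : i = 0
        · subst hi; rw [gr.proj_self hX]
        · rw [gr.proj_of_ne hX hi, map_zero,
            hε.killingForm_eq_zero (by simpa using hi) lam.E_mem hX]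
      | add X Y hX hY => rw [map_add, map_add, map_add, hX, hY]
    rw [scaleDeriv, h7]
    exact (congrArg (· + _) h6).trans (neg_add_cancel _)
  refine ⟨⟨W, S, hpar⟩, Set.eq_univ_of_forall fun Φ => ?_, Set.eq_univ_of_forall fun Φ => ?_⟩
  · change C.pullScale lam Φ s = s
    funext x
    obtain ⟨u, rfl⟩ := C.exists_π_eq x
    have e : Φ • C.π u = C.π (Φ.1 u) := C.baseMap_π Φ u
    rw [pullScale, e, hs, hs]
    have h1 : C.autScale lam Φ⁻¹ (C.scaleMk lam (Φ.1 u) ⟨f (Φ.1 u), hf.pos _⟩)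
      = C.scaleMk lam (Φ.1.symm (Φ.1 u)) ⟨f (Φ.1 u), hf.pos _⟩ := rfl
    rw [h1]
    simp only [Homeomorph.symm_apply_apply, hinv]
  · change C.pullWeyl gr Φ W.σ = W.σ
    funext x
    induction x using Quotient.inductionOn with
    | h u =>
      change Φ.1.symm (Φ.1 u <• Q (Φ.1 u)) = u <• Q u
      rw [hQc (Φ.1 u) u (hF3 Φ (hinv Φ) u), ← Φ.2.2.2.1, Homeomorph.symm_apply_apply]

end Weyl
end CartanGeometry

/-! ### Averaging over the automorphism group -/

namespace CartanGeometry

section Averaging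

open MeasureTheory Filter Topology

variable {n m b d : ℕ} {G : Type*} [TopologicalSpace G]
  [ChartedSpace (EuclideanSpace ℝ (Fin n)) G] [Group G]
  {P : Subgroup G} [ChartedSpace (EuclideanSpace ℝ (Fin m)) P]
  {B : Type*} [TopologicalSpace B] [ChartedSpace (EuclideanSpace ℝ (Fin b)) B]
  [IsManifold (𝓡 b) ∞ B] [MulAction Pᵐᵒᵖ B]
  {M : Type*} [TopologicalSpace M] [ChartedSpace (EuclideanSpace ℝ (Fin d)) M]
  (C : CartanGeometry n m b d P B M)

theorem continuous_aut_coe_prod :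
    Continuous (fun Φ : C.Aut => ((Φ.1 : C(B, B)), (Φ.1.symm : C(B, B)))) := continuous_induced_dom

theorem continuous_aut_coe : Continuous (fun Φ : C.Aut => (Φ.1 : C(B, B))) :=
  C.continuous_aut_coe_prod.fst

theorem continuous_aut_symm_coe : Continuous (fun Φ : C.Aut => (Φ.1.symm : C(B, B))) :=
  C.continuous_aut_coe_prod.snd

theorem continuous_aut_apply : Continuous (fun x : C.Aut × B => x.1.1 x.2) := by
  have : LocallyCompactSpace B := ChartedSpace.locallyCompactSpace (Model b) B
  exact (C.continuous_aut_coe.comp continuous_fst).eval continuous_snd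

theorem isTopologicalGroup_aut : IsTopologicalGroup C.Aut := by
  have : LocallyCompactSpace B := ChartedSpace.locallyCompactSpace (Model b) B
  refine { continuous_mul := ?_, continuous_inv := ?_ }
  · refine continuous_induced_rng.2 (Continuous.prodMk ?_ ?_)
    · exact ContinuousMap.continuous_comp'.comp
        ((C.continuous_aut_coe.comp continuous_snd).prodMk
          (C.continuous_aut_coe.comp continuous_fst))
    · exact ContinuousMap.continuous_comp'.comp
        ((C.continuous_aut_symm_coe.comp continuous_fst).prodMk
          (C.continuous_aut_symm_coe.comp continuous_snd))
  · exact continuous_induced_rng.2 (C.continuous_aut_symm_coe.prodMk C.continuous_aut_coe)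

/-- The automorphisms that move some point of `K` into `L` form a compact set: this is where
properness of the action enters. -/
theorem isCompact_setOf_smul_mem [ProperSMul C.Aut M] {K L : Set M} (hK : IsCompact K)
    (hL : IsCompact L) : IsCompact {Φ : C.Aut | ∃ x ∈ L, Φ⁻¹ • x ∈ K} := by
  have h := ((ProperSMul.isProperMap_smul_pair (G := C.Aut) (X := M)).isCompact_preimage
    (hL.prod hK)).image continuous_fst
  convert h using 1
  ext Φ
  simp only [Set.mem_ofPred_eq, Set.mem_image, Set.mem_preimage, Set.mem_prod, Prod.exists,
    exists_and_right, exists_eq_right]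
  constructor
  · rintro ⟨x, hx, hxK⟩
    exact ⟨Φ⁻¹ • x, by rwa [smul_inv_smul], hxK⟩
  · rintro ⟨y, hy, hyK⟩
    exact ⟨Φ • y, hy, by rwa [inv_smul_smul]⟩

/-- A group that acts properly on a locally compact space is locally compact; this provides the Haar
measure. -/
theorem locallyCompactSpace_aut [Nonempty M] [ProperSMul C.Aut M] : LocallyCompactSpace C.Aut := by
  have := C.isTopologicalGroup_aut
  have : LocallyCompactSpace M := ChartedSpace.locallyCompactSpace (EuclideanSpace ℝ (Fin d)) M
  obtain ⟨x⟩ := ‹Nonempty M›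
  obtain ⟨K, hK, hxK⟩ := exists_compact_mem_nhds x
  have hS := C.isCompact_setOf_smul_mem hK (isCompact_singleton (x := x))
  refine hS.locallyCompactSpace_of_mem_nhds_of_group (x := 1) ?_
  have hc : ContinuousAt (fun Φ : C.Aut => Φ⁻¹ • x) 1 := by fun_prop
  have : K ∈ 𝓝 ((1 : C.Aut)⁻¹ • x) := by rwa [inv_one, one_smul]
  filter_upwards [hc.eventually_mem this] with Φ hΦ
  exact ⟨x, rfl, hΦ⟩

variable {E : Type*} [NormedAddCommGroup E] [NormedSpace ℝ E]

/-- The average of `h : B → E` over the automorphisms, for a measure `μ` on the automorphism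
group. -/
def average [MeasurableSpace C.Aut] (μ : Measure C.Aut) (h : B → E) (u : B) : E :=
  ∫ Φ : C.Aut, h ((Φ⁻¹).1 u) ∂μ

variable {C}

theorem π_inv_apply (Φ : C.Aut) (u : B) : C.π ((Φ⁻¹).1 u) = Φ⁻¹ • C.π u := (C.baseMap_π Φ⁻¹ u).symm

theorem continuous_inv_apply (u : B) : Continuous fun Φ : C.Aut => (Φ⁻¹).1 u := by
  have := C.isTopologicalGroup_aut
  exact C.continuous_aut_apply.comp (continuous_inv.prodMk continuous_const)

omit [NormedSpace ℝ E] in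
theorem hasCompactSupport_inv_apply [ProperSMul C.Aut M] {K : Set M} (hK : IsCompact K) {h : B → E}
    (hs : ∀ u, C.π u ∉ K → h u = 0) (u : B) :
    HasCompactSupport fun Φ : C.Aut => h ((Φ⁻¹).1 u) := by
  have := C.isTopologicalGroup_aut
  refine HasCompactSupport.intro (C.isCompact_setOf_smul_mem hK (isCompact_singleton (x := C.π u)))
    fun Φ hΦ => hs _ fun hmem => hΦ ⟨C.π u, rfl, ?_⟩
  rwa [← π_inv_apply]

theorem cderiv_eq_zero [T2Space M] {K : Set M} (hK : IsCompact K) {h : B → E}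
    (hs : ∀ u, C.π u ∉ K → h u = 0) (u : B) (hu : C.π u ∉ K) : C.cderiv h u = 0 := by
  have h1 : h =ᶠ[𝓝 u] fun _ => (0 : E) := by
    filter_upwards [(hK.isClosed.isOpen_compl.preimage C.contMDiff_π.continuous).mem_nhds hu]
      with v hv using hs v hv
  have h2 : mfderiv (𝓡 b) 𝓘(ℝ, E) h u = 0 :=
    ((hasMFDerivAt_const (I := 𝓡 b) (0 : E) u).congr_of_eventuallyEq h1).mfderiv
  ext1 X
  change (mfderiv (𝓡 b) 𝓘(ℝ, E) h u : Model b →L[ℝ] E) _ = 0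
  rw [h2]; rfl

variable [MeasurableSpace C.Aut] [BorelSpace C.Aut] (μ : Measure C.Aut)
  [IsFiniteMeasureOnCompacts μ]

omit [NormedSpace ℝ E] in
theorem integrable_inv_apply [ProperSMul C.Aut M] {K : Set M} (hK : IsCompact K) {h : B → E}
    (hc : Continuous h) (hs : ∀ u, C.π u ∉ K → h u = 0) (u : B) :
    Integrable (fun Φ : C.Aut => h ((Φ⁻¹).1 u)) μ :=
  (hc.comp (continuous_inv_apply u)).integrable_of_hasCompactSupport
    (hasCompactSupport_inv_apply hK hs u)

/-- Differentiation under the integral sign: the average of `h` has the average of `dh ∘ ω⁻¹` as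
its derivative, since automorphisms preserve `ω`. -/
theorem hasFDerivAt_average [T2Space M] [ProperSMul C.Aut M] [CompleteSpace E] {K : Set M}
    (hK : IsCompact K) {h : B → E} (hh : ContMDiff (𝓡 b) 𝓘(ℝ, E) ∞ h)
    (hs : ∀ u, C.π u ∉ K → h u = 0) (u₀ : B) {x₀ : Model b}
    (hx₀ : x₀ ∈ (extChartAt (𝓡 b) u₀).target) :
    HasFDerivAt (fun x => C.average μ h ((extChartAt (𝓡 b) u₀).symm x))
      ((C.average μ (C.cderiv h) ((extChartAt (𝓡 b) u₀).symm x₀)).comp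
        (C.chartCartan u₀ x₀)) x₀ := by
  have := C.isTopologicalGroup_aut
  set φ := extChartAt (𝓡 b) u₀ with hφ
  have ho : IsOpen φ.target := isOpen_extChartAt_target (I := 𝓡 b) u₀
  obtain ⟨r, hr, hball⟩ := Metric.nhds_basis_closedBall.mem_iff.1 (ho.mem_nhds hx₀)
  have hcs : ContinuousOn φ.symm φ.target := continuousOn_extChartAt_symm u₀
  have hL : IsCompact ((fun x => C.π (φ.symm x)) '' Metric.closedBall x₀ r) :=
    (isCompact_closedBall x₀ r).image_of_continuousOn
      (C.contMDiff_π.continuous.comp_continuousOn (hcs.mono hball))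
  set S := closure {Φ : C.Aut | ∃ x ∈ (fun x => C.π (φ.symm x)) '' Metric.closedBall x₀ r,
    Φ⁻¹ • x ∈ K} with hS
  have hSc : IsCompact S := (C.isCompact_setOf_smul_mem hK hL).closure
  have hD : ContMDiff (𝓡 b) 𝓘(ℝ, Model n →L[ℝ] E) ∞ (C.cderiv h) := C.contMDiff_cderiv hh
  have hDs := cderiv_eq_zero hK hs
  have hout : ∀ Φ ∉ S, ∀ x ∈ Metric.closedBall x₀ r, C.cderiv h ((Φ⁻¹).1 (φ.symm x)) = 0 := by
    intro Φ hΦ x hx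
    refine hDs _ fun hmem => hΦ (subset_closure ⟨_, ⟨x, hx, rfl⟩, ?_⟩)
    rwa [← π_inv_apply]
  set F' : Model b → C.Aut → (Model b →L[ℝ] E) := fun x Φ =>
    (C.cderiv h ((Φ⁻¹).1 (φ.symm x))).comp (C.chartCartan u₀ x) with hF'
  obtain ⟨c, hc⟩ := ((isCompact_closedBall x₀ r).prod hSc).exists_bound_of_continuousOn
    (f := fun z : Model b × C.Aut => F' z.1 z.2) (by
      have h1 : ContinuousOn (fun z : Model b × C.Aut => C.cderiv h ((z.2⁻¹).1 (φ.symm z.1)))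
          (Metric.closedBall x₀ r ×ˢ S) := by
        refine hD.continuous.comp_continuousOn (C.continuous_aut_apply.comp_continuousOn
          (f := fun z : Model b × C.Aut => (z.2⁻¹, φ.symm z.1)) ?_)
        exact (continuous_inv.comp continuous_snd).continuousOn.prodMk
          (hcs.comp continuousOn_fst fun z hz => hball hz.1)
      exact h1.clm_comp ((C.contDiffOn_chartCartan u₀).continuousOn.comp continuousOn_fst
        fun z hz => hball hz.1))
  have key := hasFDerivAt_integral_of_dominated_of_fderiv_le (μ := μ) (𝕜 := ℝ)
    (F := fun x (Φ : C.Aut) => h ((Φ⁻¹).1 (φ.symm x))) (F' := F') (x₀ := x₀)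
    (bound := S.indicator fun _ => c) (s := Metric.closedBall x₀ r)
    (Metric.closedBall_mem_nhds x₀ hr)
    (Eventually.of_forall fun x =>
      (integrable_inv_apply μ hK hh.continuous hs (φ.symm x)).aestronglyMeasurable)
    (integrable_inv_apply μ hK hh.continuous hs (φ.symm x₀))
    (((ContinuousLinearMap.compL ℝ (Model b) (Model n) E).flip
      (C.chartCartan u₀ x₀)).integrable_comp
        (integrable_inv_apply μ hK hD.continuous hDs (φ.symm x₀))).aestronglyMeasurable
    (Eventually.of_forall fun Φ x hx => by
      by_cases hΦ : Φ ∈ S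
      · rw [Set.indicator_of_mem hΦ]
        exact hc (x, Φ) ⟨hx, hΦ⟩
      · rw [Set.indicator_of_notMem hΦ, hF']
        simp only [hout Φ hΦ x hx, ContinuousLinearMap.zero_comp, norm_zero, le_refl])
    ((integrable_indicator_iff isClosed_closure.measurableSet).2
      (integrableOn_const hSc.measure_lt_top.ne))
    (Eventually.of_forall fun Φ x hx => by
      have h1 := C.hasFDerivAt_chart u₀ (hball hx)
        ((hh.comp (Φ⁻¹).2.1).mdifferentiable (by simp) _)
      have h2 := C.cderiv_comp_aut Φ⁻¹ hh (φ.symm x)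
      have h3 : C.cderiv (h ∘ (Φ⁻¹).1) (φ.symm x) = C.cderiv h ((Φ⁻¹).1 (φ.symm x)) := h2
      rw [h3] at h1
      exact h1)
  refine key.congr_fderiv ?_
  exact ContinuousLinearMap.integral_comp_comm
    ((ContinuousLinearMap.compL ℝ (Model b) (Model n) E).flip (C.chartCartan u₀ x₀))
    (integrable_inv_apply μ hK hD.continuous hDs (φ.symm x₀))

/-- By induction on `k`, for all target spaces at once: the derivative of an average is an average
of a function with values in a space of linear maps. -/
theorem contMDiff_average_nat [T2Space M] [ProperSMul C.Aut M] {K : Set M} (hK : IsCompact K)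
    (k : ℕ) : ∀ (E : Type) [NormedAddCommGroup E] [NormedSpace ℝ E] [CompleteSpace E] (h : B → E),
      ContMDiff (𝓡 b) 𝓘(ℝ, E) ∞ h → (∀ u, C.π u ∉ K → h u = 0) →
      ContMDiff (𝓡 b) 𝓘(ℝ, E) k (C.average μ h) := by
  induction k with
  | zero =>
    intro E _ _ _ h hh hs
    rw [contMDiff_iff_chart (by simp)]
    intro u₀
    rw [Nat.cast_zero, contDiffOn_zero]
    exact fun x hx => (hasFDerivAt_average μ hK hh hs u₀ hx).continuousAt.continuousWithinAt
  | succ k ih =>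
    intro E _ _ _ h hh hs
    exact C.contMDiff_succ_of_cderiv
      (ih (Model n →L[ℝ] E) _ (C.contMDiff_cderiv hh) (cderiv_eq_zero hK hs))
      fun u₀ x hx => hasFDerivAt_average μ hK hh hs u₀ hx

theorem contMDiff_average [T2Space M] [ProperSMul C.Aut M] {K : Set M} (hK : IsCompact K)
    {h : B → ℝ} (hh : ContMDiff (𝓡 b) 𝓘(ℝ, ℝ) ∞ h) (hs : ∀ u, C.π u ∉ K → h u = 0) :
    ContMDiff (𝓡 b) 𝓘(ℝ, ℝ) ∞ (C.average μ h) :=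
  contMDiff_infty.2 fun k => contMDiff_average_nat μ hK k ℝ h hh hs

omit [BorelSpace C.Aut] [IsFiniteMeasureOnCompacts μ] in
theorem average_act {p : P} {c : ℝ} {h : B → ℝ} (hp : ∀ u, h (u <• p) = c * h u) (u : B) :
    C.average μ h (u <• p) = c * C.average μ h u := by
  simp only [average]
  rw [← integral_const_mul]
  refine integral_congr_ae (Eventually.of_forall fun Φ => ?_)
  simp only
  rw [(Φ⁻¹).2.2.2.1, hp]

omit [IsFiniteMeasureOnCompacts μ] in
theorem average_aut [μ.IsMulLeftInvariant] (h : B → E) (Φ : C.Aut) (u : B) :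
    C.average μ h (Φ.1 u) = C.average μ h u := by
  have := C.isTopologicalGroup_aut
  have h1 := integral_mul_left_eq_self (μ := μ) (fun Ψ : C.Aut => h ((Ψ⁻¹).1 u)) Φ⁻¹
  rw [average, average, ← h1]
  refine integral_congr_ae (Eventually.of_forall fun Ψ => ?_)
  simp only
  rw [mul_inv_rev, inv_inv]
  rfl

theorem average_pos_iff [ProperSMul C.Aut M] [μ.IsOpenPosMeasure] {K : Set M} (hK : IsCompact K)
    {h : B → ℝ} (hc : Continuous h) (h0 : ∀ u, 0 ≤ h u) (hs : ∀ u, C.π u ∉ K → h u = 0) (u : B) :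
    0 < C.average μ h u ↔ ∃ Φ : C.Aut, h (Φ.1 u) ≠ 0 := by
  constructor
  · intro hpos
    by_contra! hne
    have h1 : ∀ Φ : C.Aut, h ((Φ⁻¹).1 u) = 0 := fun Φ => hne Φ⁻¹
    have : C.average μ h u = 0 := by simp only [average, h1, integral_zero]
    exact hpos.ne' this
  · rintro ⟨Φ, hΦ⟩
    refine (hc.comp (continuous_inv_apply u)).integral_pos_of_hasCompactSupport_nonneg_nonzero
      (hasCompactSupport_inv_apply hK hs u) (fun Ψ => h0 _) (x := Φ⁻¹) ?_
    simpa using hΦ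

omit [BorelSpace C.Aut] [IsFiniteMeasureOnCompacts μ] in
theorem average_nonneg {h : B → ℝ} (h0 : ∀ u, 0 ≤ h u) (u : B) : 0 ≤ C.average μ h u :=
  integral_nonneg fun _ => h0 _

end Averaging
end CartanGeometry

/-! ### Invariant global scales for proper actions -/

section Gluing

open Filter Topology

variable {b : ℕ} {B : Type*} [TopologicalSpace B] [ChartedSpace (EuclideanSpace ℝ (Fin b)) B]

/-- The `k`-th term of the sum that glues functions `f k`, with weights built from functions `a j`:
it vanishes as soon as `1 ≤ k * a j u` for some `j < k`. -/
def glueTerm (f a : ℕ → B → ℝ) (k : ℕ) (u : B) : ℝ :=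
  f k u * ∏ j ∈ Finset.range k, Real.smoothTransition (1 - k * a j u)

/-- The glued function; the sum is locally finite if the sets `a j > 0` cover. -/
def glue (f a : ℕ → B → ℝ) (u : B) : ℝ := ∑ᶠ k, glueTerm f a k u

variable {f a : ℕ → B → ℝ}

omit [ChartedSpace (EuclideanSpace ℝ (Fin b)) B] in
theorem locallyFinite_glueTerm (ha : ∀ k, Continuous (a k)) (hcov : ∀ u, ∃ k, 0 < a k u) :
    LocallyFinite fun k => Function.support (glueTerm f a k) := by
  intro u
  obtain ⟨j, hj⟩ := hcov u
  refine ⟨{v | a j u / 2 < a j v}, (isOpen_lt continuous_const (ha j)).mem_nhds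
    (show a j u / 2 < a j u by linarith), ?_⟩
  obtain ⟨N, hN⟩ := exists_nat_gt (2 / a j u)
  refine (Set.finite_Iio (max N (j + 1))).subset ?_
  rintro k ⟨v, hv, hv'⟩
  by_contra hk
  simp only [Set.mem_Iio, not_lt, max_le_iff] at hk
  refine hv ?_
  have h1 : (1 : ℝ) ≤ k * a j v := by
    have h2 : (2 / a j u) ≤ k := hN.le.trans (by exact_mod_cast hk.1)
    have h3 : a j u / 2 < a j v := hv'
    calc (1 : ℝ) = 2 / a j u * (a j u / 2) := by field_simp
      _ ≤ k * a j v := mul_le_mul h2 h3.le (by positivity) (by positivity)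
  rw [glueTerm, Finset.prod_eq_zero (i := j) (Finset.mem_range.2 (by omega)), mul_zero]
  exact Real.smoothTransition.zero_of_nonpos (by linarith)

theorem contMDiff_glue (hf : ∀ k, ContMDiff (𝓡 b) 𝓘(ℝ, ℝ) ∞ (f k))
    (ha : ∀ k, ContMDiff (𝓡 b) 𝓘(ℝ, ℝ) ∞ (a k)) (hcov : ∀ u, ∃ k, 0 < a k u) :
    ContMDiff (𝓡 b) 𝓘(ℝ, ℝ) ∞ (glue f a) := by
  refine contMDiff_finsum (fun k => (hf k).mul (contMDiff_finsetProd fun j _ => ?_))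
    (locallyFinite_glueTerm (fun k => (ha k).continuous) hcov)
  have h1 : ContMDiff (𝓡 b) 𝓘(ℝ, ℝ) ∞ (fun u => 1 - k * a j u) :=
    contMDiff_const.sub (contMDiff_const.mul (ha j))
  exact Real.smoothTransition.contDiff.contMDiff.comp h1

omit [ChartedSpace (EuclideanSpace ℝ (Fin b)) B] in
theorem glue_pos (ha : ∀ k, Continuous (a k)) (hcov : ∀ u, ∃ k, 0 < a k u) (hf : ∀ k u, 0 ≤ f k u)
    (hfa : ∀ k u, 0 < a k u → 0 < f k u) (ha0 : ∀ k u, 0 ≤ a k u) (u : B) : 0 < glue f a u := by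
  classical
  refine finsum_pos (fun k => mul_nonneg (hf k u) (Finset.prod_nonneg fun j _ =>
    Real.smoothTransition.nonneg _)) ?_ ((locallyFinite_glueTerm ha hcov).point_finite u)
  -- the first `k` with `a k u > 0` contributes a positive term
  refine ⟨Nat.find (hcov u), mul_pos (hfa _ u (Nat.find_spec (hcov u)))
    (Finset.prod_pos fun j hj => Real.smoothTransition.pos_of_pos ?_)⟩
  have h1 := Nat.find_min (hcov u) (Finset.mem_range.1 hj)
  have h2 : a j u = 0 := le_antisymm (not_lt.1 h1) (ha0 j u)
  rw [h2]; norm_num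

omit [TopologicalSpace B] [ChartedSpace (EuclideanSpace ℝ (Fin b)) B] in
theorem glue_eq_mul {u v : B} {c : ℝ} (hf : ∀ k, f k v = c * f k u) (ha : ∀ k, a k v = a k u) :
    glue f a v = c * glue f a u := by
  rw [glue, glue, ← smul_eq_mul, smul_finsum]
  refine finsum_congr fun k => ?_
  simp only [glueTerm, hf, ha, mul_assoc, smul_eq_mul]

end Gluing

namespace CartanGeometry

section InvariantScale

open MeasureTheory Filter Topology

variable {n m b d : ℕ} {G : Type*} [TopologicalSpace G]
  [ChartedSpace (EuclideanSpace ℝ (Fin n)) G] [Group G]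
  {P : Subgroup G} [ChartedSpace (EuclideanSpace ℝ (Fin m)) P]
  {B : Type*} [TopologicalSpace B] [ChartedSpace (EuclideanSpace ℝ (Fin b)) B]
  [IsManifold (𝓡 b) ∞ B] [MulAction Pᵐᵒᵖ B]
  {M : Type*} [TopologicalSpace M] [T2Space M] [ChartedSpace (EuclideanSpace ℝ (Fin d)) M]
  [IsManifold (𝓡 d) ∞ M]
  (C : CartanGeometry n m b d P B M) {χ : P →* ℝ}

/-- Local functions with the transformation behaviour of a scale function, supported over compact
sets of the base. -/
theorem exists_local_scale (hχ : ContMDiff (𝓡 m) 𝓘(ℝ, ℝ) ∞ χ) (hχ0 : ∀ p, 0 < χ p) (x : M) :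
    ∃ (ρ : M → ℝ) (h : B → ℝ) (K : Set M), IsCompact K ∧ ContMDiff (𝓡 d) 𝓘(ℝ, ℝ) ∞ ρ ∧
      (∀ y, 0 ≤ ρ y) ∧ ρ x ≠ 0 ∧ (∀ y ∉ K, ρ y = 0) ∧ ContMDiff (𝓡 b) 𝓘(ℝ, ℝ) ∞ h ∧
      (∀ u, 0 ≤ h u) ∧ (∀ u, h u ≠ 0 ↔ ρ (C.π u) ≠ 0) ∧
      ∀ (u : B) (p : P), h (u <• p) = (χ p)⁻¹ * h u := by
  obtain ⟨U, τ, κ, hU, hx, -, hκ, hπ, hτκ, hκτ⟩ := C.locallyTrivial x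
  obtain ⟨ρ, -, hρ⟩ := (SmoothBumpFunction.nhds_basis_tsupport (I := 𝓡 d) x).mem_iff.1
    (hU.mem_nhds hx)
  have hρ0 : ∀ y ∉ tsupport ρ, ρ y = 0 := fun y hy => image_eq_zero_of_notMem_tsupport hy
  refine ⟨ρ, fun u => ρ (C.π u) * (χ (κ u))⁻¹, tsupport ρ, ρ.hasCompactSupport, ρ.contMDiff,
    fun y => ρ.nonneg, by rw [ρ.eq_one]; exact one_ne_zero, hρ0, fun u => ?_,
    fun u => mul_nonneg ρ.nonneg (inv_nonneg.2 (hχ0 _).le), fun u => ?_, fun u p => ?_⟩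
  · by_cases hu : C.π u ∈ U
    · have hV : C.π ⁻¹' U ∈ 𝓝 u := (hU.preimage C.contMDiff_π.continuous).mem_nhds hu
      have h1 : ContMDiffAt (𝓡 b) 𝓘(ℝ, ℝ) ∞ (fun u => χ (κ u)) u :=
        (hχ.comp_contMDiffOn hκ).contMDiffAt hV
      exact (ρ.contMDiff.comp C.contMDiff_π).contMDiffAt.mul (h1.inv₀ (hχ0 _).ne')
    · have hV : C.π ⁻¹' (tsupport ρ)ᶜ ∈ 𝓝 u :=
        ((isClosed_tsupport ρ).isOpen_compl.preimage C.contMDiff_π.continuous).mem_nhds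
          fun h => hu (hρ h)
      refine (contMDiffAt_const (c := (0 : ℝ))).congr_of_eventuallyEq ?_
      filter_upwards [hV] with v hv
      rw [hρ0 _ hv, zero_mul]
  · have := (inv_pos.2 (hχ0 (κ u))).ne'
    simp [this]
  · beta_reduce
    by_cases hu : C.π u ∈ U
    · have h1 : κ (u <• p) = κ u * p := by
        conv_lhs => rw [← hτκ u hu]
        rw [act_act]
        exact hκτ _ hu _
      rw [C.π_act, h1, map_mul, mul_inv]
      ring
    · rw [C.π_act, hρ0 _ fun h => hu (hρ h)]
      simp

/-- If the automorphism group acts properly on the base, averages of local scale functions can be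
glued to a scale function that is invariant under all automorphisms. -/
theorem exists_invariant_scaleFunction [SecondCountableTopology B] [ProperSMul C.Aut M]
    (hχ : ContMDiff (𝓡 m) 𝓘(ℝ, ℝ) ∞ χ) (hχ0 : ∀ p, 0 < χ p) :
    ∃ f : B → ℝ, IsScaleFunction (b := b) χ f ∧ ∀ (Φ : C.Aut) u, f (Φ.1 u) = f u := by
  rcases isEmpty_or_nonempty B with hB | ⟨⟨u₀⟩⟩
  · exact ⟨fun _ => 1, ⟨contMDiff_const, fun u => hB.elim u, fun u => hB.elim u⟩,
      fun _ u => hB.elim u⟩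
  have : Nonempty M := ⟨C.π u₀⟩
  have := C.isTopologicalGroup_aut
  have := C.locallyCompactSpace_aut
  let _ : MeasurableSpace C.Aut := borel C.Aut
  have : BorelSpace C.Aut := ⟨rfl⟩
  let μ : Measure C.Aut := Measure.haar
  choose ρ h K hK hρ hρ0 hρx hρK hh hh0 hne hact using fun v : B =>
    C.exists_local_scale hχ hχ0 (C.π v)
  have hhK : ∀ v u, C.π u ∉ K v → h v u = 0 := fun v u hu => by
    by_contra hc
    exact (hne v u).1 hc (hρK v _ hu)
  have hρs : ∀ v, ContMDiff (𝓡 b) 𝓘(ℝ, ℝ) ∞ fun u => ρ v (C.π u) := fun v =>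
    (hρ v).comp C.contMDiff_π
  let f : B → B → ℝ := fun v => C.average μ (h v)
  let a : B → B → ℝ := fun v => C.average μ fun u => ρ v (C.π u)
  have hf : ∀ v, ContMDiff (𝓡 b) 𝓘(ℝ, ℝ) ∞ (f v) := fun v =>
    contMDiff_average μ (hK v) (hh v) (hhK v)
  have ha : ∀ v, ContMDiff (𝓡 b) 𝓘(ℝ, ℝ) ∞ (a v) := fun v =>
    contMDiff_average μ (hK v) (hρs v) fun u hu => hρK v _ hu
  have hapos : ∀ v u, 0 < a v u ↔ ∃ Φ : C.Aut, ρ v (C.π (Φ.1 u)) ≠ 0 := fun v u =>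
    average_pos_iff μ (hK v) (hρs v).continuous (fun u => hρ0 v _) (fun u hu => hρK v _ hu) u
  have hfa : ∀ v u, 0 < a v u → 0 < f v u := fun v u hpos => by
    rw [hapos] at hpos
    obtain ⟨Φ, hΦ⟩ := hpos
    exact (average_pos_iff μ (hK v) (hh v).continuous (hh0 v) (hhK v) u).2 ⟨Φ, (hne v _).2 hΦ⟩
  obtain ⟨s, hs, hsu⟩ := TopologicalSpace.countable_cover_nhds (f := fun v => {u | 0 < a v u})
    fun v => (isOpen_lt continuous_const (ha v).continuous).mem_nhds
      ((hapos v v).2 ⟨1, hρx v⟩)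
  have hsn : s.Nonempty := by
    obtain ⟨v, hv, -⟩ := Set.mem_iUnion₂.1 (hsu ▸ Set.mem_univ u₀)
    exact ⟨v, hv⟩
  obtain ⟨v, rfl⟩ := hs.exists_eq_range hsn
  have hcov : ∀ u, ∃ k, 0 < a (v k) u := fun u => by
    obtain ⟨_, ⟨k, rfl⟩, hk⟩ := Set.mem_iUnion₂.1 (hsu ▸ Set.mem_univ u)
    exact ⟨k, hk⟩
  refine ⟨glue (fun k => f (v k)) (fun k => a (v k)),
    ⟨contMDiff_glue (fun k => hf _) (fun k => ha _) hcov,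
      glue_pos (fun k => (ha _).continuous) hcov (fun k u => average_nonneg μ (hh0 _) u)
        (fun k u => hfa _ u) (fun k u => average_nonneg μ (fun u => hρ0 _ _) u),
      fun u p => glue_eq_mul (fun k => average_act μ (fun u => hact _ u p) u) fun k => ?_⟩,
    fun Φ u => ?_⟩
  · refine (average_act μ (p := p) (c := 1) (fun u => ?_) u).trans (one_mul _)
    rw [C.π_act, one_mul]
  · have := glue_eq_mul (c := 1) (f := fun k => f (v k)) (a := fun k => a (v k)) (u := u)
      (v := Φ.1 u) (fun k => (average_aut μ _ Φ u).trans (one_mul _).symm)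
      fun k => average_aut μ _ Φ u
    rwa [one_mul] at this

end InvariantScale
end CartanGeometry

end ParabolicGeometry

end

theorem proposition3p2 {n m b d : ℕ}
    {G : Type*} [TopologicalSpace G] [T2Space G] [SecondCountableTopology G]
    [ChartedSpace (EuclideanSpace ℝ (Fin n)) G] [Group G] [LieGroup (𝓡 n) ∞ G]
    (P : Subgroup G) [ChartedSpace (EuclideanSpace ℝ (Fin m)) P] [LieGroup (𝓡 m) ∞ P]
    (gr : ParabolicGeometry.KGrading (GroupLieAlgebra (𝓡 n) G))
    (hP : ParabolicGeometry.IsParabolicType (m := m) P gr)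
    {B : Type*} [TopologicalSpace B] [T2Space B] [SecondCountableTopology B]
    [ChartedSpace (EuclideanSpace ℝ (Fin b)) B] [IsManifold (𝓡 b) ∞ B] [MulAction Pᵐᵒᵖ B]
    {M : Type*} [TopologicalSpace M] [T2Space M] [SecondCountableTopology M]
    [ChartedSpace (EuclideanSpace ℝ (Fin d)) M] [IsManifold (𝓡 d) ∞ M]
    (C : ParabolicGeometry.CartanGeometry n m b d P B M)
    (lam : ParabolicGeometry.ScaleRepresentation (m := m) P gr) :
    (C.IsEssential lam → ¬ ProperSMul C.Aut M) ∧
    (ProperSMul C.Aut M → ∃ W : C.ExactWeylStructure lam,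
      C.exactAut W = Set.univ ∧ C.weylAut W.weyl = Set.univ) := by
  have key : ProperSMul C.Aut M → ∃ W : C.ExactWeylStructure lam,
      C.exactAut W = Set.univ ∧ C.weylAut W.weyl = Set.univ := by
    intro hproper
    have := hP.isKilling
    obtain ⟨ε, hε⟩ := gr.exists_isGradingElement
    obtain ⟨c, hc, hlam⟩ := hε.exists_eq_smul lam.E_mem lam.E_central
      (lam.E_scalar (-1) (by norm_num))
    obtain ⟨χ, hχ, hχ0, hχ1, hχ2, hχ3⟩ := hP.exists_extend_scale hε lam
    obtain ⟨f, hf, hinv⟩ := C.exists_invariant_scaleFunction hχ hχ0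
    exact C.exists_exactWeylStructure hP hε hc hlam hχ hχ1 hχ2 hχ0 hχ3 hf hinv
  refine ⟨fun hess hproper => ?_, key⟩
  obtain ⟨W, hW, -⟩ := key hproper
  exact (hess W).ne hW
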